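/- Let $N\subset\mathbb R^2$ be a lattice of rank $2$, $M=\operatorname{Hom}(N,\mathbb Z)$, and let $\Delta$ be a complete fan in $\mathbb R^2$, rational with respect to $N$ and regular (each of its cones is generated by part of a $\mathbb Z$-basis of $N$). For a fan $\Delta$ rational with respect to $N$, write $T_N\,\mathrm{emb}(\Delta)$ for the associated complex toric surface, obtained by gluing the affine surfaces $U_\sigma=\operatorname{Spec}\mathbb C[\check\sigma\cap M]$, $\sigma\in\Delta$, along the $U_{\sigma\cap\tau}$. Let $\phi:N\to N$ be a $\mathbb Z$-linear map with eigenvalues $\rho_1,\rho_2\in\mathbb C$ such that $|\rho_1|>|\rho_2|$; equivalently $\lambda_1^2>e$, where $\lambda_1=|\rho_1|$ and $e=|\rho_1\rho_2|=|\det\phi|$. Then there is a fan $\Delta'$, rational with respect to $N$ and refining $\Delta$ (same support, every cone of $\Delta'$ contained in a cone of $\Delta$), such that the rational self-map $f$ of $T_N\,\mathrm{emb}(\Delta')$ which extends the endomorphism of the torus $T_N=\operatorname{Hom}(M,\mathbb C^*)$ induced by $\phi$ is algebraically stable, that is, $\bigcup_{k\ge 0} f^{-k}(I(f))$ is a countable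 set of points, where $I(f)$ is the indeterminacy set of $f$. Moreover, $\Delta'$ can be chosen such that in addition there is a sublattice $N'\subset N$ of finite index with respect to which $\Delta'$ is regular. -/

import Mathlib

noncomputable section

/-- The ambient real plane. Only its structure of topological vector space matters here. -/
abbrev Plane : Type := Fin 2 → ℝ

/-- A fan of strictly convex rational polyhedral cones with respect to a lattice `N` of the
plane. -/
structure Fan (N : Submodule ℤ Plane) where
  /-- the cones of the fan -/
  cones : Set (PointedCone ℝ Plane)
  finite : cones.Finite
  /-- the singleton `{0}` is a cone of the fan -/
  bot_mem : ⊥ ∈ cones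
  /-- every cone is generated by finitely many lattice vectors -/
  rational : ∀ σ ∈ cones, ∃ s : Finset Plane,
    (s : Set Plane) ⊆ (N : Set Plane) ∧ σ = PointedCone.hull ℝ (s : Set Plane)
  /-- every cone is strict, `σ ∩ (-σ) = {0}` -/
  strict : ∀ σ ∈ cones, ∀ x : Plane, x ∈ σ → -x ∈ σ → x = 0
  face_mem : ∀ σ ∈ cones, ∀ τ : PointedCone ℝ Plane, τ.IsFaceOf σ → τ ∈ cones
  inter_isFaceOf : ∀ σ ∈ cones, ∀ τ ∈ cones, (σ ⊓ τ).IsFaceOf σ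

namespace Fan

variable {N : Submodule ℤ Plane}

/-- The support of a fan is the union of its cones. -/
def support (Δ : Fan N) : Set Plane := {x | ∃ σ ∈ Δ.cones, x ∈ σ}

/-- A fan is complete when its support is the whole plane. -/
def IsComplete (Δ : Fan N) : Prop := Δ.support = Set.univ

/-- A cone is regular with respect to a rank two lattice `L` when it is generated by a part of a
`ℤ`-basis of `L`. -/
def IsRegularCone (L : Submodule ℤ Plane) (σ : PointedCone ℝ Plane) : Prop :=
  ∃ (b : Module.Basis (Fin 2) ℤ L) (s : Set (Fin 2)),
    σ = PointedCone.hull ℝ ((fun i => (b i : Plane)) '' s)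

/-- A fan is regular with respect to a lattice `L` when all its cones are. -/
def IsRegular (Δ : Fan N) (L : Submodule ℤ Plane) : Prop :=
  ∀ σ ∈ Δ.cones, IsRegularCone L σ

/-- `Δ'` is a refinement of `Δ`: it has the same support, and each of its cones lies in a cone
of `Δ`. -/
def Refines (Δ' Δ : Fan N) : Prop :=
  Δ'.support = Δ.support ∧ ∀ σ' ∈ Δ'.cones, ∃ σ ∈ Δ.cones, σ' ≤ σ

end Fan

namespace Toric

/-- The dual lattice `M = Hom (N, ℤ)`. -/
abbrev DualLattice (N : Submodule ℤ Plane) : Type := N →ₗ[ℤ] ℤ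

/-- The semigroup `S_σ` of all `m ∈ M` that are nonnegative on `σ`. Since the cones of a fan are
generated by lattice vectors, it is enough to test `m` on the lattice vectors of `σ`. -/
def semigroup (N : Submodule ℤ Plane) (σ : PointedCone ℝ Plane) :
    AddSubmonoid (DualLattice N) where
  carrier := {m | ∀ n : N, (n : Plane) ∈ σ → 0 ≤ m n}
  zero_mem' := fun _ _ => le_refl _
  add_mem' := fun hm hm' n hn => add_nonneg (hm n hn) (hm' n hn)

theorem semigroup_anti (N : Submodule ℤ Plane) {τ σ : PointedCone ℝ Plane} (h : τ ≤ σ) :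
    semigroup N σ ≤ semigroup N τ :=
  fun _ hm n hn => hm n (h hn)

/-- The points of the affine toric surface `U_σ = Spec ℂ[S_σ]`: the maps `u : S_σ → ℂ` with
`u 0 = 1` and `u (m + m') = u m * u m'`. -/
abbrev AffinePoint (N : Submodule ℤ Plane) (σ : PointedCone ℝ Plane) : Type :=
  Multiplicative (semigroup N σ) →* ℂ

/-- The embedding `U_τ → U_σ` for `τ ≤ σ`, by restriction from `S_τ` to `S_σ`. -/
def AffinePoint.restrict {N : Submodule ℤ Plane} {τ σ : PointedCone ℝ Plane} (h : τ ≤ σ)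
    (u : AffinePoint N τ) : AffinePoint N σ :=
  u.comp (AddMonoidHom.toMultiplicative (AddSubmonoid.inclusion (semigroup_anti N h)))

/-- The coordinate ring `ℂ[S_σ]` of `U_σ`. -/
abbrev CoordRing (N : Submodule ℤ Plane) (σ : PointedCone ℝ Plane) : Type :=
  AddMonoidAlgebra ℂ (semigroup N σ)

/-- The coordinate ring `ℂ[M]` of the torus `T_N = Hom (M, ℂ^*)`. -/
abbrev TorusRing (N : Submodule ℤ Plane) : Type := AddMonoidAlgebra ℂ (DualLattice N)

/-- The value of a regular function on `U_σ` at a point. -/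
def evalAt {N : Submodule ℤ Plane} {σ : PointedCone ℝ Plane} (u : AffinePoint N σ) :
    CoordRing N σ →ₐ[ℂ] ℂ :=
  AddMonoidAlgebra.lift ℂ ℂ (semigroup N σ) u

/-- Restriction to the torus of the regular functions on `U_σ`. -/
def toTorus (N : Submodule ℤ Plane) (σ : PointedCone ℝ Plane) :
    CoordRing N σ →ₐ[ℂ] TorusRing N :=
  AddMonoidAlgebra.mapDomainAlgHom ℂ ℂ (semigroup N σ).subtype

/-- Gluing of the affine charts: a point of `U_σ` and a point of `U_τ` are identified when they
come from one point of `U_(σ ∩ τ)`. -/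
def Glue {N : Submodule ℤ Plane} (Δ : Fan N)
    (p q : Σ σ : Δ.cones, AffinePoint N (σ : PointedCone ℝ Plane)) : Prop :=
  ∃ w : AffinePoint N ((p.1 : PointedCone ℝ Plane) ⊓ (q.1 : PointedCone ℝ Plane)),
    w.restrict inf_le_left = p.2 ∧ w.restrict inf_le_right = q.2

/-- The (points of the) toric surface of the fan `Δ`, obtained by gluing the affine toric surfaces
`U_σ`, `σ ∈ Δ`, along their open subsets `U_(σ ∩ τ)`. -/
def Surface {N : Submodule ℤ Plane} (Δ : Fan N) : Type := Quot (Glue Δ)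

/-- The chart `U_σ → Surface Δ`. -/
def Surface.chart {N : Submodule ℤ Plane} (Δ : Fan N) (σ : Δ.cones)
    (u : AffinePoint N (σ : PointedCone ℝ Plane)) : Surface Δ :=
  Quot.mk (Glue Δ) ⟨σ, u⟩

/-- The function `h` on the torus lies in the local ring of `U_σ` at `u` (it is a quotient
`a / b` of regular functions on `U_σ` with `b u ≠ 0`), and its value at `u` is `z`. -/
def IsRegularWithValue {N : Submodule ℤ Plane} {σ : PointedCone ℝ Plane} (u : AffinePoint N σ)
    (h : TorusRing N) (z : ℂ) : Prop :=
  ∃ a b : CoordRing N σ, evalAt u b ≠ 0 ∧ toTorus N σ a = toTorus N σ b * h ∧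
    z = evalAt u a / evalAt u b

/-- The comorphism `ℂ[M] → ℂ[M]` of the group endomorphism of `T_N` induced by `φ : N → N`; it
sends the character of `m` to the character of `m ∘ φ`. -/
def comorphism {N : Submodule ℤ Plane} (φ : N →ₗ[ℤ] N) : TorusRing N →ₐ[ℂ] TorusRing N :=
  AddMonoidAlgebra.mapDomainAlgHom ℂ ℂ φ.dualMap.toAddMonoidHom

/-- The rational self-map `f` of the toric surface of `Δ` that extends the endomorphism of the
torus induced by `φ` is regular (holomorphic) at `x`, and `f x = y`. That is, in some affine chart
`U_τ` around `y`, every regular function `g` on `U_τ` pulls back to an element of the local ring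
at `x` whose value at `x` is `g y`. -/
def MapsTo {N : Submodule ℤ Plane} (Δ : Fan N) (φ : N →ₗ[ℤ] N) (x y : Surface Δ) : Prop :=
  ∃ (σ : Δ.cones) (u : AffinePoint N (σ : PointedCone ℝ Plane))
    (τ : Δ.cones) (v : AffinePoint N (τ : PointedCone ℝ Plane)),
    x = Surface.chart Δ σ u ∧ y = Surface.chart Δ τ v ∧
    ∀ g : CoordRing N (τ : PointedCone ℝ Plane),
      IsRegularWithValue u (comorphism φ (toTorus N τ g)) (evalAt v g)

/-- The indeterminacy set of `f`: the points at which `f` is not regular. -/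
def indeterminacy {N : Submodule ℤ Plane} (Δ : Fan N) (φ : N →ₗ[ℤ] N) : Set (Surface Δ) :=
  {x | ¬ ∃ y, MapsTo Δ φ x y}

/-- The inverse image of a set by `f`, as a map defined outside the indeterminacy set. -/
def preimage {N : Submodule ℤ Plane} (Δ : Fan N) (φ : N →ₗ[ℤ] N) (B : Set (Surface Δ)) :
    Set (Surface Δ) :=
  {x | ∃ y ∈ B, MapsTo Δ φ x y}

/-- Algebraic stability: the union over `k ≥ 0` of the sets `f^(-k) (I f)`, where `I f` is the
indeterminacy set, is a countable set of points. The term `k = 0` is `I f` itself, so taking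
inverse images through the graph of `f`, which can only add points of `I f` at each step, gives
the same union. -/
def IsAlgebraicallyStable {N : Submodule ℤ Plane} (Δ : Fan N) (φ : N →ₗ[ℤ] N) : Prop :=
  (⋃ k : ℕ, (preimage Δ φ)^[k] (indeterminacy Δ φ)).Countable

end Toric

end

/-! ### Charts, regular functions and algebraic stability of toric surfaces -/

noncomputable section

namespace Toric

open AddMonoidAlgebra

variable {N : Submodule ℤ Plane} {σ τ : PointedCone ℝ Plane}

/-! Eigenvalues of different moduli are real, say `r₁` and `r₂`, and eigenforms `ξ`, `η` of `φ`
serve as coordinates of the plane. The line `η = 0` attracts directions and the line `ξ = 0` repels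
them.

Toric side (`isAlgebraicallyStable_of_invariant`). If `φ` maps a cone `σ` into a cone `τ`, then `f`
is regular on `U_σ`. If `φ` maps each cone of a family `G` into a cone of `G`, then `f` is regular
on the union `V` of the charts of `G` and maps `V` to itself, so `I(f)` and all its iterated
preimages avoid `V`. When `G` contains the zero cone and all rays, the complement of `V` consists of
at most one torus-fixed point for each remaining cone and is finite. It thus suffices to find a
refinement in which each ray goes to zero, into a ray, or into a two-dimensional cone belonging to a
family that `φ` preserves.

Combinatorial side (`exists_stable_refinement`). Take a sublattice `N'` with `k N ⊆ N' ⊆ N` and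
sectors unimodular for `N'`: attracting ones along `η = 0`, which `φ` maps into one another, and
repelling ones along `ξ = 0`, which no vector enters from outside under `φ`. Outside the sectors use
as rays all primitive vectors of `N'` with `|η| ≤ B |ξ| ^ γ`, where `γ < 1` is close to `1`
(`fareySet`). These are finitely many, because the attracting sectors keep them away from `η = 0`.
They form a regular fan, because `t ↦ t ^ γ` is concave: a primitive vector in the triangle `0, u,
w` satisfies the bound if `u` and `w` do (`isUnimodularSystem_fareySet`). They are stable under `φ`,
because `|r₂| < |r₁|`: dividing `φ u` by its content, which is at least `1 / k`, preserves the bound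
once `γ` is close to `1` (`exists_rpow_exponent`). A large `B` makes the rays include those of `Δ`.

The sectors exist in either case. If no lattice vector lies on an eigenline, thin sectors with
nearly symmetric slopes surround both lines (`exists_isBalanced`). Otherwise both eigenlines are
rational and serve as edges of the sectors (`exists_stable_refinement_of_eigenvectors`). -/

theorem toTorus_injective (N : Submodule ℤ Plane) (σ : PointedCone ℝ Plane) :
    Function.Injective (toTorus N σ) :=
  AddMonoidAlgebra.mapDomain_injective Subtype.val_injective

theorem toTorus_single (m : semigroup N σ) (c : ℂ) :
    toTorus N σ (single m c) = single (m : DualLattice N) c := by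
  simp [toTorus]

theorem evalAt_single (u : AffinePoint N σ) (m : semigroup N σ) (c : ℂ) :
    evalAt u (single m c) = c * u (Multiplicative.ofAdd m) := by
  simp [evalAt]

theorem comorphism_single (φ : N →ₗ[ℤ] N) (m : DualLattice N) (c : ℂ) :
    comorphism φ (single m c) = single (m.comp φ) c := by
  simp [comorphism, LinearMap.dualMap_apply']

/-- The inclusion of coordinate rings `ℂ[S_σ] → ℂ[S_τ]` for `τ ≤ σ`. -/
def CoordRing.incl (h : τ ≤ σ) : CoordRing N σ →ₐ[ℂ] CoordRing N τ :=
  AddMonoidAlgebra.mapDomainAlgHom ℂ ℂ (AddSubmonoid.inclusion (semigroup_anti N h))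

theorem CoordRing.incl_single (h : τ ≤ σ) (m : semigroup N σ) (c : ℂ) :
    CoordRing.incl h (single m c) = single ⟨m, semigroup_anti N h m.2⟩ c := by
  simp [CoordRing.incl]; rfl

theorem toTorus_incl (h : τ ≤ σ) (a : CoordRing N σ) :
    toTorus N τ (CoordRing.incl h a) = toTorus N σ a := by
  have : (toTorus N τ).comp (CoordRing.incl h) = toTorus N σ := by
    apply AddMonoidAlgebra.algHom_ext
    · intro m
      simp only [AlgHom.comp_apply, CoordRing.incl_single, toTorus_single]
    · exact Subsingleton.elim _ _
  exact DFunLike.congr_fun this a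

theorem evalAt_restrict (h : τ ≤ σ) (u : AffinePoint N τ) (a : CoordRing N σ) :
    evalAt (u.restrict h) a = evalAt u (CoordRing.incl h a) := by
  have : evalAt (u.restrict h) = (evalAt u).comp (CoordRing.incl h) := by
    apply AddMonoidAlgebra.algHom_ext
    · intro m
      simp only [AlgHom.comp_apply, CoordRing.incl_single, evalAt_single]
      rfl
    · exact Subsingleton.elim _ _
  exact DFunLike.congr_fun this a

/-- Two fractions for one function agree after cross-multiplication, since `ℂ[S_σ]` embeds in
`ℂ[M]`. -/
theorem IsRegularWithValue.unique {u : AffinePoint N σ} {h : TorusRing N} {z z' : ℂ}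
    (H : IsRegularWithValue u h z) (H' : IsRegularWithValue u h z') : z = z' := by
  obtain ⟨a, b, hb, hab, rfl⟩ := H
  obtain ⟨a', b', hb', hab', rfl⟩ := H'
  have : a * b' = a' * b := by
    apply toTorus_injective N σ
    rw [map_mul, map_mul, hab, hab']
    ring
  rw [div_eq_div_iff hb hb', ← map_mul, ← map_mul, this]

theorem IsRegularWithValue.one (u : AffinePoint N σ) : IsRegularWithValue u 1 1 :=
  ⟨1, 1, by simp, by simp, by simp⟩

theorem IsRegularWithValue.mul {u : AffinePoint N σ} {h h' : TorusRing N} {z z' : ℂ}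
    (H : IsRegularWithValue u h z) (H' : IsRegularWithValue u h' z') :
    IsRegularWithValue u (h * h') (z * z') := by
  obtain ⟨a, b, hb, hab, rfl⟩ := H
  obtain ⟨a', b', hb', hab', rfl⟩ := H'
  refine ⟨a * a', b * b', by simp [hb, hb'], ?_, by simp [mul_div_mul_comm]⟩
  rw [map_mul, map_mul, hab, hab']
  ring

theorem IsRegularWithValue.of_coordRing (u : AffinePoint N σ) (a : CoordRing N σ) :
    IsRegularWithValue u (toTorus N σ a) (evalAt u a) :=
  ⟨a, 1, by simp, by simp, by simp⟩

theorem IsRegularWithValue.character (u : AffinePoint N σ) (m : semigroup N σ) :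
    IsRegularWithValue u (single (m : DualLattice N) 1) (u (Multiplicative.ofAdd m)) := by
  have := IsRegularWithValue.of_coordRing u (single m 1)
  rwa [toTorus_single, evalAt_single, one_mul] at this

/-- `m` cuts out `τ` in `σ`, in the sense that `S_τ = S_σ + ℕ (-m)`. -/
structure CutsOut (N : Submodule ℤ Plane) (σ τ : PointedCone ℝ Plane) (m : DualLattice N) :
    Prop where
  mem : m ∈ semigroup N σ
  neg_mem : -m ∈ semigroup N τ
  exists_add_mem : ∀ m' ∈ semigroup N τ, ∃ k : ℕ, m' + k • m ∈ semigroup N σ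

/-- `ℂ[S_τ]` is a localisation of `ℂ[S_σ]` at the character of `m`: a power of that character clears
the denominators of any given element. -/
theorem CutsOut.exists_mul {m : DualLattice N} (hm : CutsOut N σ τ m) (a : CoordRing N τ) :
    ∃ (k : ℕ) (a' : CoordRing N σ), toTorus N σ a' = single (k • m) 1 * toTorus N τ a := by
  induction a using AddMonoidAlgebra.induction_on with
  | of m' =>
    obtain ⟨k, hk⟩ := hm.exists_add_mem m' m'.2
    refine ⟨k, single ⟨_, hk⟩ 1, ?_⟩
    rw [toTorus_single, AddMonoidAlgebra.of_apply, toTorus_single, single_mul_single]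
    exact congrArg₂ single (add_comm _ _) (one_mul 1).symm
  | add a b ha hb =>
    obtain ⟨k, a', ha'⟩ := ha
    obtain ⟨l, b', hb'⟩ := hb
    refine ⟨k + l, single (l • ⟨m, hm.mem⟩) 1 * a' + single (k • ⟨m, hm.mem⟩) 1 * b', ?_⟩
    rw [map_add, map_mul, map_mul, ha', hb', toTorus_single, toTorus_single, map_add, mul_add,
      ← mul_assoc, ← mul_assoc, single_mul_single, single_mul_single]
    simp only [AddSubmonoidClass.coe_nsmul, ← add_smul, one_mul]
    rw [add_comm l k, add_comm]
  | smul r a ha =>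
    obtain ⟨k, a', ha'⟩ := ha
    exact ⟨k, r • a', by rw [map_smul, map_smul, ha', mul_smul_comm]⟩

theorem CutsOut.apply_ne_zero {m : DualLattice N} (hm : CutsOut N σ τ m) (hle : τ ≤ σ)
    (w : AffinePoint N τ) : w.restrict hle (Multiplicative.ofAdd ⟨m, hm.mem⟩) ≠ 0 := by
  intro h0
  have h1 : w (Multiplicative.ofAdd ⟨m, semigroup_anti N hle hm.mem⟩) *
      w (Multiplicative.ofAdd ⟨-m, hm.neg_mem⟩) = 1 := by
    rw [← map_mul, ← ofAdd_add, ← map_one w, ← ofAdd_zero]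
    congr 2
    ext1
    simp
  have h2 : w (Multiplicative.ofAdd ⟨m, semigroup_anti N hle hm.mem⟩) = 0 := h0
  simp [h2] at h1

/-- `U_τ` is the open subset of `U_σ` where the character of `m` does not vanish, so the local ring
at a point of `U_τ` is the same in both charts. -/
theorem isRegularWithValue_restrict {m : DualLattice N} (hm : CutsOut N σ τ m) (hle : τ ≤ σ)
    (w : AffinePoint N τ) (h : TorusRing N) (z : ℂ) :
    IsRegularWithValue (w.restrict hle) h z ↔ IsRegularWithValue w h z := by
  constructor
  · rintro ⟨a, b, hb, hab, rfl⟩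
    refine ⟨CoordRing.incl hle a, CoordRing.incl hle b, ?_, ?_, ?_⟩
    · rwa [← evalAt_restrict]
    · rwa [toTorus_incl, toTorus_incl]
    · rw [evalAt_restrict, evalAt_restrict]
  · rintro ⟨a, b, hb, hab, rfl⟩
    obtain ⟨k, a', ha'⟩ := hm.exists_mul a
    obtain ⟨l, b', hb'⟩ := hm.exists_mul b
    set M : ℕ → CoordRing N σ := fun j => single (j • ⟨m, hm.mem⟩) 1 with hM
    have hMt : ∀ j, toTorus N σ (M j) = single (j • m) 1 := fun j => by
      rw [hM, toTorus_single, AddSubmonoidClass.coe_nsmul]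
    have hMe : ∀ j, evalAt (w.restrict hle) (M j) ≠ 0 := fun j => by
      rw [hM, evalAt_single, one_mul, ofAdd_nsmul, map_pow]
      exact pow_ne_zero _ (hm.apply_ne_zero hle w)
    have key : ∀ (j : ℕ) (c : CoordRing N τ) (c' : CoordRing N σ),
        toTorus N σ c' = single (j • m) 1 * toTorus N τ c →
        evalAt (w.restrict hle) c' = evalAt (w.restrict hle) (M j) * evalAt w c := by
      intro j c c' hc
      rw [evalAt_restrict, evalAt_restrict, ← map_mul]
      congr 1
      apply toTorus_injective N τ
      rw [map_mul, toTorus_incl, toTorus_incl, hc, hMt]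
    have ea := key k a a' ha'
    have eb := key l b b' hb'
    -- Numerator and denominator were cleared with exponents `k` and `l`; the extra factors bring
    -- both to `k + l`.
    refine ⟨M l * a', M k * b', ?_, ?_, ?_⟩
    · rw [map_mul, eb]
      exact mul_ne_zero (hMe k) (mul_ne_zero (hMe l) hb)
    · rw [map_mul, map_mul, ha', hb', hab, hMt, hMt]
      ring
    · rw [map_mul, map_mul, ea, eb]
      have := hMe k
      have := hMe l
      field_simp

/-- In a separated fan, any two cones are separated by an integral linear form that vanishes exactly
on their intersection. -/
def IsSeparated (Δ : Fan N) : Prop :=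
  ∀ σ ∈ Δ.cones, ∀ τ ∈ Δ.cones, ∃ m, CutsOut N σ (σ ⊓ τ) m ∧ -m ∈ semigroup N τ

theorem isRegularWithValue_congr {Δ : Fan N} (hΔ : IsSeparated Δ) {σ τ : Δ.cones}
    {u : AffinePoint N (σ : PointedCone ℝ Plane)} {v : AffinePoint N (τ : PointedCone ℝ Plane)}
    (huv : Surface.chart Δ σ u = Surface.chart Δ τ v) (h : TorusRing N) (z : ℂ) :
    IsRegularWithValue u h z ↔ IsRegularWithValue v h z := by
  let F : Surface Δ → Prop := Quot.lift (fun p => IsRegularWithValue p.2 h z) (by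
    rintro ⟨p, u⟩ ⟨q, v⟩ ⟨w, hu, hv⟩
    dsimp only at hu hv ⊢
    obtain ⟨m, hm, -⟩ := hΔ p p.2 q q.2
    obtain ⟨m', hm', -⟩ := hΔ q q.2 p p.2
    rw [inf_comm] at hm'
    rw [← hu, ← hv, isRegularWithValue_restrict hm, isRegularWithValue_restrict hm'])
  have : F (Surface.chart Δ σ u) = F (Surface.chart Δ τ v) := by rw [huv]
  exact iff_of_eq this

/-- Uniqueness of values makes the values of regular characters multiplicative, so they define a
point. Used with `ψ` the identity to move a point to a smaller chart, and with `ψ` dual to `φ` to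
compare image points. -/
theorem exists_affinePoint (u : AffinePoint N σ) (ψ : DualLattice N →+ DualLattice N)
    (H : ∀ m ∈ semigroup N τ, ∃ z, IsRegularWithValue u (single (ψ m) 1) z) :
    ∃ w : AffinePoint N τ, ∀ m : semigroup N τ,
      IsRegularWithValue u (single (ψ m) 1) (w (Multiplicative.ofAdd m)) := by
  choose f hf using H
  refine ⟨{ toFun := fun m => f m.toAdd m.toAdd.2, map_one' := ?_, map_mul' := ?_ }, ?_⟩
  · refine (hf _ _).unique ?_
    convert IsRegularWithValue.one u
    simp [AddMonoidAlgebra.one_def]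
  · intro m m'
    refine (hf _ _).unique ?_
    have := (hf _ m.toAdd.2).mul (hf _ m'.toAdd.2)
    rwa [single_mul_single, one_mul, ← map_add] at this
  · intro m
    exact hf _ _

theorem CutsOut.exists_restrict_eq {m : DualLattice N} (hm : CutsOut N σ τ m) (hle : τ ≤ σ)
    (u : AffinePoint N σ) (hu : u (Multiplicative.ofAdd ⟨m, hm.mem⟩) ≠ 0) :
    ∃ w : AffinePoint N τ, w.restrict hle = u := by
  obtain ⟨w, hw⟩ := exists_affinePoint (τ := τ) u (AddMonoidHom.id _) (by
    intro m' hm'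
    obtain ⟨k, hk⟩ := hm.exists_add_mem m' hm'
    refine ⟨_, single ⟨_, hk⟩ 1, single (k • ⟨m, hm.mem⟩) 1, ?_, ?_, rfl⟩
    · rw [evalAt_single, one_mul, ofAdd_nsmul, map_pow]
      exact pow_ne_zero _ hu
    · rw [toTorus_single, toTorus_single, single_mul_single, AddSubmonoidClass.coe_nsmul]
      exact congrArg₂ single (add_comm _ _) (one_mul 1).symm)
  refine ⟨w, MonoidHom.ext fun m' => ?_⟩
  exact (hw ⟨m'.toAdd, semigroup_anti N hle m'.toAdd.2⟩).unique
    (IsRegularWithValue.character u m'.toAdd)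

theorem chart_restrict (Δ : Fan N) (σ τ : Δ.cones)
    (hle : (τ : PointedCone ℝ Plane) ≤ (σ : PointedCone ℝ Plane))
    (u : AffinePoint N (τ : PointedCone ℝ Plane)) :
    Surface.chart Δ σ (u.restrict hle) = Surface.chart Δ τ u :=
  Quot.sound ⟨u.restrict (le_inf hle le_rfl), rfl, rfl⟩

/-- This is separatedness of the surface: two images in `U_τ` and `U_τ'` come from one point of
`U_(τ ∩ τ')`. -/
theorem MapsTo.unique {Δ : Fan N} (hΔ : IsSeparated Δ) {φ : N →ₗ[ℤ] N} {x y y' : Surface Δ}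
    (h : MapsTo Δ φ x y) (h' : MapsTo Δ φ x y') : y = y' := by
  obtain ⟨σ, u, τ, v, hx, rfl, H⟩ := h
  obtain ⟨σ', u', τ', v', hx', rfl, H'⟩ := h'
  replace H' : ∀ g : CoordRing N (τ' : PointedCone ℝ Plane),
      IsRegularWithValue u (comorphism φ (toTorus N τ' g)) (evalAt v' g) := fun g =>
    (isRegularWithValue_congr hΔ (hx.symm.trans hx') _ _).2 (H' g)
  have H1 : ∀ m : semigroup N (τ : PointedCone ℝ Plane), IsRegularWithValue u
      (single ((m : DualLattice N).comp φ) 1) (v (Multiplicative.ofAdd m)) := fun m => by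
    have := H (single m 1)
    rwa [toTorus_single, comorphism_single, evalAt_single, one_mul] at this
  have H2 : ∀ m : semigroup N (τ' : PointedCone ℝ Plane), IsRegularWithValue u
      (single ((m : DualLattice N).comp φ) 1) (v' (Multiplicative.ofAdd m)) := fun m => by
    have := H' (single m 1)
    rwa [toTorus_single, comorphism_single, evalAt_single, one_mul] at this
  obtain ⟨m, hm, hmτ'⟩ := hΔ τ τ.2 τ' τ'.2
  obtain ⟨w, hw⟩ := exists_affinePoint
    (τ := (τ : PointedCone ℝ Plane) ⊓ (τ' : PointedCone ℝ Plane)) u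
    φ.dualMap.toAddMonoidHom (by
      intro m' hm'
      obtain ⟨k, hk⟩ := hm.exists_add_mem m' hm'
      -- Write `m' = (m' + k m) + k (-m)`; the first summand lies in `S_τ`, the second in `S_τ'`.
      have := (H1 ⟨_, hk⟩).mul (H2 (k • ⟨-m, hmτ'⟩))
      rw [single_mul_single, one_mul] at this
      refine ⟨_, (congrArg (fun l => IsRegularWithValue u (single l 1) _) ?_).mp this⟩
      ext n
      simp)
  apply Quot.sound
  refine ⟨w, MonoidHom.ext fun m => ?_, MonoidHom.ext fun m => ?_⟩
  · exact (hw ⟨m.toAdd, semigroup_anti N inf_le_left m.toAdd.2⟩).unique (H1 m.toAdd)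
  · exact (hw ⟨m.toAdd, semigroup_anti N inf_le_right m.toAdd.2⟩).unique (H2 m.toAdd)

/-- Composition with `φ` sends `S_τ` to `S_σ`, so `f` restricts to a morphism `U_σ → U_τ`. -/
theorem exists_mapsTo (Δ : Fan N) (φ : N →ₗ[ℤ] N) (σ τ : Δ.cones)
    (hφ : ∀ n : N, (n : Plane) ∈ (σ : PointedCone ℝ Plane) →
      (φ n : Plane) ∈ (τ : PointedCone ℝ Plane))
    (u : AffinePoint N (σ : PointedCone ℝ Plane)) :
    ∃ v : AffinePoint N (τ : PointedCone ℝ Plane),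
      MapsTo Δ φ (Surface.chart Δ σ u) (Surface.chart Δ τ v) := by
  let F : semigroup N (τ : PointedCone ℝ Plane) →+ semigroup N (σ : PointedCone ℝ Plane) :=
    { toFun := fun m => ⟨(m : DualLattice N).comp φ, fun n hn => m.2 _ (hφ n hn)⟩
      map_zero' := rfl
      map_add' := fun _ _ => rfl }
  refine ⟨u.comp (AddMonoidHom.toMultiplicative F), σ, u, τ, _, rfl, rfl, fun g => ?_⟩
  let G : CoordRing N (τ : PointedCone ℝ Plane) →ₐ[ℂ] CoordRing N (σ : PointedCone ℝ Plane) :=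
    AddMonoidAlgebra.mapDomainAlgHom ℂ ℂ F
  have hG : ∀ m c, G (single m c) = single (F m) c := fun m c => by simp [G]
  have h1 : (comorphism φ).comp (toTorus N τ) = (toTorus N σ).comp G := by
    apply AddMonoidAlgebra.algHom_ext
    · intro m
      simp only [AlgHom.comp_apply, toTorus_single, comorphism_single, hG]
      rfl
    · exact Subsingleton.elim _ _
  have h2 : evalAt (u.comp (AddMonoidHom.toMultiplicative F)) = (evalAt u).comp G := by
    apply AddMonoidAlgebra.algHom_ext
    · intro m
      simp only [AlgHom.comp_apply, evalAt_single, hG]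
      rfl
    · exact Subsingleton.elim _ _
  have e1 := DFunLike.congr_fun h1 g
  have e2 := DFunLike.congr_fun h2 g
  rw [AlgHom.comp_apply, AlgHom.comp_apply] at e1
  rw [AlgHom.comp_apply] at e2
  rw [e1, e2]
  exact IsRegularWithValue.of_coordRing u (G g)

/-- A separated fan is algebraically stable as soon as `φ` maps each cone of a family `G` into a
cone of `G`, and all proper faces of the remaining cones belong to `G`. -/
theorem isAlgebraicallyStable_of_invariant {Δ : Fan N} (hΔ : IsSeparated Δ) {φ : N →ₗ[ℤ] N}
    (G : Set (PointedCone ℝ Plane)) (hG : G ⊆ Δ.cones)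
    (hmap : ∀ σ ∈ G, ∃ τ ∈ G, ∀ n : N, (n : Plane) ∈ σ → (φ n : Plane) ∈ τ)
    (hface : ∀ σ ∈ Δ.cones, σ ∉ G → ∀ m ∈ semigroup N σ, m ≠ 0 → ∃ τ ∈ G, τ ≤ σ ∧
      ∀ m₀ ∈ semigroup N σ, -m₀ ∈ semigroup N τ → ∃ j : ℕ, j • m - m₀ ∈ semigroup N σ) :
    IsAlgebraicallyStable Δ φ := by
  classical
  set V : Set (Surface Δ) := {x | ∃ σ : Δ.cones, (σ : PointedCone ℝ Plane) ∈ G ∧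
    ∃ u, x = Surface.chart Δ σ u} with hV
  have hVmap : ∀ x ∈ V, ∃ y ∈ V, MapsTo Δ φ x y := by
    rintro x ⟨σ, hσ, u, rfl⟩
    obtain ⟨τ, hτ, h⟩ := hmap σ hσ
    obtain ⟨v, hv⟩ := exists_mapsTo Δ φ σ ⟨τ, hG hτ⟩ h u
    exact ⟨_, ⟨⟨τ, hG hτ⟩, hτ, v, rfl⟩, hv⟩
  have hsub : ∀ k : ℕ, (preimage Δ φ)^[k] (indeterminacy Δ φ) ⊆ Vᶜ := by
    intro k
    induction k with
    | zero =>
      intro x hx hxV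
      obtain ⟨y, -, hy⟩ := hVmap x hxV
      exact hx ⟨y, hy⟩
    | succ k ih =>
      rw [Function.iterate_succ_apply']
      rintro x ⟨y, hy, hxy⟩ hxV
      obtain ⟨y', hy', hxy'⟩ := hVmap x hxV
      exact ih hy (hxy.unique hΔ hxy' ▸ hy')
  -- A point outside `V` is the torus-fixed point of its chart. If the character of some `m ≠ 0` did
  -- not vanish there, neither would that of `m₀`, which divides a power of it, and the point would
  -- lie in `U_τ ⊆ V`.
  have hunique : ∀ σ : Δ.cones, (σ : PointedCone ℝ Plane) ∉ G →
      ∀ u, Surface.chart Δ σ u ∉ V → ∀ m, m ≠ 1 → u m = 0 := by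
    intro σ hσ u hu m hm
    by_contra hum
    apply hu
    obtain ⟨τ, hτ, hle, hj⟩ := hface σ σ.2 hσ m.toAdd m.toAdd.2 (by
      intro h0
      exact hm (Subtype.ext h0))
    obtain ⟨m₀, hm₀, hneg⟩ := hΔ σ σ.2 τ (hG hτ)
    rw [inf_eq_right.2 hle] at hm₀
    obtain ⟨j, hj⟩ := hj m₀ hm₀.mem hneg
    have hne : u (Multiplicative.ofAdd ⟨m₀, hm₀.mem⟩) ≠ 0 := by
      intro h0
      have h1 : u (m ^ j) = u (Multiplicative.ofAdd ⟨_, hj⟩) *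
          u (Multiplicative.ofAdd ⟨m₀, hm₀.mem⟩) := by
        rw [← map_mul]
        congr 1
        apply Multiplicative.toAdd.injective
        ext1
        simp
      rw [h0, mul_zero, map_pow] at h1
      exact pow_ne_zero j hum h1
    obtain ⟨w, hw⟩ := hm₀.exists_restrict_eq hle u hne
    refine ⟨⟨τ, hG hτ⟩, hτ, w, ?_⟩
    rw [← hw]
    exact chart_restrict Δ σ ⟨τ, hG hτ⟩ hle w
  have hfin : (Vᶜ).Finite := by
    have := Δ.finite.to_subtype
    refine (Set.finite_iUnion (f := fun σ : Δ.cones => {x | x ∈ Vᶜ ∧ ∃ u,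
      x = Surface.chart Δ σ u}) fun σ => Set.Subsingleton.finite ?_).subset ?_
    · rintro x ⟨hx, u, rfl⟩ y ⟨hy, v, rfl⟩
      by_cases hσ : (σ : PointedCone ℝ Plane) ∈ G
      · exact absurd ⟨σ, hσ, u, rfl⟩ hx
      · congr 1
        refine MonoidHom.ext fun m => ?_
        by_cases hm : m = 1
        · simp [hm]
        · rw [hunique σ hσ u hx m hm, hunique σ hσ v hy m hm]
    · intro x hx
      induction x using Quot.ind with
      | mk p => exact Set.mem_iUnion.2 ⟨p.1, hx, p.2, rfl⟩
  exact (hfin.subset (Set.iUnion_subset hsub)).countable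

end Toric
end

/-! ### The area form and the cells of a line arrangement -/

noncomputable section

section Area

variable (e : Module.Basis (Fin 2) ℝ Plane)

/-- The oriented area form of the plane for which the basis `e` has area `1`. -/
def area (x y : Plane) : ℝ := e.repr x 0 * e.repr y 1 - e.repr x 1 * e.repr y 0

variable {e}

theorem area_add_left (x y z : Plane) : area e (x + y) z = area e x z + area e y z := by
  simp [area]; ring

theorem area_add_right (x y z : Plane) : area e x (y + z) = area e x y + area e x z := by
  simp [area]; ring

theorem area_smul_left (c : ℝ) (x y : Plane) : area e (c • x) y = c * area e x y := by
  simp [area]; ring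

theorem area_smul_right (c : ℝ) (x y : Plane) : area e x (c • y) = c * area e x y := by
  simp [area]; ring

theorem area_neg_left (x y : Plane) : area e (-x) y = -area e x y := by
  simp [area]; ring

theorem area_neg_right (x y : Plane) : area e x (-y) = -area e x y := by
  simp [area]; ring

theorem area_self (x : Plane) : area e x x = 0 := by
  simp [area]; ring

theorem area_swap (x y : Plane) : area e y x = -area e x y := by
  simp [area]; ring

theorem area_zero_right (x : Plane) : area e x 0 = 0 := by
  simp [area]

theorem area_zero_left (x : Plane) : area e 0 x = 0 := by
  simp [area]

theorem area_basis : area e (e 0) (e 1) = 1 := by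
  simp [area]

theorem area_basis_zero_left (x : Plane) : area e (e 0) x = e.repr x 1 := by
  simp [area]

theorem area_basis_one_left (x : Plane) : area e (e 1) x = -e.repr x 0 := by
  simp [area]

theorem area_smul_eq (u w z : Plane) : area e u w • z = area e z w • u + area e u z • w := by
  apply e.repr.injective
  ext i
  fin_cases i <;> simp [area] <;> ring

theorem eq_of_area_eq_one {u w : Plane} (h : area e u w = 1) (z : Plane) :
    z = area e z w • u + area e u z • w := by
  rw [← area_smul_eq, h, one_smul]

/-- The Plücker relation. -/
theorem area_mul_area (u v z w : Plane) :
    area e u v * area e z w = area e u z * area e v w + area e u w * area e z v := by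
  simp only [area]; ring

theorem area_between_trans_left {u v w z : Plane} (huv : 0 < area e u v) (hvw : 0 < area e v w)
    (huw : 0 < area e u w) (huz : 0 < area e u z) (hzv : 0 < area e z v) : 0 < area e z w := by
  have := area_mul_area (e := e) u v z w
  have h1 : 0 < area e u v * area e z w := by rw [this]; positivity
  exact pos_of_mul_pos_right h1 huv.le

theorem area_between_trans_right {u v w z : Plane} (huv : 0 < area e u v) (hvw : 0 < area e v w)
    (huw : 0 < area e u w) (hvz : 0 < area e v z) (hzw : 0 < area e z w) : 0 < area e u z := by
  have : area e v w * area e u z = area e u v * area e z w + area e u w * area e v z := by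
    simp only [area]; ring
  have h1 : 0 < area e v w * area e u z := by rw [this]; positivity
  exact pos_of_mul_pos_right h1 hvw.le

theorem area_eq_intCast {x y : Plane} (hx : x ∈ Submodule.span ℤ (Set.range e))
    (hy : y ∈ Submodule.span ℤ (Set.range e)) : ∃ k : ℤ, area e x y = k := by
  rw [e.mem_span_iff_repr_mem ℤ] at hx hy
  obtain ⟨a, ha⟩ := hx 0
  obtain ⟨b, hb⟩ := hx 1
  obtain ⟨c, hc⟩ := hy 0
  obtain ⟨d, hd⟩ := hy 1
  refine ⟨a * d - b * c, ?_⟩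
  simp only [area, ← ha, ← hb, ← hc, ← hd]
  simp

end Area

theorem PointedCone.mem_hull_pair {u w z : Plane} :
    z ∈ PointedCone.hull ℝ {u, w} ↔ ∃ a b : ℝ, 0 ≤ a ∧ 0 ≤ b ∧ z = a • u + b • w := by
  constructor
  · intro h
    obtain ⟨a, b, rfl⟩ := Submodule.mem_span_pair.1 h
    exact ⟨a, b, a.2, b.2, rfl⟩
  · rintro ⟨a, b, ha, hb, rfl⟩
    exact Submodule.mem_span_pair.2 ⟨⟨a, ha⟩, ⟨b, hb⟩, rfl⟩

theorem PointedCone.mem_hull_singleton {u z : Plane} :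
    z ∈ PointedCone.hull ℝ {u} ↔ ∃ a : ℝ, 0 ≤ a ∧ z = a • u := by
  constructor
  · intro h
    obtain ⟨a, rfl⟩ := Submodule.mem_span_singleton.1 h
    exact ⟨a, a.2, rfl⟩
  · rintro ⟨a, ha, rfl⟩
    exact Submodule.mem_span_singleton.2 ⟨⟨a, ha⟩, rfl⟩

/-- A finite symmetric set of vectors of the lattice spanned by `e`, which contains `e` and in which
any two vectors without a third one strictly between them have area one. -/
structure IsUnimodularSystem (e : Module.Basis (Fin 2) ℝ Plane) (U : Set Plane) : Prop where
  finite : U.Finite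
  neg_mem : ∀ u ∈ U, -u ∈ U
  basis_mem : ∀ i, e i ∈ U
  subset_span : U ⊆ Submodule.span ℤ (Set.range e)
  exists_between : ∀ u ∈ U, ∀ w ∈ U, 0 < area e u w → area e u w ≠ 1 →
    ∃ v ∈ U, 0 < area e u v ∧ 0 < area e v w

/-- The smallest cone containing `x` of the arrangement of the lines spanned by `U`. -/
def cell (e : Module.Basis (Fin 2) ℝ Plane) (U : Set Plane) (x : Plane) :
    PointedCone ℝ Plane where
  carrier := {y | ∀ v ∈ U, 0 ≤ area e v x → 0 ≤ area e v y}
  add_mem' := fun ha hb v hv hx => by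
    rw [area_add_right]
    exact add_nonneg (ha v hv hx) (hb v hv hx)
  zero_mem' := fun v _ _ => (area_zero_right v).ge
  smul_mem' := fun c y hy v hv hx => by
    have : c • y = (c : ℝ) • y := rfl
    rw [this, area_smul_right]
    exact mul_nonneg c.2 (hy v hv hx)

section Cell

variable {e : Module.Basis (Fin 2) ℝ Plane} {U : Set Plane}

theorem mem_cell {x y : Plane} :
    y ∈ cell e U x ↔ ∀ v ∈ U, 0 ≤ area e v x → 0 ≤ area e v y := Iff.rfl

theorem self_mem_cell (x : Plane) : x ∈ cell e U x := fun _ _ h => h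

namespace IsUnimodularSystem

/-- By symmetry of `U`, the one-sided condition defining a cell also controls the opposite sign. -/
theorem area_nonpos_of_mem_cell (hU : IsUnimodularSystem e U) {x y v : Plane}
    (hy : y ∈ cell e U x) (hv : v ∈ U) (h : area e v x ≤ 0) : area e v y ≤ 0 := by
  have := hy (-v) (hU.neg_mem v hv) (by rw [area_neg_left]; linarith)
  rw [area_neg_left] at this
  linarith

theorem cell_zero (hU : IsUnimodularSystem e U) : cell e U 0 = ⊥ := by
  refine eq_bot_iff.2 fun y hy => ?_
  have h : ∀ i, area e (e i) y = 0 := fun i => le_antisymm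
    (hU.area_nonpos_of_mem_cell hy (hU.basis_mem i) (area_zero_right _).le)
    (hy _ (hU.basis_mem i) (area_zero_right _).ge)
  have h0 := h 0
  have h1 := h 1
  rw [area_basis_zero_left] at h0
  rw [area_basis_one_left, neg_eq_zero] at h1
  refine (Submodule.mem_bot _).2 (e.repr.injective ?_)
  ext i
  fin_cases i <;> simp [h0, h1]

/-- No line spanned by `U` crosses the sector between adjacent `u` and `w`, so a form `area e v`
that is nonnegative at an interior point is nonnegative at both edges. -/
theorem cell_pair (hU : IsUnimodularSystem e U) {u w x : Plane} (hu : u ∈ U) (hw : w ∈ U)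
    (huw : area e u w = 1) (hno : ∀ v ∈ U, 0 < area e u v → area e v w ≤ 0)
    (hux : 0 < area e u x) (hxw : 0 < area e x w) :
    cell e U x = PointedCone.hull ℝ {u, w} := by
  have key : ∀ v ∈ U, 0 ≤ area e v x → 0 ≤ area e v u ∧ 0 ≤ area e v w := by
    intro v hv hvx
    rw [eq_of_area_eq_one huw x, area_add_right, area_smul_right, area_smul_right] at hvx
    constructor
    · by_contra! h
      have h1 := hno v hv (by rw [area_swap]; linarith)
      nlinarith
    · by_contra! h
      have h1 := hno (-v) (hU.neg_mem v hv)
      rw [area_neg_left, area_neg_right, area_swap, neg_neg] at h1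
      by_cases h2 : 0 < area e v u
      · linarith [h1 h2]
      · nlinarith
  ext y
  rw [PointedCone.mem_hull_pair]
  constructor
  · intro hy
    refine ⟨area e y w, area e u y, ?_, hy u hu hux.le, eq_of_area_eq_one huw y⟩
    have := hU.area_nonpos_of_mem_cell hy hw (by rw [area_swap]; linarith)
    rw [area_swap] at this
    linarith
  · rintro ⟨a, b, ha, hb, rfl⟩ v hv hvx
    obtain ⟨h1, h2⟩ := key v hv hvx
    rw [area_add_right, area_smul_right, area_smul_right]
    positivity

theorem cell_ray (hU : IsUnimodularSystem e U) {u w : Plane} (hu : u ∈ U) (hw : w ∈ U)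
    (huw : area e u w = 1) {a : ℝ} (ha : 0 < a) :
    cell e U (a • u) = PointedCone.hull ℝ {u} := by
  ext y
  rw [PointedCone.mem_hull_singleton]
  constructor
  · intro hy
    have hz : area e u (a • u) = 0 := by rw [area_smul_right, area_self, mul_zero]
    have h1 := le_antisymm (hU.area_nonpos_of_mem_cell hy hu hz.le) (hy u hu hz.ge)
    refine ⟨area e y w, ?_, ?_⟩
    · have := hU.area_nonpos_of_mem_cell hy hw (by
        rw [area_smul_right, area_swap, huw]; linarith)
      rw [area_swap] at this
      linarith
    · conv_lhs => rw [eq_of_area_eq_one huw y, h1, zero_smul, add_zero]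
  · rintro ⟨b, hb, rfl⟩ v hv hvx
    rw [area_smul_right] at hvx ⊢
    exact mul_nonneg hb (nonneg_of_mul_nonneg_right hvx ha)

/-- Start from a quadrant of `e` around `x`. As long as a vector of `U` lies strictly between `u`
and `w`, let it replace the edge that keeps `x` inside. The number of vectors in between drops, and
when none is left `exists_between` forces area one. -/
theorem exists_adjacent (hU : IsUnimodularSystem e U) {x : Plane} (hx : x ≠ 0) :
    ∃ u ∈ U, ∃ w ∈ U, area e u w = 1 ∧ (∀ v ∈ U, 0 < area e u v → area e v w ≤ 0) ∧
      0 < area e x w ∧ 0 ≤ area e u x := by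
  have step : ∀ (n : ℕ) (u w : Plane), u ∈ U → w ∈ U → 0 < area e u w → 0 < area e x w →
      0 ≤ area e u x → {v | v ∈ U ∧ 0 < area e u v ∧ 0 < area e v w}.ncard = n →
      ∃ u ∈ U, ∃ w ∈ U, area e u w = 1 ∧ (∀ v ∈ U, 0 < area e u v → area e v w ≤ 0) ∧
      0 < area e x w ∧ 0 ≤ area e u x := by
    intro n
    induction n using Nat.strong_induction_on with
    | _ n ih =>
      intro u w hu hw huw hxw hux hn
      have hfin : {v | v ∈ U ∧ 0 < area e u v ∧ 0 < area e v w}.Finite :=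
        hU.finite.subset fun v hv => hv.1
      by_cases hb : ∃ v ∈ U, 0 < area e u v ∧ 0 < area e v w
      · obtain ⟨v, hv, huv, hvw⟩ := hb
        by_cases hxv : 0 < area e x v
        · refine ih _ ?_ u v hu hv huv hxv hux rfl
          rw [← hn]
          refine Set.ncard_lt_ncard ⟨fun z hz => ⟨hz.1, hz.2.1, ?_⟩, fun h => ?_⟩ hfin
          · exact area_between_trans_left huv hvw huw hz.2.1 hz.2.2
          · have := (h ⟨hv, huv, hvw⟩ : v ∈ _).2.2
            rw [area_self] at this
            exact lt_irrefl _ this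
        · refine ih _ ?_ v w hv hw hvw hxw (by rw [area_swap]; linarith) rfl
          rw [← hn]
          refine Set.ncard_lt_ncard ⟨fun z hz => ⟨hz.1, ?_, hz.2.2⟩, fun h => ?_⟩ hfin
          · exact area_between_trans_right huv hvw huw hz.2.1 hz.2.2
          · have := (h ⟨hv, huv, hvw⟩ : v ∈ _).2.1
            rw [area_self] at this
            exact lt_irrefl _ this
      · push Not at hb
        refine ⟨u, hu, w, hw, ?_, hb, hxw, hux⟩
        by_contra h1
        obtain ⟨v, hv, huv, hvw⟩ := hU.exists_between u hu w hw huw h1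
        exact absurd hvw (hb v hv huv).not_gt
  have h0 := hU.basis_mem 0
  have h1 := hU.basis_mem 1
  have h0' := hU.neg_mem _ h0
  have h1' := hU.neg_mem _ h1
  have hX : e.repr x 0 ≠ 0 ∨ e.repr x 1 ≠ 0 := by
    by_contra! h
    apply hx
    apply e.repr.injective
    ext i
    fin_cases i <;> simp [h.1, h.2]
  -- The half-open quadrants, each with its first edge, partition the nonzero vectors.
  rcases lt_trichotomy (e.repr x 0) 0 with hx0 | hx0 | hx0 <;>
  rcases lt_trichotomy (e.repr x 1) 0 with hx1 | hx1 | hx1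
  · refine step _ _ _ h0' h1' ?_ ?_ ?_ rfl <;> simp [area] <;> linarith
  · refine step _ _ _ h0' h1' ?_ ?_ ?_ rfl <;> simp [area] <;> linarith
  · refine step _ _ _ h1 h0' ?_ ?_ ?_ rfl <;> simp [area] <;> linarith
  · refine step _ _ _ h1' h0 ?_ ?_ ?_ rfl <;> simp [area] <;> linarith
  · simp [hx0, hx1] at hX
  · refine step _ _ _ h1 h0' ?_ ?_ ?_ rfl <;> simp [area] <;> linarith
  · refine step _ _ _ h1' h0 ?_ ?_ ?_ rfl <;> simp [area] <;> linarith
  · refine step _ _ _ h0 h1 ?_ ?_ ?_ rfl <;> simp [area] <;> linarith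
  · refine step _ _ _ h0 h1 ?_ ?_ ?_ rfl <;> simp [area] <;> linarith

/-- Every cell is the zero cone, a ray or a sector spanned by two adjacent vectors of `U`. -/
theorem cell_cases (hU : IsUnimodularSystem e U) (x : Plane) :
    (x = 0 ∧ cell e U x = ⊥) ∨
    ∃ u ∈ U, ∃ w ∈ U, area e u w = 1 ∧ (∀ v ∈ U, 0 < area e u v → area e v w ≤ 0) ∧
      ((∃ a : ℝ, 0 < a ∧ x = a • u) ∧ cell e U x = PointedCone.hull ℝ {u} ∨
        (0 < area e x w ∧ 0 < area e u x) ∧ cell e U x = PointedCone.hull ℝ {u, w}) := by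
  by_cases hx : x = 0
  · exact Or.inl ⟨hx, by rw [hx]; exact hU.cell_zero⟩
  · obtain ⟨u, hu, w, hw, huw, hno, hxw, hux⟩ := hU.exists_adjacent hx
    refine Or.inr ⟨u, hu, w, hw, huw, hno, ?_⟩
    rcases hux.eq_or_lt with h | h
    · have hxu : x = area e x w • u := by
        conv_lhs => rw [eq_of_area_eq_one huw x, ← h, zero_smul, add_zero]
      refine Or.inl ⟨⟨_, hxw, hxu⟩, ?_⟩
      rw [hxu]
      exact hU.cell_ray hu hw huw hxw
    · exact Or.inr ⟨⟨hxw, h⟩, hU.cell_pair hu hw huw hno h hxw⟩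

end IsUnimodularSystem

end Cell
end

/-! ### The fan of cells: faces, regularity, refinement -/

noncomputable section

namespace IsUnimodularSystem

variable {e : Module.Basis (Fin 2) ℝ Plane} {U : Set Plane}

/-- A cell depends only on the subset of `U` whose forms are nonnegative at `x`. -/
theorem finite_range_cell (hU : IsUnimodularSystem e U) : (Set.range (cell e U)).Finite := by
  classical
  refine ((hU.finite.finite_subsets).image (fun A : Set Plane =>
    {y : Plane | ∀ v ∈ A, 0 ≤ area e v y})).preimage
      (f := fun C : PointedCone ℝ Plane => (C : Set Plane)) SetLike.coe_injective.injOn |>.subset ?_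
  rintro _ ⟨x, rfl⟩
  refine ⟨{v ∈ U | 0 ≤ area e v x}, Set.sep_subset _ _, ?_⟩
  ext y
  simp [mem_cell]

theorem eq_zero_of_mem_cell_of_neg_mem (hU : IsUnimodularSystem e U) {x y : Plane}
    (hy : y ∈ cell e U x) (hy' : -y ∈ cell e U x) : y = 0 := by
  have h : ∀ i, area e (e i) y = 0 := fun i => by
    rcases le_total 0 (area e (e i) x) with h | h
    · have h1 := hy _ (hU.basis_mem i) h
      have h2 := hy' _ (hU.basis_mem i) h
      rw [area_neg_right] at h2
      linarith
    · have h1 := hU.area_nonpos_of_mem_cell hy (hU.basis_mem i) h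
      have h2 := hU.area_nonpos_of_mem_cell hy' (hU.basis_mem i) h
      rw [area_neg_right] at h2
      linarith
  rw [← Submodule.mem_bot (R := {c : ℝ // 0 ≤ c}), ← hU.cell_zero]
  intro v hv _
  have h0 := h 0
  have h1 := h 1
  rw [area_basis_zero_left] at h0
  rw [area_basis_one_left, neg_eq_zero] at h1
  simp [area, h0, h1]

/-- A face containing a positive combination of `u` and `w` contains both, so it is spanned by a
subset of the generators, and each such span is a cell. -/
theorem exists_eq_cell_of_isFaceOf (hU : IsUnimodularSystem e U) {x : Plane}
    {τ : PointedCone ℝ Plane} (hτ : τ.IsFaceOf (cell e U x)) : ∃ y, τ = cell e U y := by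
  have hface : ∀ p q : Plane, ∀ a b : ℝ, p ∈ cell e U x → q ∈ cell e U x → 0 ≤ a → 0 ≤ b →
      a • p + b • q ∈ τ → (a = 0 ∨ p ∈ τ) ∧ (b = 0 ∨ q ∈ τ) := by
    intro p q a b hp hq ha hb h
    constructor
    · rcases ha.eq_or_lt with h0 | h0
      · exact Or.inl h0.symm
      · exact Or.inr (hτ.mem_of_smul_add_mem hp ((cell e U x).smul_mem hb hq) h0 h)
    · rcases hb.eq_or_lt with h0 | h0
      · exact Or.inl h0.symm
      · rw [add_comm] at h
        exact Or.inr (hτ.mem_of_smul_add_mem hq ((cell e U x).smul_mem ha hp) h0 h)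
  have hbot : ∀ {τ : PointedCone ℝ Plane}, τ ≤ ⊥ → ∃ y, τ = cell e U y := fun h =>
    ⟨0, by rw [hU.cell_zero]; exact eq_bot_iff.2 h⟩
  rcases hU.cell_cases x with ⟨-, h⟩ | ⟨u, hu, w, hw, huw, -, ⟨-, h⟩ | ⟨-, h⟩⟩
  · exact hbot (h ▸ hτ.le)
  · have hux : u ∈ cell e U x := by
      rw [h]; exact Submodule.subset_span rfl
    by_cases huτ : u ∈ τ
    · refine ⟨x, le_antisymm hτ.le ?_⟩
      rw [h]
      exact Submodule.span_le.2 (by simpa using huτ)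
    · refine hbot fun y hy => ?_
      obtain ⟨a, ha, rfl⟩ := PointedCone.mem_hull_singleton.1 (h ▸ hτ.le hy)
      have := (hface u u a 0 hux hux ha le_rfl (by simpa using hy)).1
      simp [huτ] at this
      simp [this]
  · have hux : u ∈ cell e U x := by
      rw [h]; exact Submodule.subset_span (by simp)
    have hwx : w ∈ cell e U x := by
      rw [h]; exact Submodule.subset_span (by simp)
    have hform : ∀ y ∈ τ, ∃ a b : ℝ, 0 ≤ a ∧ 0 ≤ b ∧ y = a • u + b • w ∧ (a = 0 ∨ u ∈ τ) ∧
        (b = 0 ∨ w ∈ τ) := by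
      intro y hy
      obtain ⟨a, b, ha, hb, rfl⟩ := PointedCone.mem_hull_pair.1 (h ▸ hτ.le hy)
      exact ⟨a, b, ha, hb, rfl, hface u w a b hux hwx ha hb hy⟩
    by_cases huτ : u ∈ τ <;> by_cases hwτ : w ∈ τ
    · refine ⟨x, le_antisymm hτ.le ?_⟩
      rw [h]
      exact Submodule.span_le.2 (by simp [Set.insert_subset_iff, huτ, hwτ])
    · refine ⟨(1 : ℝ) • u, ?_⟩
      rw [hU.cell_ray hu hw huw one_pos]
      refine le_antisymm (fun y hy => ?_) (Submodule.span_le.2 (by simpa using huτ))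
      obtain ⟨a, b, ha, hb, rfl, -, hb'⟩ := hform y hy
      refine PointedCone.mem_hull_singleton.2 ⟨a, ha, ?_⟩
      simp [hb'.resolve_right hwτ]
    · refine ⟨(1 : ℝ) • w, ?_⟩
      -- `w` needs a partner of area one on its other side, and `-u` is one.
      rw [hU.cell_ray hw (hU.neg_mem u hu)
        (by rw [area_neg_right, area_swap, neg_neg, huw]) one_pos]
      refine le_antisymm (fun y hy => ?_) (Submodule.span_le.2 (by simpa using hwτ))
      obtain ⟨a, b, ha, hb, rfl, ha', -⟩ := hform y hy
      refine PointedCone.mem_hull_singleton.2 ⟨b, hb, ?_⟩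
      simp [ha'.resolve_right huτ]
    · refine hbot fun y hy => ?_
      obtain ⟨a, b, ha, hb, rfl, ha', hb'⟩ := hform y hy
      simp [ha'.resolve_right huτ, hb'.resolve_right hwτ]

/-- Every form `area e v`, `v ∈ U`, has constant sign on `cell e U x`. The intersection requires
some forms that are nonpositive on this cell to vanish, which cuts out a face. -/
theorem inf_cell_isFaceOf (hU : IsUnimodularSystem e U) (x y : Plane) :
    (cell e U x ⊓ cell e U y).IsFaceOf (cell e U x) := by
  refine ⟨inf_le_left, ?_⟩
  intro p q a hp hq ha h
  refine ⟨hp, fun v hv hvy => ?_⟩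
  have h1 := h.2 v hv hvy
  rw [area_add_right, area_smul_right] at h1
  rcases le_total 0 (area e v x) with h0 | h0
  · exact hp v hv h0
  · have hvq := hU.area_nonpos_of_mem_cell hq hv h0
    exact nonneg_of_mul_nonneg_right (by linarith) ha

/-- For a pair of area one Cramer's rule has denominator one, so lattice vectors have integral
coordinates. -/
theorem exists_lattice_basis {u w : Plane} (hU : IsUnimodularSystem e U) (hu : u ∈ U)
    (hw : w ∈ U) (huw : area e u w = 1) :
    ∃ b : Module.Basis (Fin 2) ℤ (Submodule.span ℤ (Set.range e)),
      (b 0 : Plane) = u ∧ (b 1 : Plane) = w := by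
  have huL := hU.subset_span hu
  have hwL := hU.subset_span hw
  let v : Fin 2 → Submodule.span ℤ (Set.range e) := ![⟨u, huL⟩, ⟨w, hwL⟩]
  have hli : LinearIndependent ℤ v := by
    rw [LinearIndependent.pair_iff]
    intro s t hst
    have hst' : (s : ℝ) • u + (t : ℝ) • w = 0 := by
      have : s • u + t • w = 0 := congrArg Subtype.val hst
      rwa [← Int.cast_smul_eq_zsmul ℝ, ← Int.cast_smul_eq_zsmul ℝ] at this
    have h1 := congrArg (fun z => area e z w) hst'
    have h2 := congrArg (fun z => area e u z) hst'
    simp only [area_add_left, area_add_right, area_smul_left, area_smul_right, area_self, huw,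
      area_zero_left, area_zero_right, mul_one, mul_zero, add_zero, zero_add] at h1 h2
    exact ⟨by exact_mod_cast h1, by exact_mod_cast h2⟩
  have hspan : ⊤ ≤ Submodule.span ℤ (Set.range v) := by
    rintro ⟨z, hz⟩ -
    obtain ⟨a, ha⟩ := area_eq_intCast hz hwL
    obtain ⟨b, hb⟩ := area_eq_intCast huL hz
    have hz' : (⟨z, hz⟩ : Submodule.span ℤ (Set.range e)) = a • v 0 + b • v 1 := by
      apply Subtype.ext
      have := eq_of_area_eq_one huw z
      rwa [ha, hb, Int.cast_smul_eq_zsmul, Int.cast_smul_eq_zsmul] at this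
    rw [hz']
    exact add_mem (Submodule.smul_mem _ _ (Submodule.subset_span ⟨0, rfl⟩))
      (Submodule.smul_mem _ _ (Submodule.subset_span ⟨1, rfl⟩))
  exact ⟨Module.Basis.mk hli hspan, by simp [v], by simp [v]⟩

theorem cell_isRegularCone (hU : IsUnimodularSystem e U) (x : Plane) :
    Fan.IsRegularCone (Submodule.span ℤ (Set.range e)) (cell e U x) := by
  rcases hU.cell_cases x with ⟨-, h⟩ | ⟨u, hu, w, hw, huw, -, ⟨-, h⟩ | ⟨-, h⟩⟩
  · obtain ⟨b, -⟩ := hU.exists_lattice_basis (hU.basis_mem 0) (hU.basis_mem 1) area_basis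
    exact ⟨b, ∅, by simp [h, PointedCone.hull]⟩
  · obtain ⟨b, hb, -⟩ := hU.exists_lattice_basis hu hw huw
    exact ⟨b, {0}, by simp [h, hb]⟩
  · obtain ⟨b, hb, hb'⟩ := hU.exists_lattice_basis hu hw huw
    exact ⟨b, {0, 1}, by simp [h, hb, hb', Set.image_insert_eq]⟩

/-- The complete fan of all cells of the line arrangement given by a unimodular system. -/
def fan (hU : IsUnimodularSystem e U) (N : Submodule ℤ Plane) (he : ∀ i, e i ∈ N) : Fan N where
  cones := Set.range (cell e U)
  finite := hU.finite_range_cell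
  bot_mem := ⟨0, hU.cell_zero⟩
  rational := by
    classical
    rintro _ ⟨x, rfl⟩
    have hUN : U ⊆ N := hU.subset_span.trans
      (Submodule.span_le.2 (Set.range_subset_iff.2 he))
    rcases hU.cell_cases x with ⟨-, h⟩ | ⟨u, hu, w, hw, -, -, ⟨-, h⟩ | ⟨-, h⟩⟩
    · exact ⟨∅, by simp, by simp [h, PointedCone.hull]⟩
    · exact ⟨{u}, by simpa using hUN hu, by simp [h]⟩
    · exact ⟨{u, w}, by simp [Set.insert_subset_iff, hUN hu, hUN hw], by simp [h]⟩
  strict := by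
    rintro _ ⟨x, rfl⟩ y
    exact hU.eq_zero_of_mem_cell_of_neg_mem
  face_mem := by
    rintro _ ⟨x, rfl⟩ τ hτ
    obtain ⟨y, hy⟩ := hU.exists_eq_cell_of_isFaceOf hτ
    exact ⟨y, hy.symm⟩
  inter_isFaceOf := by
    rintro _ ⟨x, rfl⟩ _ ⟨y, rfl⟩
    exact hU.inf_cell_isFaceOf x y

theorem fan_isRegular (hU : IsUnimodularSystem e U) (N : Submodule ℤ Plane) (he : ∀ i, e i ∈ N) :
    (hU.fan N he).IsRegular (Submodule.span ℤ (Set.range e)) := by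
  rintro _ ⟨x, rfl⟩
  exact hU.cell_isRegularCone x

theorem fan_support (hU : IsUnimodularSystem e U) (N : Submodule ℤ Plane) (he : ∀ i, e i ∈ N) :
    (hU.fan N he).support = Set.univ :=
  Set.eq_univ_of_forall fun x => ⟨_, ⟨x, rfl⟩, self_mem_cell x⟩

end IsUnimodularSystem

/-- Since `x` is in the cone, some generator `g` lies on the positive side of `u`, hence not before
`w`, and some generator `a` lies before `w`, hence not past `u`. Strictness makes the angle from `a`
to `g` less than a half turn, so the cone of `a` and `g` contains `u` and `w`. -/
theorem PointedCone.mem_of_sector {e : Module.Basis (Fin 2) ℝ Plane} {s : Set Plane}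
    (hstrict : ∀ x : Plane, x ∈ PointedCone.hull ℝ s → -x ∈ PointedCone.hull ℝ s → x = 0)
    {u w x : Plane} (huw : 0 < area e u w) (hux : 0 < area e u x) (hxw : 0 < area e x w)
    (hx : x ∈ PointedCone.hull ℝ s) (hs : ∀ g ∈ s, 0 < area e u g → area e g w ≤ 0) :
    u ∈ PointedCone.hull ℝ s ∧ w ∈ PointedCone.hull ℝ s := by
  set σ := PointedCone.hull ℝ s with hσ
  have hsmul : ∀ {c : ℝ} {z : Plane}, 0 ≤ c → z ∈ σ → c • z ∈ σ := fun {c z} hc hz =>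
    σ.smul_mem hc hz
  have hg : ∃ g ∈ s, 0 < area e u g := by
    by_contra! h
    have : ∀ z ∈ σ, area e u z ≤ 0 := by
      intro z hz
      induction hz using Submodule.span_induction with
      | mem z hz => exact h z hz
      | zero => rw [area_zero_right]
      | add a b _ _ ha hb => rw [area_add_right]; linarith
      | smul c z _ hz =>
        have : c • z = (c : ℝ) • z := rfl
        rw [this, area_smul_right]
        exact mul_nonpos_of_nonneg_of_nonpos c.2 hz
    exact absurd hux (this x hx).not_gt
  have ha : ∃ a ∈ s, 0 < area e a w := by
    by_contra! h
    have : ∀ z ∈ σ, area e z w ≤ 0 := by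
      intro z hz
      induction hz using Submodule.span_induction with
      | mem z hz => exact h z hz
      | zero => rw [area_zero_left]
      | add a b _ _ ha hb => rw [area_add_left]; linarith
      | smul c z _ hz =>
        have : c • z = (c : ℝ) • z := rfl
        rw [this, area_smul_left]
        exact mul_nonpos_of_nonneg_of_nonpos c.2 hz
    exact absurd hxw (this x hx).not_gt
  obtain ⟨g, hgs, hug⟩ := hg
  obtain ⟨a, has, haw⟩ := ha
  have hgw := hs g hgs hug
  have hua : area e u a ≤ 0 := not_lt.1 fun h => absurd haw (hs a has h).not_gt
  have hgσ : g ∈ σ := Submodule.subset_span hgs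
  have haσ : a ∈ σ := Submodule.subset_span has
  have hgx : 0 < area e x g := by
    have h1 := area_mul_area (e := e) u w x g
    have h2 := area_swap (e := e) x w
    have h3 := area_swap (e := e) g w
    nlinarith [mul_pos hug hxw, mul_nonneg hux.le (neg_nonneg.2 hgw)]
  have hax : 0 < area e a x := by
    have h1 : area e u w * area e a x = area e u x * area e a w - area e u a * area e x w := by
      simp only [area]; ring
    nlinarith [mul_pos hux haw, mul_nonneg (neg_nonneg.2 hua) hxw.le]
  rcases lt_trichotomy (area e a g) 0 with h | h | h
  · exfalso
    have h1 : -x = (area e x g / -area e a g) • a + (area e a x / -area e a g) • g := by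
      rw [div_eq_inv_mul, div_eq_inv_mul, mul_smul, mul_smul, ← smul_add, ← area_smul_eq,
        inv_neg, neg_smul, inv_smul_smul₀ h.ne]
    have h2 : -x ∈ σ := by
      rw [h1]
      exact add_mem (hsmul (div_nonneg hgx.le (by linarith)) haσ)
        (hsmul (div_nonneg hax.le (by linarith)) hgσ)
    have := hstrict x hx h2
    rw [this, area_zero_right] at hux
    exact lt_irrefl _ hux
  · exfalso
    have h0 : area e x g • a + area e a x • g = 0 := by
      rw [← area_smul_eq, h, zero_smul]
    have h1 : -a = (area e a x / area e x g) • g := by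
      rw [div_eq_inv_mul, mul_smul, ← neg_eq_of_add_eq_zero_right h0, smul_neg,
        inv_smul_smul₀ hgx.ne']
    have := hstrict a haσ (h1 ▸ hsmul (div_nonneg hax.le hgx.le) hgσ)
    rw [this, area_zero_left] at haw
    exact lt_irrefl _ haw
  · have hmem : ∀ z, 0 ≤ area e z g → 0 ≤ area e a z → z ∈ σ := by
      intro z h1 h2
      have : z = (area e z g / area e a g) • a + (area e a z / area e a g) • g := by
        rw [div_eq_inv_mul, div_eq_inv_mul, mul_smul, mul_smul, ← smul_add, ← area_smul_eq,
          inv_smul_smul₀ h.ne']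
      rw [this]
      exact add_mem (hsmul (div_nonneg h1 h.le) haσ) (hsmul (div_nonneg h2 h.le) hgσ)
    exact ⟨hmem u hug.le (by rw [area_swap]; linarith),
      hmem w (by rw [area_swap]; linarith) haw.le⟩

/-- The generators of `Δ` lie on rays of `U`, so none is interior to a two-dimensional cell; a cone
of `Δ` containing an interior point of the cell contains all of it. -/
theorem IsUnimodularSystem.fan_refines {e : Module.Basis (Fin 2) ℝ Plane} {U : Set Plane}
    (hU : IsUnimodularSystem e U) {N : Submodule ℤ Plane} (he : ∀ i, e i ∈ N) {Δ : Fan N}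
    (hΔ : Δ.IsComplete)
    (hgen : ∀ σ ∈ Δ.cones, ∃ s : Set Plane, σ = PointedCone.hull ℝ s ∧
      ∀ g ∈ s, g ≠ 0 → ∃ c : ℝ, 0 < c ∧ ∃ u ∈ U, g = c • u) :
    (hU.fan N he).Refines Δ := by
  refine ⟨by rw [hU.fan_support, hΔ], ?_⟩
  rintro _ ⟨x, rfl⟩
  obtain ⟨σ, hσ, hx⟩ : x ∈ Δ.support := hΔ ▸ Set.mem_univ x
  refine ⟨σ, hσ, ?_⟩
  rcases hU.cell_cases x with ⟨-, h⟩ | ⟨u, hu, w, hw, huw, hno, ⟨⟨a, ha, hxu⟩, h⟩ | ⟨⟨hxw, hux⟩, h⟩⟩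
  · rw [h]; exact bot_le
  · rw [h]
    refine Submodule.span_le.2 ?_
    rw [Set.singleton_subset_iff]
    have : u = a⁻¹ • x := by rw [hxu, inv_smul_smul₀ ha.ne']
    rw [this]
    exact σ.smul_mem (inv_pos.2 ha).le hx
  · obtain ⟨s, rfl, hs⟩ := hgen σ hσ
    have := PointedCone.mem_of_sector (Δ.strict _ hσ) (by rw [huw]; exact one_pos) hux hxw hx (by
      intro g hg hug
      obtain ⟨c, hc, v, hv, rfl⟩ := hs g hg (by
        rintro rfl
        rw [area_zero_right] at hug
        exact lt_irrefl _ hug)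
      rw [area_smul_right] at hug
      rw [area_smul_left]
      exact mul_nonpos_of_nonneg_of_nonpos hc.le (hno v hv (pos_of_mul_pos_right hug hc.le)))
    rw [h]
    refine Submodule.span_le.2 ?_
    simp [Set.insert_subset_iff, this]
end

/-! ### Separatedness and a stability criterion for fans of cells -/

noncomputable section

namespace IsUnimodularSystem

open Toric

variable {e : Module.Basis (Fin 2) ℝ Plane} {U : Set Plane}

/-- A uniform description of all three kinds of cell: in a smaller cell a missing generator has
coefficient zero. -/
theorem exists_generators (hU : IsUnimodularSystem e U) (x : Plane) :
    ∃ u ∈ U, ∃ w ∈ U, area e u w = 1 ∧ ∀ z ∈ cell e U x, 0 ≤ area e z w ∧ 0 ≤ area e u z ∧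
      (area e z w ≠ 0 → u ∈ cell e U x) ∧ (area e u z ≠ 0 → w ∈ cell e U x) := by
  rcases hU.cell_cases x with ⟨-, h⟩ | ⟨u, hu, w, hw, huw, -, ⟨-, h⟩ | ⟨-, h⟩⟩
  · refine ⟨_, hU.basis_mem 0, _, hU.basis_mem 1, area_basis, fun z hz => ?_⟩
    rw [h, Submodule.mem_bot] at hz
    simp [hz, area_zero_left, area_zero_right]
  · refine ⟨u, hu, w, hw, huw, fun z hz => ?_⟩
    rw [h] at hz ⊢
    obtain ⟨a, ha, rfl⟩ := PointedCone.mem_hull_singleton.1 hz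
    rw [area_smul_left, area_smul_right, huw, area_self]
    exact ⟨by linarith, by simp, fun _ => Submodule.subset_span rfl, by simp⟩
  · refine ⟨u, hu, w, hw, huw, fun z hz => ?_⟩
    rw [h] at hz ⊢
    obtain ⟨a, b, ha, hb, rfl⟩ := PointedCone.mem_hull_pair.1 hz
    rw [area_add_left, area_add_right, area_smul_left, area_smul_right, area_smul_left,
      area_smul_right, huw, area_self, area_self]
    exact ⟨by linarith, by linarith, fun _ => Submodule.subset_span (by simp),
      fun _ => Submodule.subset_span (by simp)⟩

variable {N : Submodule ℤ Plane}

theorem mem_lattice (hU : IsUnimodularSystem e U) (he : ∀ i, e i ∈ N) {u : Plane} (hu : u ∈ U) :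
    u ∈ N :=
  Submodule.span_le.2 (Set.range_subset_iff.2 he) (hU.subset_span hu)

/-- The form `area e v` is integral only on the lattice of `e`; the factor `k` makes it integral on
`N`. -/
theorem exists_intCast_area {k : ℕ}
    (hk : ∀ n ∈ N, (k : ℝ) • n ∈ Submodule.span ℤ (Set.range e)) {v : Plane}
    (hv : v ∈ Submodule.span ℤ (Set.range e)) :
    ∃ f : DualLattice N, ∀ n : N, (f n : ℝ) = k * area e v n := by
  have h : ∀ n : N, ∃ c : ℤ, k * area e v n = c := fun n => by
    obtain ⟨c, hc⟩ := area_eq_intCast hv (hk n n.2)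
    exact ⟨c, by rw [← hc, area_smul_right]⟩
  choose f hf using h
  refine ⟨(AddMonoidHom.mk' f fun a b => ?_).toIntLinearMap, fun n => (hf n).symm⟩
  have : ((f (a + b) : ℤ) : ℝ) = ((f a + f b : ℤ) : ℝ) := by
    rw [Int.cast_add, ← hf, ← hf, ← hf, Submodule.coe_add, area_add_right, mul_add]
  exact_mod_cast this

theorem mul_apply_eq {k : ℕ} (hk : ∀ n ∈ N, (k : ℝ) • n ∈ Submodule.span ℤ (Set.range e))
    (u w : N) (hu : (u : Plane) ∈ Submodule.span ℤ (Set.range e))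
    (hw : (w : Plane) ∈ Submodule.span ℤ (Set.range e)) (huw : area e u w = 1)
    (m : DualLattice N) (n : N) :
    (k : ℝ) * m n = (k * area e n w) * m u + (k * area e u n) * m w := by
  obtain ⟨a, ha⟩ := area_eq_intCast (hk n n.2) hw
  obtain ⟨b, hb⟩ := area_eq_intCast hu (hk n n.2)
  have h : k • n = a • u + b • w := by
    apply Subtype.ext
    have := eq_of_area_eq_one huw ((k : ℝ) • (n : Plane))
    rwa [ha, hb, Int.cast_smul_eq_zsmul, Int.cast_smul_eq_zsmul, Nat.cast_smul_eq_nsmul] at this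
  rw [area_smul_left] at ha
  rw [area_smul_right] at hb
  have h1 := congrArg m h
  rw [map_nsmul, map_add, map_zsmul, map_zsmul] at h1
  rw [ha, hb]
  have h2 := congrArg (Int.cast (R := ℝ)) h1
  simpa using h2

/-- A form need only be tested on the generators: `k n` is a nonnegative integral combination of
them for each `n` in the cell. -/
theorem mem_semigroup_cell (hU : IsUnimodularSystem e U) {k : ℕ} (hk0 : 0 < k)
    (hk : ∀ n ∈ N, (k : ℝ) • n ∈ Submodule.span ℤ (Set.range e)) {x : Plane} {u w : N}
    (hu : (u : Plane) ∈ U) (hw : (w : Plane) ∈ U) (huw : area e u w = 1)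
    (hcell : ∀ z ∈ cell e U x, 0 ≤ area e z w ∧ 0 ≤ area e u z ∧
      (area e z w ≠ 0 → (u : Plane) ∈ cell e U x) ∧ (area e u z ≠ 0 → (w : Plane) ∈ cell e U x))
    (m : DualLattice N) (hmu : (u : Plane) ∈ cell e U x → 0 ≤ m u)
    (hmw : (w : Plane) ∈ cell e U x → 0 ≤ m w) : m ∈ semigroup N (cell e U x) := by
  intro n hn
  obtain ⟨h1, h2, h3, h4⟩ := hcell n hn
  have hk0' : (0 : ℝ) < k := by exact_mod_cast hk0
  have hm := mul_apply_eq hk u w (hU.subset_span hu) (hU.subset_span hw) huw m n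
  have e1 : 0 ≤ (k * area e n w) * m u := by
    by_cases h : area e (n : Plane) w = 0
    · simp [h]
    · have : (0 : ℝ) ≤ m u := by exact_mod_cast hmu (h3 h)
      positivity
  have e2 : 0 ≤ (k * area e u n) * m w := by
    by_cases h : area e (u : Plane) n = 0
    · simp [h]
    · have : (0 : ℝ) ≤ m w := by exact_mod_cast hmw (h4 h)
      positivity
  have : (0 : ℝ) ≤ m n := nonneg_of_mul_nonneg_right (by linarith) hk0'
  exact_mod_cast this

theorem fan_isSeparated (hU : IsUnimodularSystem e U) (he : ∀ i, e i ∈ N) {k : ℕ} (hk0 : 0 < k)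
    (hk : ∀ n ∈ N, (k : ℝ) • n ∈ Submodule.span ℤ (Set.range e)) :
    IsSeparated (hU.fan N he) := by
  classical
  rintro _ ⟨x, rfl⟩ _ ⟨y, rfl⟩
  have hk0' : (0 : ℝ) < k := by exact_mod_cast hk0
  choose f hf using fun v : U => exists_intCast_area hk (hU.subset_span v.2)
  have := hU.finite.fintype
  -- The separating form is the sum of all forms from `U` that are nonnegative on the first cell and
  -- nonpositive on the second.
  set S : Finset U := {v | 0 ≤ area e v x ∧ area e v y ≤ 0} with hS
  set m : DualLattice N := ∑ v ∈ S, f v with hm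
  have hmx : ∀ v ∈ S, ∀ n : N, (n : Plane) ∈ cell e U x → 0 ≤ f v n := fun v hv n hn => by
    have h1 := hn v v.2 (Finset.mem_filter.1 hv).2.1
    have : (0 : ℝ) ≤ f v n := by rw [hf]; positivity
    exact_mod_cast this
  have hmy : ∀ v ∈ S, ∀ n : N, (n : Plane) ∈ cell e U y → f v n ≤ 0 := fun v hv n hn => by
    have h1 := hU.area_nonpos_of_mem_cell hn v.2 (Finset.mem_filter.1 hv).2.2
    have : (f v n : ℝ) ≤ 0 := by
      rw [hf]
      exact mul_nonpos_of_nonneg_of_nonpos hk0'.le h1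
    exact_mod_cast this
  have hm1 : m ∈ semigroup N (cell e U x) := fun n hn => by
    rw [hm, LinearMap.sum_apply]
    exact Finset.sum_nonneg fun v hv => hmx v hv n hn
  have hm2 : -m ∈ semigroup N (cell e U y) := fun n hn => by
    rw [hm, LinearMap.neg_apply, LinearMap.sum_apply, ← Finset.sum_neg_distrib]
    exact Finset.sum_nonneg fun v hv => neg_nonneg.2 (hmy v hv n hn)
  -- If `n` violated a condition `v` of the second cell, then `-v` would be one of the summands and
  -- positive at `n`, although all summands vanish there.
  have hm3 : ∀ n : N, (n : Plane) ∈ cell e U x → m n = 0 → (n : Plane) ∈ cell e U y := by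
    intro n hn h0 v hv hvy
    by_contra! hneg
    have hvx : area e v x < 0 := by
      by_contra! h
      exact absurd (hn v hv h) hneg.not_ge
    have hmem : (⟨-v, hU.neg_mem v hv⟩ : U) ∈ S := by
      rw [hS, Finset.mem_filter, area_neg_left, area_neg_left]
      exact ⟨Finset.mem_univ _, by linarith, by linarith⟩
    rw [hm, LinearMap.sum_apply, Finset.sum_eq_zero_iff_of_nonneg fun v hv => hmx v hv n hn] at h0
    have h1 := congrArg (Int.cast (R := ℝ)) (h0 _ hmem)
    rw [hf, Int.cast_zero, area_neg_left] at h1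
    rcases mul_eq_zero.1 h1 with h2 | h2
    · exact hk0'.ne' h2
    · linarith
  refine ⟨m, ⟨hm1, semigroup_anti N inf_le_right hm2, fun m' hm' => ?_⟩, hm2⟩
  obtain ⟨u, hu, w, hw, huw, hcell⟩ := hU.exists_generators x
  lift u to N using hU.mem_lattice he hu
  lift w to N using hU.mem_lattice he hw
  have key : ∀ g : N, (g : Plane) ∈ cell e U x → ∀ K : ℕ, (m' g).natAbs ≤ K →
      0 ≤ (m' + K • m) g := by
    intro g hg K hK
    have h0 := hm1 g hg
    rw [LinearMap.add_apply, LinearMap.smul_apply, nsmul_eq_mul]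
    rcases h0.eq_or_lt with h | h
    · have := hm' g ⟨hg, hm3 g hg h.symm⟩
      rw [← h]
      simpa using this
    · have h1 : (K : ℤ) * 1 ≤ K * m g := by gcongr; exact h
      omega
  refine ⟨(m' u).natAbs + (m' w).natAbs, mem_semigroup_cell hU hk0 hk hu hw huw hcell _
    (fun h => key u h _ (by omega)) (fun h => key w h _ (by omega))⟩

/-- The good cones are the cells of points of `X`. They include zero and all rays, so each remaining
cone is a sector, and its proper faces are good. -/
theorem fan_isAlgebraicallyStable (hU : IsUnimodularSystem e U) (he : ∀ i, e i ∈ N) {k : ℕ}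
    (hk0 : 0 < k) (hk : ∀ n ∈ N, (k : ℝ) • n ∈ Submodule.span ℤ (Set.range e)) (φ : N →ₗ[ℤ] N)
    (X : Set Plane) (hX0 : 0 ∈ X) (hXU : U ⊆ X)
    (hmap : ∀ x ∈ X, ∃ y ∈ X, ∀ n : N, (n : Plane) ∈ cell e U x → (φ n : Plane) ∈ cell e U y) :
    IsAlgebraicallyStable (hU.fan N he) φ := by
  refine isAlgebraicallyStable_of_invariant (hU.fan_isSeparated he hk0 hk) (cell e U '' X)
    (by rintro _ ⟨x, -, rfl⟩; exact ⟨x, rfl⟩) ?_ ?_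
  · rintro _ ⟨x, hx, rfl⟩
    obtain ⟨y, hy, h⟩ := hmap x hx
    exact ⟨_, ⟨y, hy, rfl⟩, h⟩
  · rintro _ ⟨x, rfl⟩ hx m hm hm0
    have hk0' : (0 : ℝ) < k := by exact_mod_cast hk0
    obtain ⟨u, hu, w, hw, huw, hcell⟩ : ∃ u ∈ U, ∃ w ∈ U, area e u w = 1 ∧
        cell e U x = PointedCone.hull ℝ {u, w} := by
      rcases hU.cell_cases x with ⟨rfl, -⟩ | ⟨u, hu, w, hw, huw, -, ⟨-, h⟩ | ⟨-, h⟩⟩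
      · exact absurd ⟨_, hX0, rfl⟩ hx
      · refine absurd ⟨u, hXU hu, ?_⟩ hx
        have := hU.cell_ray hu hw huw one_pos
        rw [one_smul] at this
        rw [h, this]
      · exact ⟨u, hu, w, hw, huw, h⟩
    lift u to N using hU.mem_lattice he hu
    lift w to N using hU.mem_lattice he hw
    have hux : (u : Plane) ∈ cell e U x := by rw [hcell]; exact Submodule.subset_span (by simp)
    have hwx : (w : Plane) ∈ cell e U x := by rw [hcell]; exact Submodule.subset_span (by simp)
    have hcu : cell e U u = PointedCone.hull ℝ {(u : Plane)} := by
      have := hU.cell_ray hu hw huw one_pos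
      rwa [one_smul] at this
    have hcw : cell e U w = PointedCone.hull ℝ {(w : Plane)} := by
      have := hU.cell_ray hw (hU.neg_mem u hu)
        (by rw [area_neg_right, area_swap, neg_neg, huw]) one_pos
      rwa [one_smul] at this
    have hgen : ∀ z ∈ cell e U x, 0 ≤ area e z w ∧ 0 ≤ area e u z ∧
        (area e z w ≠ 0 → (u : Plane) ∈ cell e U x) ∧
        (area e u z ≠ 0 → (w : Plane) ∈ cell e U x) := fun z hz => by
      rw [hcell] at hz
      obtain ⟨a, b, ha, hb, rfl⟩ := PointedCone.mem_hull_pair.1 hz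
      rw [area_add_left, area_add_right, area_smul_left, area_smul_right, area_smul_left,
        area_smul_right, huw, area_self, area_self]
      exact ⟨by linarith, by linarith, fun _ => hux, fun _ => hwx⟩
    have hpos : 0 < m u ∨ 0 < m w := by
      by_contra! h
      apply hm0
      ext n
      have h1 := le_antisymm h.1 (hm u hux)
      have h2 := le_antisymm h.2 (hm w hwx)
      have := mul_apply_eq hk u w (hU.subset_span hu) (hU.subset_span hw) huw m n
      rw [h1, h2, Int.cast_zero, mul_zero, mul_zero, add_zero] at this
      have h3 : (m n : ℝ) = 0 := by
        rcases mul_eq_zero.1 this with h | h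
        · exact absurd h hk0'.ne'
        · exact h
      exact_mod_cast h3
    -- `m` is positive on one generator `g`, and the face is the ray of the other, `g'`. If `m₀`
    -- vanishes on `g'`, the multiple `j = m₀ g` works because `m g ≥ 1`.
    have key : ∀ g g' : N, (g : Plane) ∈ cell e U x → (g' : Plane) ∈ cell e U x →
        (g' : Plane) ∈ cell e U g' → 0 < m g → ∀ m₀ ∈ semigroup N (cell e U x),
        -m₀ ∈ semigroup N (cell e U g') → 0 ≤ ((m₀ g).toNat • m - m₀) g ∧
        0 ≤ ((m₀ g).toNat • m - m₀) g' := by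
      intro g g' hg hg' hgg' hmg m₀ hm₀ hneg
      have h1 := hneg g' hgg'
      have h2 := hm₀ g hg
      rw [LinearMap.neg_apply] at h1
      rw [LinearMap.sub_apply, LinearMap.sub_apply, LinearMap.smul_apply, LinearMap.smul_apply,
        nsmul_eq_mul, nsmul_eq_mul, Int.toNat_of_nonneg h2]
      constructor
      · nlinarith
      · nlinarith [mul_nonneg h2 (hm g' hg')]
    rcases hpos with hpos | hpos
    · refine ⟨_, ⟨w, hXU hw, rfl⟩, ?_, fun m₀ hm₀ hneg => ⟨(m₀ u).toNat, ?_⟩⟩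
      · rw [hcw, Submodule.span_le, Set.singleton_subset_iff]
        exact hwx
      · obtain ⟨h1, h2⟩ := key u w hux hwx (self_mem_cell _) hpos m₀ hm₀ hneg
        exact mem_semigroup_cell hU hk0 hk hu hw huw hgen _ (fun _ => h1) (fun _ => h2)
    · refine ⟨_, ⟨u, hXU hu, rfl⟩, ?_, fun m₀ hm₀ hneg => ⟨(m₀ w).toNat, ?_⟩⟩
      · rw [hcu, Submodule.span_le, Set.singleton_subset_iff]
        exact hux
      · obtain ⟨h1, h2⟩ := key w u hwx hux (self_mem_cell _) hpos m₀ hm₀ hneg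
        exact mem_semigroup_cell hU hk0 hk hu hw huw hgen _ (fun _ => h2) (fun _ => h1)

end IsUnimodularSystem
end

/-! ### Primitive vectors, sector systems and the Farey set -/

noncomputable section

section Primitive

variable {e : Module.Basis (Fin 2) ℝ Plane}

/-- The primitive vectors of the lattice spanned by `e`. -/
def IsPrimitiveVector (e : Module.Basis (Fin 2) ℝ Plane) (u : Plane) : Prop :=
  u ∈ Submodule.span ℤ (Set.range e) ∧ ∃ z ∈ Submodule.span ℤ (Set.range e), area e u z = 1

theorem IsPrimitiveVector.neg {u : Plane} (h : IsPrimitiveVector e u) :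
    IsPrimitiveVector e (-u) := by
  obtain ⟨hu, z, hz, huz⟩ := h
  exact ⟨neg_mem hu, -z, neg_mem hz, by rw [area_neg_left, area_neg_right, neg_neg, huz]⟩

theorem IsPrimitiveVector.ne_zero {u : Plane} (h : IsPrimitiveVector e u) : u ≠ 0 := by
  rintro rfl
  obtain ⟨-, z, -, h⟩ := h
  rw [area_zero_left] at h
  exact zero_ne_one h

theorem eq_zero_of_area_eq_zero {x : Plane} (h : ∀ z, area e z x = 0) : x = 0 := by
  have h0 := h (e 0)
  have h1 := h (e 1)
  rw [area_basis_zero_left] at h0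
  rw [area_basis_one_left, neg_eq_zero] at h1
  refine e.repr.injective ?_
  ext i
  fin_cases i <;> simp [h0, h1]

theorem exists_eq_nsmul_isPrimitiveVector {g : Plane}
    (hg : g ∈ Submodule.span ℤ (Set.range e)) (hg0 : g ≠ 0) :
    ∃ j : ℕ, 0 < j ∧ ∃ u, IsPrimitiveVector e u ∧ g = (j : ℝ) • u := by
  obtain ⟨a, ha⟩ := (e.mem_span_iff_repr_mem ℤ g).1 hg 0
  obtain ⟨b, hb⟩ := (e.mem_span_iff_repr_mem ℤ g).1 hg 1
  have hab : 0 < Int.gcd a b := by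
    rw [Int.gcd_pos_iff]
    by_contra! h
    apply hg0
    apply e.repr.injective
    ext i
    fin_cases i <;> simp [← ha, ← hb, h.1, h.2]
  obtain ⟨a', ha'⟩ := Int.gcd_dvd_left a b
  obtain ⟨b', hb'⟩ := Int.gcd_dvd_right a b
  have hab' : (0 : ℝ) < Int.gcd a b := by exact_mod_cast hab
  have hspan : ∀ c d : ℤ, (c : ℝ) • e 0 + (d : ℝ) • e 1 ∈ Submodule.span ℤ (Set.range e) := by
    intro c d
    rw [Int.cast_smul_eq_zsmul, Int.cast_smul_eq_zsmul]
    exact add_mem (Submodule.smul_mem _ _ (Submodule.subset_span ⟨0, rfl⟩))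
      (Submodule.smul_mem _ _ (Submodule.subset_span ⟨1, rfl⟩))
  -- The partner of area one comes from the Bézout coefficients of `a` and `b`.
  refine ⟨Int.gcd a b, hab, (a' : ℝ) • e 0 + (b' : ℝ) • e 1, ⟨hspan a' b',
    ((-Int.gcdB a b : ℤ) : ℝ) • e 0 + (Int.gcdA a b : ℝ) • e 1, hspan _ _, ?_⟩, ?_⟩
  · have h1 := Int.gcd_eq_gcd_ab a b
    have h2 : ((Int.gcd a b : ℤ) : ℝ) * (a' * Int.gcdA a b + b' * Int.gcdB a b) =
        (Int.gcd a b : ℤ) * 1 := by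
      have : (Int.gcd a b : ℤ) * (a' * Int.gcdA a b + b' * Int.gcdB a b) = Int.gcd a b * 1 := by
        calc _ = (Int.gcd a b * a') * Int.gcdA a b + (Int.gcd a b * b') * Int.gcdB a b := by ring
          _ = a * Int.gcdA a b + b * Int.gcdB a b := by rw [← ha', ← hb']
          _ = _ := by rw [mul_one, h1]
      exact_mod_cast this
    have h3 := mul_left_cancel₀ (by exact_mod_cast hab'.ne') h2
    rw [area_add_left, area_smul_left, area_smul_left, area_add_right, area_add_right,
      area_smul_right, area_smul_right, area_smul_right, area_smul_right, area_self, area_self,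
      area_swap (e 0) (e 1), area_basis]
    push_cast
    linarith
  · have e1 : (a : ℝ) = Int.gcd a b * a' := by exact_mod_cast ha'
    have e2 : (b : ℝ) = Int.gcd a b * b' := by exact_mod_cast hb'
    rw [smul_add, smul_smul, smul_smul, ← e1, ← e2]
    apply e.repr.injective
    ext i
    fin_cases i <;> simp [← ha, ← hb]

theorem IsPrimitiveVector.eq_one {u c : Plane} (hu : IsPrimitiveVector e u)
    (hc : c ∈ Submodule.span ℤ (Set.range e)) {a : ℤ} (ha : 0 ≤ a) (h : u = (a : ℝ) • c) :
    a = 1 := by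
  obtain ⟨-, z, hz, huz⟩ := hu
  obtain ⟨b, hb⟩ := area_eq_intCast hc hz
  rw [h, area_smul_left, hb] at huz
  exact Int.eq_one_or_neg_one_of_mul_eq_one (by exact_mod_cast huz) |>.resolve_right (by omega)

theorem IsPrimitiveVector.eq_or_eq_neg {u t : Plane} (hu : IsPrimitiveVector e u)
    (ht : IsPrimitiveVector e t) (h : area e t u = 0) : u = t ∨ u = -t := by
  obtain ⟨htL, z, hz, htz⟩ := ht
  obtain ⟨a, ha⟩ := area_eq_intCast hu.1 hz
  have h1 : u = (a : ℝ) • t := by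
    have := eq_of_area_eq_one htz u
    rwa [h, zero_smul, add_zero, ha] at this
  rcases le_total 0 a with h0 | h0
  · left
    rw [h1, hu.eq_one htL h0 h1]
    simp
  · right
    have h2 : u = ((-a : ℤ) : ℝ) • (-t) := by rw [h1]; simp
    have h3 := hu.eq_one (neg_mem htL) (by omega) h2
    rw [h2, h3]
    simp

/-- A lattice triangle with two primitive edges at `0` that is not unimodular contains a further
primitive vector strictly between these edges. -/
theorem exists_isPrimitiveVector_between {u w : Plane} (hu : IsPrimitiveVector e u)
    (hw : IsPrimitiveVector e w) (hpos : 0 < area e u w) (hne : area e u w ≠ 1) :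
    ∃ v, IsPrimitiveVector e v ∧ 0 < area e u v ∧ 0 < area e v w ∧
      area e u v + area e v w ≤ area e u w := by
  obtain ⟨huL, z, hz, huz⟩ := hu
  obtain ⟨d, hd⟩ := area_eq_intCast huL hw.1
  obtain ⟨a, ha⟩ := area_eq_intCast hw.1 hz
  have hwe := eq_of_area_eq_one huz w
  rw [ha, hd] at hwe
  have hd0 : 0 < d := by rw [hd] at hpos; exact_mod_cast hpos
  have hd1 : d ≠ 1 := by rintro rfl; exact hne (by rw [hd]; simp)
  -- Here `w = a u + d z`. Every `z + c u` has area one with `u`, and for this `c` its area with `w`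
  -- is `d - a % d`, at most `d - 1` since primitivity of `w` excludes `a % d = 0`. The two areas
  -- then add up to at most `d`: the vector lies in the triangle `0, u, w`.
  set c : ℤ := a / d + 1 with hc
  have hmod := Int.emod_add_mul_ediv a d
  have hmod1 := Int.emod_lt_of_pos a hd0
  have hmod0 := Int.emod_nonneg a hd0.ne'
  have hcL : ∀ c : ℤ, z + (c : ℝ) • u ∈ Submodule.span ℤ (Set.range e) := fun c => by
    rw [Int.cast_smul_eq_zsmul]
    exact add_mem hz (Submodule.smul_mem _ _ huL)
  have hmodne : a % d ≠ 0 := by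
    intro h0
    rw [h0, zero_add] at hmod
    apply hd1
    refine hw.eq_one (hcL (a / d)) hd0.le ?_
    rw [hwe, smul_add, smul_smul, ← Int.cast_mul, hmod, add_comm]
  have hvw : area e (z + (c : ℝ) • u) w = ((c * d - a : ℤ) : ℝ) := by
    rw [area_add_left, area_smul_left, hd, area_swap, ha]
    push_cast
    ring
  have huv : area e u (z + (c : ℝ) • u) = 1 := by
    rw [area_add_right, area_smul_right, area_self, huz]
    ring
  have hcd : c * d - a = d - a % d := by
    rw [hc]
    linarith [mul_comm (a / d) d, add_mul (a / d) 1 d]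
  refine ⟨z + (c : ℝ) • u, ⟨hcL c, -u, neg_mem huL, ?_⟩, ?_, ?_, ?_⟩
  · rw [area_neg_right, area_swap, neg_neg, huv]
  · rw [huv]; exact one_pos
  · rw [hvw, hcd]
    exact_mod_cast (by omega : 0 < d - a % d)
  · rw [hvw, huv, hd, hcd]
    exact_mod_cast (by omega : 1 + (d - a % d) ≤ d)

end Primitive

section Sectors

variable {e : Module.Basis (Fin 2) ℝ Plane} {ξ η : Plane →ₗ[ℝ] ℝ} {κ : ℝ}
  {Q : Set (Plane × Plane)}

/-- The open sector between `c` and `c'`. -/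
def sector (e : Module.Basis (Fin 2) ℝ Plane) (c c' : Plane) : Set Plane :=
  {x | 0 < area e c x ∧ 0 < area e x c'}

/-- The union of a family of open sectors. -/
def sectors (e : Module.Basis (Fin 2) ℝ Plane) (Q : Set (Plane × Plane)) : Set Plane :=
  {x | ∃ q ∈ Q, x ∈ sector e q.1 q.2}

/-- The edges of a family of sectors. -/
def edges (Q : Set (Plane × Plane)) : Set Plane := {t | ∃ q ∈ Q, t = q.1 ∨ t = q.2}

theorem smul_mem_sector {c c' x : Plane} {a : ℝ} (ha : 0 < a) :
    a • x ∈ sector e c c' ↔ x ∈ sector e c c' := by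
  simp only [sector, Set.mem_ofPred_eq, area_smul_left, area_smul_right, mul_pos_iff_of_pos_left ha]

theorem smul_mem_sectors {x : Plane} {a : ℝ} (ha : 0 < a) :
    a • x ∈ sectors e Q ↔ x ∈ sectors e Q := by
  simp only [sectors, Set.mem_ofPred_eq, smul_mem_sector ha]

/-- If the sector between two primitive vectors overlaps a unimodular sector that contains
neither of them, then it contains an edge of that sector. -/
theorem edge_mem_sector {c c' u w x : Plane} (hc : c ∈ Submodule.span ℤ (Set.range e))
    (hc' : c' ∈ Submodule.span ℤ (Set.range e)) (hcc' : area e c c' = 1)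
    (hu : IsPrimitiveVector e u) (hw : IsPrimitiveVector e w) (hpos : 0 < area e u w)
    (hne : area e u w ≠ 1) (hu' : u ∉ sector e c c') (hw' : w ∉ sector e c c')
    (hx : x ∈ sector e u w) (hx' : x ∈ sector e c c') :
    c ∈ sector e u w ∨ c' ∈ sector e u w := by
  obtain ⟨hux, hxw⟩ := hx
  obtain ⟨hcx, hxc⟩ := hx'
  simp only [sector, Set.mem_ofPred_eq, not_and, not_lt] at hu' hw' ⊢
  have hue := eq_of_area_eq_one hcc' u
  have hwe := eq_of_area_eq_one hcc' w
  have hexp : ∀ y z : Plane, area e y z = area e y c' * area e c z - area e c y * area e z c' := by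
    intro y z
    have : area e c c' * area e y z = area e y c' * area e c z - area e c y * area e z c' := by
      simp only [area]; ring
    rwa [hcc', one_mul] at this
  have f1 := hexp u x
  have f2 := hexp x w
  have f3 := hexp u w
  have s1 := area_swap (e := e) c u
  have s6 := area_swap (e := e) c' w
  set u1 := area e u c'
  set u2 := area e c u
  set w1 := area e w c'
  set w2 := area e c w
  set x1 := area e x c'
  set x2 := area e c x
  rw [f1] at hux
  rw [f2] at hxw
  -- In coordinates with respect to `c` and `c'`, if neither edge is strictly between `u` and `w`,
  -- then `u` lies on the ray of `c` and `w` on that of `c'`. By primitivity they coincide with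
  -- these edges, against `area e u w ≠ 1`.
  by_contra! hcon
  obtain ⟨hc1, hc2⟩ := hcon
  have hu2 : 0 ≤ u2 := by
    by_contra! h
    have hw2 := hc1 (by linarith)
    have hw1 : w1 < 0 := by nlinarith
    by_cases hu1 : 0 < u1
    · linarith [hc2 hu1]
    · rw [f3] at hpos
      have k1 : x1 * (u1 * w2 - u2 * w1) = (x1 * w2 - x2 * w1) * u1 + (u1 * x2 - u2 * x1) * w1 := by
        ring
      nlinarith [mul_pos hxc hpos, mul_nonneg hxw.le (neg_nonneg.2 (not_lt.1 hu1)),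
        mul_pos hux (neg_pos.2 hw1)]
  have hu1 : 0 < u1 := by nlinarith
  have hu2' : u2 = 0 := by
    rcases hu2.eq_or_lt with h | h
    · exact h.symm
    · linarith [hu' h]
  have hw1 : 0 ≤ w1 := by
    linarith [hc2 hu1]
  have hw2 : 0 < w2 := by nlinarith
  have hw1' : w1 = 0 := le_antisymm (hw' hw2) hw1
  rw [hu2', zero_smul, add_zero] at hue
  rw [hw1', zero_smul, zero_add] at hwe
  obtain ⟨a, ha⟩ := area_eq_intCast hu.1 hc'
  obtain ⟨b, hb⟩ := area_eq_intCast hc hw.1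
  have ha' : u1 = a := ha
  have hb' : w2 = b := hb
  rw [ha'] at hue hu1
  rw [hb'] at hwe hw2
  have ha1 := hu.eq_one hc (by exact_mod_cast hu1.le) hue
  have hb1 := hw.eq_one hc' (by exact_mod_cast hw2.le) hwe
  apply hne
  rw [f3, ha', hb', ha1, hb1, hu2']
  simp

/-- A finite symmetric family of unimodular sectors that covers neighbourhoods of the two lines
`ξ = 0` and `η = 0`, up to edges. -/
structure IsSectorSystem (e : Module.Basis (Fin 2) ℝ Plane) (ξ η : Plane →ₗ[ℝ] ℝ) (κ : ℝ)
    (Q : Set (Plane × Plane)) : Prop where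
  pos : 0 < κ
  area_eq : ∀ x y, area e x y = κ * (ξ x * η y - η x * ξ y)
  finite : Q.Finite
  neg_mem : ∀ q ∈ Q, (-q.1, -q.2) ∈ Q
  fst_mem : ∀ q ∈ Q, q.1 ∈ Submodule.span ℤ (Set.range e)
  snd_mem : ∀ q ∈ Q, q.2 ∈ Submodule.span ℤ (Set.range e)
  area_eq_one : ∀ q ∈ Q, area e q.1 q.2 = 1
  edges_not_mem : ∀ t ∈ edges Q, t ∉ sectors e Q
  basis_mem : ∀ i, e i ∈ edges Q
  near_left : ∃ δ : ℝ, 0 < δ ∧ ∀ x, |ξ x| < δ * |η x| →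
    x ∈ sectors e Q ∨ ∃ t ∈ edges Q, area e t x = 0
  near_right : ∃ δ : ℝ, 0 < δ ∧ ∀ x, |η x| < δ * |ξ x| →
    x ∈ sectors e Q ∨ ∃ t ∈ edges Q, area e t x = 0

/-- The primitive vectors that are edges of sectors of `Q`, or lie outside of the sectors and in the
region `|η| ≤ B |ξ| ^ γ`. -/
def fareySet (e : Module.Basis (Fin 2) ℝ Plane) (ξ η : Plane →ₗ[ℝ] ℝ)
    (Q : Set (Plane × Plane)) (B γ : ℝ) : Set Plane :=
  {u | IsPrimitiveVector e u ∧ (u ∈ edges Q ∨ u ∉ sectors e Q ∧ |η u| ≤ B * |ξ u| ^ γ)}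

/-- Concavity of `t ↦ t ^ γ`, with the remaining weight `1 - a - b` placed at `0`, where the
function vanishes. -/
theorem add_rpow_le_rpow_add {γ : ℝ} (h0 : 0 < γ) (h1 : γ < 1) {a b p q : ℝ} (ha : 0 ≤ a)
    (hb : 0 ≤ b) (hp : 0 ≤ p) (hq : 0 ≤ q) (hab : a + b ≤ 1) :
    a * p ^ γ + b * q ^ γ ≤ (a * p + b * q) ^ γ := by
  have hconc := Real.concaveOn_rpow h0.le h1.le
  rcases (add_nonneg ha hb).eq_or_lt with hs | hs
  · have ha0 : a = 0 := by linarith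
    have hb0 : b = 0 := by linarith
    simp [ha0, hb0, Real.zero_rpow h0.ne']
  · have h2 := hconc.2 (Set.mem_Ici.2 hp) (Set.mem_Ici.2 hq) (div_nonneg ha hs.le)
      (div_nonneg hb hs.le) (by field_simp)
    have hm : 0 ≤ (a / (a + b)) • p + (b / (a + b)) • q := by
      simp only [smul_eq_mul]; positivity
    have h3 := hconc.2 (Set.mem_Ici.2 hm) (Set.mem_Ici.2 le_rfl) hs.le
      (sub_nonneg.2 hab) (by ring)
    simp only [smul_eq_mul, mul_zero, add_zero, Real.zero_rpow h0.ne'] at h2 h3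
    have e1 : (a + b) * (a / (a + b) * p + b / (a + b) * q) = a * p + b * q := by field_simp
    rw [e1] at h3
    refine le_trans ?_ h3
    have e2 : a * p ^ γ + b * q ^ γ =
        (a + b) * (a / (a + b) * p ^ γ + b / (a + b) * q ^ γ) := by field_simp
    rw [e2]
    exact mul_le_mul_of_nonneg_left h2 hs.le

namespace IsSectorSystem

theorem eq_zero (hQ : IsSectorSystem e ξ η κ Q) {x : Plane} (h1 : ξ x = 0) (h2 : η x = 0) :
    x = 0 :=
  eq_zero_of_area_eq_zero (e := e) fun z => by rw [hQ.area_eq, h1, h2]; ring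

theorem edge_isPrimitive (hQ : IsSectorSystem e ξ η κ Q) {t : Plane} (ht : t ∈ edges Q) :
    IsPrimitiveVector e t := by
  obtain ⟨q, hq, rfl | rfl⟩ := ht
  · exact ⟨hQ.fst_mem q hq, q.2, hQ.snd_mem q hq, hQ.area_eq_one q hq⟩
  · refine ⟨hQ.snd_mem q hq, -q.1, NegMemClass.neg_mem (hQ.fst_mem q hq), ?_⟩
    rw [area_neg_right, area_swap, neg_neg, hQ.area_eq_one q hq]

theorem neg_mem_edges (hQ : IsSectorSystem e ξ η κ Q) {t : Plane} (ht : t ∈ edges Q) :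
    -t ∈ edges Q := by
  obtain ⟨q, hq, rfl | rfl⟩ := ht
  · exact ⟨_, hQ.neg_mem q hq, Or.inl rfl⟩
  · exact ⟨_, hQ.neg_mem q hq, Or.inr rfl⟩

theorem neg_mem_sectors (hQ : IsSectorSystem e ξ η κ Q) {x : Plane} (hx : x ∈ sectors e Q) :
    -x ∈ sectors e Q := by
  obtain ⟨q, hq, h1, h2⟩ := hx
  refine ⟨_, hQ.neg_mem q hq, ?_, ?_⟩
  · simpa only [area_neg_left, area_neg_right, neg_neg] using h1
  · simpa only [area_neg_left, area_neg_right, neg_neg] using h2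

theorem finite_edges (hQ : IsSectorSystem e ξ η κ Q) : (edges Q).Finite := by
  refine ((hQ.finite.image Prod.fst).union (hQ.finite.image Prod.snd)).subset ?_
  rintro t ⟨q, hq, rfl | rfl⟩
  · exact Or.inl ⟨q, hq, rfl⟩
  · exact Or.inr ⟨q, hq, rfl⟩

theorem finite_bounded (hQ : IsSectorSystem e ξ η κ Q) (R : ℝ) :
    {x | x ∈ Submodule.span ℤ (Set.range e) ∧ |ξ x| ≤ R ∧ |η x| ≤ R}.Finite := by
  have hb : Bornology.IsBounded {x : Plane | |ξ x| ≤ R ∧ |η x| ≤ R} := by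
    rw [isBounded_iff_forall_norm_le]
    refine ⟨κ * ((|ξ (e 1)| + |η (e 1)|) * R) * ‖e 0‖ +
      κ * ((|ξ (e 0)| + |η (e 0)|) * R) * ‖e 1‖, fun x hx => ?_⟩
    have hbd : ∀ z, |area e z x| ≤ κ * ((|ξ z| + |η z|) * R) := fun z => by
      rw [hQ.area_eq, abs_mul, abs_of_pos hQ.pos]
      refine mul_le_mul_of_nonneg_left ?_ hQ.pos.le
      calc |ξ z * η x - η z * ξ x| ≤ |ξ z * η x| + |η z * ξ x| := abs_sub _ _
        _ = |ξ z| * |η x| + |η z| * |ξ x| := by rw [abs_mul, abs_mul]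
        _ ≤ |ξ z| * R + |η z| * R := by gcongr; exacts [hx.2, hx.1]
        _ = _ := by ring
    conv_lhs => rw [eq_of_area_eq_one (area_basis (e := e)) x]
    refine (norm_add_le _ _).trans ?_
    rw [norm_smul, norm_smul, Real.norm_eq_abs, Real.norm_eq_abs, area_swap, abs_neg]
    gcongr
    · exact hbd _
    · exact hbd _
  refine (ZSpan.setFinite_inter e hb).subset ?_
  rintro x ⟨h1, h2⟩
  exact ⟨h2, h1⟩

/-- A primitive vector near `η = 0` is in a sector or is an edge. Away from that line `δ |ξ| ≤ |η| ≤
B |ξ| ^ γ`, and `γ < 1` bounds `|ξ|` by `(B / δ) ^ (1 / (1 - γ))`. -/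
theorem fareySet_finite (hQ : IsSectorSystem e ξ η κ Q) {B γ : ℝ} (hB : 0 ≤ B) (h0 : 0 < γ)
    (h1 : γ < 1) : (fareySet e ξ η Q B γ).Finite := by
  obtain ⟨δ, hδ, hnear⟩ := hQ.near_right
  set R : ℝ := (B / δ) ^ (1 - γ)⁻¹ with hR
  refine (hQ.finite_edges.union (hQ.finite_bounded (max R (B * R ^ γ)))).subset ?_
  rintro u ⟨hu, hu' | ⟨hu', hbd⟩⟩
  · exact Or.inl hu'
  by_cases hs : |η u| < δ * |ξ u|
  · rcases hnear u hs with h | ⟨t, ht, h⟩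
    · exact absurd h hu'
    · rcases hu.eq_or_eq_neg (hQ.edge_isPrimitive ht) h with rfl | rfl
      · exact Or.inl ht
      · exact Or.inl (hQ.neg_mem_edges ht)
  · right
    have hle : |ξ u| ≤ R := by
      rcases (abs_nonneg (ξ u)).eq_or_lt with h | h
      · rw [← h]; positivity
      · have h3 : |ξ u| ^ (1 - γ) ≤ B / δ := by
          rw [Real.rpow_sub h, Real.rpow_one, div_le_div_iff₀ (by positivity) hδ]
          linarith
        have h4 := Real.rpow_le_rpow (by positivity) h3 (inv_nonneg.2 (sub_nonneg.2 h1.le))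
        rwa [← Real.rpow_mul (abs_nonneg _), mul_inv_cancel₀ (sub_pos.2 h1).ne',
          Real.rpow_one] at h4
    refine ⟨hu.1, hle.trans (le_max_left _ _), hbd.trans ?_⟩
    refine le_trans ?_ (le_max_right _ _)
    gcongr

/-- The repelling line is covered by sectors or edges, so a sector avoiding these lies strictly on
one side of `ξ = 0`. -/
theorem mul_pos_of_disjoint (hQ : IsSectorSystem e ξ η κ Q) {u w : Plane} (hpos : 0 < area e u w)
    (hno : ∀ x ∈ sector e u w, x ∉ sectors e Q)
    (hno' : ∀ t ∈ edges Q, t ∉ sector e u w) : 0 < ξ u * ξ w := by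
  obtain ⟨δ, hδ, hnear⟩ := hQ.near_left
  have hsec : ∀ a b : ℝ, 0 < a → 0 < b → a • u + b • w ∈ sector e u w := fun a b ha hb => by
    constructor
    · rw [area_add_right, area_smul_right, area_smul_right, area_self]
      linarith [mul_pos hb hpos]
    · rw [area_add_left, area_smul_left, area_smul_left, area_self]
      linarith [mul_pos ha hpos]
  have hbd : ∀ x ∈ sector e u w, δ * |η x| ≤ |ξ x| := by
    intro x hx
    by_contra! h
    rcases hnear x h with h | ⟨t, ht, h⟩
    · exact hno x hx h
    · obtain ⟨-, z, -, htz⟩ := hQ.edge_isPrimitive ht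
      have hxe := eq_of_area_eq_one htz x
      rw [h, zero_smul, add_zero] at hxe
      rcases lt_trichotomy (area e x z) 0 with h0 | h0 | h0
      · refine hno' (-t) (hQ.neg_mem_edges ht) ((smul_mem_sector (neg_pos.2 h0)).1 ?_)
        rw [neg_smul_neg, ← hxe]
        exact hx
      · rw [h0, zero_smul] at hxe
        have := hx.1
        rw [hxe, area_zero_right] at this
        exact lt_irrefl _ this
      · refine hno' t ht ((smul_mem_sector h0).1 ?_)
        rw [← hxe]
        exact hx
  -- The bound `δ |η| ≤ |ξ|` passes to the closed sector by continuity.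
  have hclosed : ∀ a b : ℝ, 0 ≤ a → 0 ≤ b →
      δ * |η (a • u + b • w)| ≤ |ξ (a • u + b • w)| := by
    intro a b ha hb
    have hev : ∀ᶠ ε : ℝ in nhdsWithin 0 (Set.Ioi 0),
        δ * |η ((a + ε) • u + (b + ε) • w)| ≤ |ξ ((a + ε) • u + (b + ε) • w)| := by
      filter_upwards [self_mem_nhdsWithin] with ε hε
      have hε' : 0 < ε := hε
      exact hbd _ (hsec _ _ (by linarith) (by linarith))
    have hlim : ∀ f : Plane →ₗ[ℝ] ℝ, Filter.Tendsto (fun ε : ℝ => |f ((a + ε) • u + (b + ε) • w)|)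
        (nhdsWithin 0 (Set.Ioi 0)) (nhds |f (a • u + b • w)|) := by
      intro f
      have hc : Continuous fun ε : ℝ => |f ((a + ε) • u + (b + ε) • w)| := by
        simp only [map_add, map_smul]
        fun_prop
      have := hc.tendsto 0
      rw [add_zero, add_zero] at this
      exact this.mono_left nhdsWithin_le_nhds
    exact le_of_tendsto_of_tendsto ((hlim η).const_mul δ) (hlim ξ) hev
  by_contra! hcon
  -- If `ξ u` and `ξ w` did not have the same strict sign, these weights would give a point with `ξ
  -- = 0`, hence `η = 0`, and `u`, `w` would be dependent.
  have hz := hclosed |ξ w| |ξ u| (abs_nonneg _) (abs_nonneg _)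
  have hξ : ξ (|ξ w| • u + |ξ u| • w) = 0 := by
    simp only [map_add, map_smul, smul_eq_mul]
    rcases le_total 0 (ξ u) with h1 | h1 <;> rcases le_total 0 (ξ w) with h2 | h2
    · rw [abs_of_nonneg h1, abs_of_nonneg h2]; nlinarith [mul_nonneg h1 h2]
    · rw [abs_of_nonneg h1, abs_of_nonpos h2]; ring
    · rw [abs_of_nonpos h1, abs_of_nonneg h2]; ring
    · rw [abs_of_nonpos h1, abs_of_nonpos h2]; nlinarith [mul_nonneg_of_nonpos_of_nonpos h1 h2]
  rw [hξ, abs_zero] at hz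
  have hη : η (|ξ w| • u + |ξ u| • w) = 0 := by
    have : |η (|ξ w| • u + |ξ u| • w)| ≤ 0 := by nlinarith
    exact abs_nonpos_iff.1 this
  have h0 := hQ.eq_zero hξ hη
  have a1 := congrArg (fun z => area e u z) h0
  have a2 := congrArg (fun z => area e z w) h0
  simp only [area_add_right, area_add_left, area_smul_left, area_smul_right, area_self,
    area_zero_left, area_zero_right, mul_zero, zero_add, add_zero] at a1 a2
  have b1 : ξ u = 0 := abs_eq_zero.1 ((mul_eq_zero.1 a1).resolve_right hpos.ne')
  have b2 : ξ w = 0 := abs_eq_zero.1 ((mul_eq_zero.1 a2).resolve_right hpos.ne')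
  rw [hQ.area_eq, b1, b2] at hpos
  simp at hpos

theorem not_mem_sectors_of_mem_fareySet (hQ : IsSectorSystem e ξ η κ Q) {B γ : ℝ} {u : Plane}
    (hu : u ∈ fareySet e ξ η Q B γ) : u ∉ sectors e Q :=
  hu.2.elim (hQ.edges_not_mem u) fun h => h.1

theorem edges_subset_fareySet (hQ : IsSectorSystem e ξ η κ Q) (B γ : ℝ) :
    edges Q ⊆ fareySet e ξ η Q B γ := fun _ ht => ⟨hQ.edge_isPrimitive ht, Or.inl ht⟩

/-- Between `u` and `w` there is an edge; or the sector meets a sector of `Q` and again contains an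
edge by `edge_mem_sector`; or it avoids all of these and lies on one side of `ξ = 0`. In the last
case the primitive vector from `exists_isPrimitiveVector_between` is `a u + b w` with `a + b ≤ 1`,
and concavity gives its bound. -/
theorem isUnimodularSystem_fareySet (hQ : IsSectorSystem e ξ η κ Q) {B γ : ℝ} (hB : 0 ≤ B)
    (h0 : 0 < γ) (h1 : γ < 1) (hedges : ∀ t ∈ edges Q, ξ t ≠ 0 → |η t| ≤ B * |ξ t| ^ γ) :
    IsUnimodularSystem e (fareySet e ξ η Q B γ) where
  finite := hQ.fareySet_finite hB h0 h1
  neg_mem := by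
    rintro u ⟨hu, hu'⟩
    refine ⟨hu.neg, ?_⟩
    rcases hu' with h | ⟨h, hbd⟩
    · exact Or.inl (hQ.neg_mem_edges h)
    · refine Or.inr ⟨fun hneg => h ?_, ?_⟩
      · simpa only [neg_neg] using hQ.neg_mem_sectors hneg
      · rw [map_neg, map_neg, abs_neg, abs_neg]
        exact hbd
  basis_mem := fun i => hQ.edges_subset_fareySet B γ (hQ.basis_mem i)
  subset_span := fun u hu => hu.1.1
  exists_between := by
    intro u hu w hw hpos hne
    by_cases hT : ∃ t ∈ edges Q, t ∈ sector e u w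
    · obtain ⟨t, ht, h⟩ := hT
      exact ⟨t, hQ.edges_subset_fareySet B γ ht, h⟩
    by_cases hΩ : ∃ x ∈ sector e u w, x ∈ sectors e Q
    · obtain ⟨x, hx, q, hq, hxq⟩ := hΩ
      have hn : ∀ v ∈ fareySet e ξ η Q B γ, v ∉ sector e q.1 q.2 := fun v hv h =>
        hQ.not_mem_sectors_of_mem_fareySet hv ⟨q, hq, h⟩
      rcases edge_mem_sector (hQ.fst_mem q hq) (hQ.snd_mem q hq) (hQ.area_eq_one q hq) hu.1 hw.1
        hpos hne (hn u hu) (hn w hw) hx hxq with h | h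
      · exact ⟨_, hQ.edges_subset_fareySet B γ ⟨q, hq, Or.inl rfl⟩, h⟩
      · exact ⟨_, hQ.edges_subset_fareySet B γ ⟨q, hq, Or.inr rfl⟩, h⟩
    push Not at hT hΩ
    have hξ := hQ.mul_pos_of_disjoint hpos hΩ hT
    have hbd : ∀ v ∈ fareySet e ξ η Q B γ, ξ v ≠ 0 → |η v| ≤ B * |ξ v| ^ γ := fun v hv hv0 =>
      hv.2.elim (fun h => hedges v h hv0) fun h => h.2
    have hub := hbd u hu (left_ne_zero_of_mul hξ.ne')
    have hwb := hbd w hw (right_ne_zero_of_mul hξ.ne')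
    obtain ⟨v, hv, huv, hvw, hle⟩ := exists_isPrimitiveVector_between hu.1 hw.1 hpos hne
    refine ⟨v, ⟨hv, Or.inr ⟨hΩ v ⟨huv, hvw⟩, ?_⟩⟩, huv, hvw⟩
    set a := area e v w / area e u w with ha
    set b := area e u v / area e u w with hb
    have ha0 : 0 < a := div_pos hvw hpos
    have hb0 : 0 < b := div_pos huv hpos
    have hab : a + b ≤ 1 := by
      rw [ha, hb, ← add_div, div_le_one hpos]
      linarith
    have hve : v = a • u + b • w := by
      rw [ha, hb, div_eq_inv_mul, div_eq_inv_mul, mul_smul, mul_smul, ← smul_add, ← area_smul_eq,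
        inv_smul_smul₀ hpos.ne']
    have hξv : |ξ v| = a * |ξ u| + b * |ξ w| := by
      rw [hve, map_add, map_smul, map_smul, smul_eq_mul, smul_eq_mul]
      rcases pos_and_pos_or_neg_and_neg_of_mul_pos hξ with ⟨h, h'⟩ | ⟨h, h'⟩
      · rw [abs_of_pos h, abs_of_pos h', abs_of_pos (by positivity)]
      · rw [abs_of_neg h, abs_of_neg h', abs_of_neg (by nlinarith)]
        ring
    calc |η v| = |a * η u + b * η w| := by
          rw [hve, map_add, map_smul, map_smul, smul_eq_mul, smul_eq_mul]
      _ ≤ |a * η u| + |b * η w| := abs_add_le _ _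
      _ = a * |η u| + b * |η w| := by rw [abs_mul, abs_mul, abs_of_pos ha0, abs_of_pos hb0]
      _ ≤ a * (B * |ξ u| ^ γ) + b * (B * |ξ w| ^ γ) := by gcongr
      _ = B * (a * |ξ u| ^ γ + b * |ξ w| ^ γ) := by ring
      _ ≤ B * (a * |ξ u| + b * |ξ w|) ^ γ := by
          gcongr
          exact add_rpow_le_rpow_add h0 h1 ha0.le hb0.le (abs_nonneg _) (abs_nonneg _) hab
      _ = B * |ξ v| ^ γ := by rw [hξv]

end IsSectorSystem

end Sectors
end

/-! ### From a sector system to a stable refinement -/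

noncomputable section

theorem IsUnimodularSystem.exists_eq_smul_of_mem_cell {e : Module.Basis (Fin 2) ℝ Plane}
    {U : Set Plane} (hU : IsUnimodularSystem e U) {u z : Plane} (hu : u ∈ U) (hu0 : u ≠ 0) {c : ℝ}
    (hc : 0 < c) (hz : z ∈ cell e U (c • u)) : ∃ b : ℝ, 0 ≤ b ∧ z = b • u := by
  rcases hU.cell_cases (c • u) with ⟨h, -⟩ | ⟨u', hu', w, hw, -, hno, ⟨⟨a, ha, h⟩, h'⟩ | ⟨⟨h1, h2⟩, -⟩⟩
  · exact absurd h (smul_ne_zero hc.ne' hu0)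
  · rw [h'] at hz
    obtain ⟨b, hb, rfl⟩ := PointedCone.mem_hull_singleton.1 hz
    refine ⟨b * (a⁻¹ * c), by positivity, ?_⟩
    rw [mul_smul, mul_smul, h, inv_smul_smul₀ ha.ne']
  · rw [area_smul_left] at h1
    rw [area_smul_right] at h2
    exact absurd (hno u hu (pos_of_mul_pos_right h2 hc.le))
      (pos_of_mul_pos_right h1 hc.le).not_ge

/-- The lattice of `e` contains the kernel of a homomorphism from `N` to the finite group `(ℤ /
k)²`, namely `k` times the coordinates, up to order and sign, reduced modulo `k`. -/
theorem relIndex_span_ne_zero {e : Module.Basis (Fin 2) ℝ Plane} {N : Submodule ℤ Plane} {k : ℕ}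
    (hk0 : 0 < k) (hk : ∀ n ∈ N, (k : ℝ) • n ∈ Submodule.span ℤ (Set.range e)) :
    (Submodule.span ℤ (Set.range e)).toAddSubgroup.relIndex N.toAddSubgroup ≠ 0 := by
  obtain ⟨f₀, hf₀⟩ := IsUnimodularSystem.exists_intCast_area hk
    (Submodule.subset_span (Set.mem_range_self 0))
  obtain ⟨f₁, hf₁⟩ := IsUnimodularSystem.exists_intCast_area hk
    (Submodule.subset_span (Set.mem_range_self 1))
  have : NeZero k := ⟨hk0.ne'⟩
  have hk0' : (k : ℝ) ≠ 0 := by exact_mod_cast hk0.ne'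
  let g : N.toAddSubgroup →+ ZMod k × ZMod k :=
    ((Int.castAddHom (ZMod k)).comp f₀.toAddMonoidHom).prod
      ((Int.castAddHom (ZMod k)).comp f₁.toAddMonoidHom)
  have hker : g.ker ≤ (Submodule.span ℤ (Set.range e)).toAddSubgroup.addSubgroupOf
      N.toAddSubgroup := by
    intro n hn
    have hn' : (((f₀ n : ℤ) : ZMod k), ((f₁ n : ℤ) : ZMod k)) = (0, 0) := hn
    rw [Prod.mk.injEq, ZMod.intCast_zmod_eq_zero_iff_dvd, ZMod.intCast_zmod_eq_zero_iff_dvd] at hn'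
    obtain ⟨⟨a, ha⟩, ⟨b, hb⟩⟩ := hn'
    have h0 := hf₀ n
    have h1 := hf₁ n
    rw [ha, area_basis_zero_left] at h0
    rw [hb, area_basis_one_left] at h1
    push_cast at h0 h1
    have h0' := mul_left_cancel₀ hk0' h0
    have h1' := mul_left_cancel₀ hk0' h1
    rw [AddSubgroup.mem_addSubgroupOf]
    refine (e.mem_span_iff_repr_mem ℤ _).2 fun i => ?_
    fin_cases i
    · exact ⟨-b, by simp [h1']⟩
    · exact ⟨a, by simp [h0']⟩
  have hfin := AddSubgroup.finiteIndex_of_le hker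
  exact hfin.index_ne_zero

/-- The worst case is `c = 1 / k`, where the claim reads `|r₂| ≤ |r₁| ^ γ * k ^ (γ - 1)`. The right
side tends to `|r₁|` as `γ → 1`, so some `γ < 1` works. -/
theorem exists_rpow_exponent {r₁ r₂ : ℝ} (hr : |r₂| < |r₁|) {k : ℕ} (hk : 0 < k) :
    ∃ γ : ℝ, 0 < γ ∧ γ < 1 ∧ ∀ c : ℝ, 1 ≤ k * c → |r₂| * c ^ γ ≤ |r₁| ^ γ * c := by
  have h1 : 0 < |r₁| := (abs_nonneg _).trans_lt hr
  have hk' : (0 : ℝ) < k := by exact_mod_cast hk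
  have hcont : ContinuousAt (fun γ : ℝ => |r₁| ^ γ * (k : ℝ) ^ (γ - 1)) 1 := by
    refine ContinuousAt.mul ?_ ?_
    · exact Real.continuousAt_const_rpow h1.ne'
    · exact (Real.continuousAt_const_rpow hk'.ne').comp (by fun_prop)
  have hlt : |r₂| < (fun γ : ℝ => |r₁| ^ γ * (k : ℝ) ^ (γ - 1)) 1 := by simpa using hr
  have hev := hcont.eventually (lt_mem_nhds hlt)
  have hev2 : ∀ᶠ γ : ℝ in nhds 1, 0 < γ := lt_mem_nhds one_pos
  have hev3 := (hev.and hev2).filter_mono (nhdsWithin_le_nhds (s := Set.Iio 1))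
  obtain ⟨γ, ⟨hγ, hγ0⟩, hγ1⟩ := (hev3.and self_mem_nhdsWithin).exists
  have hγ1' : γ < 1 := hγ1
  refine ⟨γ, hγ0, hγ1', fun c hc => ?_⟩
  have hc0 : 0 < c := pos_of_mul_pos_right (one_pos.trans_le hc) hk'.le
  have h2 : (k : ℝ) ^ (γ - 1) ≤ c ^ (1 - γ) := by
    have h3 : (1 : ℝ) ≤ (k * c) ^ (1 - γ) := Real.one_le_rpow hc (by linarith)
    rw [Real.mul_rpow hk'.le hc0.le] at h3
    have h4 : (k : ℝ) ^ (γ - 1) * (k : ℝ) ^ (1 - γ) = 1 := by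
      rw [← Real.rpow_add hk']; simp
    have h5 : 0 < (k : ℝ) ^ (γ - 1) := Real.rpow_pos_of_pos hk' _
    calc (k : ℝ) ^ (γ - 1) = (k : ℝ) ^ (γ - 1) * 1 := (mul_one _).symm
      _ ≤ (k : ℝ) ^ (γ - 1) * ((k : ℝ) ^ (1 - γ) * c ^ (1 - γ)) := by gcongr
      _ = c ^ (1 - γ) := by rw [← mul_assoc, h4, one_mul]
  have hcγ : 0 < c ^ γ := Real.rpow_pos_of_pos hc0 _
  calc |r₂| * c ^ γ ≤ |r₁| ^ γ * (k : ℝ) ^ (γ - 1) * c ^ γ := by gcongr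
    _ ≤ |r₁| ^ γ * c ^ (1 - γ) * c ^ γ := by gcongr
    _ = |r₁| ^ γ * c := by
      rw [mul_assoc, ← Real.rpow_add hc0]; simp

theorem exists_bound {W : Set Plane} (hW : W.Finite) (ξ η : Plane →ₗ[ℝ] ℝ) (γ : ℝ) :
    ∃ B : ℝ, 0 ≤ B ∧ ∀ t ∈ W, ξ t ≠ 0 → |η t| ≤ B * |ξ t| ^ γ := by
  obtain ⟨B, hB⟩ := (hW.image fun t => |η t| / |ξ t| ^ γ).bddAbove
  refine ⟨max B 0, le_max_right _ _, fun t ht h => ?_⟩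
  have h1 : |η t| / |ξ t| ^ γ ≤ max B 0 := (hB ⟨t, ht, rfl⟩).trans (le_max_left _ _)
  rwa [div_le_iff₀ (Real.rpow_pos_of_pos (abs_pos.2 h) _)] at h1

/-- A sector system whose attracting sectors `QC` are permuted by `φ` and whose repelling sectors
`QD` are backward invariant gives an algebraically stable refinement. -/
theorem exists_stable_refinement {N : Submodule ℤ Plane} {e : Module.Basis (Fin 2) ℝ Plane}
    (he : ∀ i, e i ∈ N) {k : ℕ} (hk0 : 0 < k)
    (hk : ∀ n ∈ N, (k : ℝ) • n ∈ Submodule.span ℤ (Set.range e)) {φ : N →ₗ[ℤ] N} {Δ : Fan N}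
    (hΔ : Δ.IsComplete) {ξ η : Plane →ₗ[ℝ] ℝ} {κ : ℝ} {QC QD : Set (Plane × Plane)} {r₁ r₂ : ℝ}
    (hQ : IsSectorSystem e ξ η κ (QC ∪ QD)) (hr : |r₂| < |r₁|)
    (hξ : ∀ n : N, ξ (φ n) = r₁ * ξ n) (hη : ∀ n : N, η (φ n) = r₂ * η n)
    (hgen : ∀ σ ∈ Δ.cones, ∃ s : Finset Plane, (s : Set Plane) ⊆ N ∧
      σ = PointedCone.hull ℝ (s : Set Plane) ∧ ∀ g ∈ s, g ≠ 0 →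
        g ∉ sectors e (QC ∪ QD) ∧ (ξ g = 0 → ∃ t ∈ edges (QC ∪ QD), area e t g = 0))
    (hC : ∀ q ∈ QC, ∃ q' ∈ QC, ∀ n : N, (n : Plane) ∈ PointedCone.hull ℝ {q.1, q.2} →
      (φ n : Plane) ∈ PointedCone.hull ℝ {q'.1, q'.2})
    (hD : ∀ n : N, (φ n : Plane) ∈ sectors e QD → (n : Plane) ∈ sectors e QD) :
    ∃ Δ' : Fan N, Δ'.Refines Δ ∧ Toric.IsAlgebraicallyStable Δ' φ ∧
      ∃ N' : Submodule ℤ Plane, N' ≤ N ∧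
        N'.toAddSubgroup.relIndex N.toAddSubgroup ≠ 0 ∧ Δ'.IsRegular N' := by
  classical
  have hk0' : (0 : ℝ) < k := by exact_mod_cast hk0
  obtain ⟨γ, hγ0, hγ1, hγ⟩ := exists_rpow_exponent hr hk0
  choose! s hsN hsσ hs using hgen
  -- `k n` is a positive integral multiple of a primitive vector, so the content `c` of `n` is at
  -- least `1 / k`.
  have hprim : ∀ n ∈ N, n ≠ 0 → ∃ c : ℝ, 1 ≤ k * c ∧ ∃ u, IsPrimitiveVector e u ∧ n = c • u := by
    intro n hn hn0
    obtain ⟨j, hj, u, hu, h⟩ := exists_eq_nsmul_isPrimitiveVector (hk n hn)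
      (smul_ne_zero hk0'.ne' hn0)
    have hj' : (1 : ℝ) ≤ j := by exact_mod_cast hj
    refine ⟨j / k, by rw [mul_div_cancel₀ _ hk0'.ne']; exact hj', u, hu, ?_⟩
    rw [div_eq_inv_mul, mul_smul, ← h, inv_smul_smul₀ hk0'.ne']
  have hcpos : ∀ {c : ℝ}, 1 ≤ k * c → 0 < c := fun h =>
    pos_of_mul_pos_right (one_pos.trans_le h) hk0'.le
  choose! c hc p hp hcp using hprim
  set G : Set Plane := ⋃ σ ∈ Δ.cones, (s σ : Set Plane) with hG
  have hGfin : G.Finite := Δ.finite.biUnion fun σ _ => (s σ).finite_toSet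
  -- `B` has to accommodate the edges and the primitive directions of the generators of `Δ`.
  obtain ⟨B, hB0, hB⟩ := exists_bound (hQ.finite_edges.union (hGfin.image p)) ξ η γ
  set U := fareySet e ξ η (QC ∪ QD) B γ with hUdef
  have hU : IsUnimodularSystem e U :=
    hQ.isUnimodularSystem_fareySet hB0 hγ0 hγ1 fun t ht => hB t (Or.inl ht)
  have hUno : ∀ u ∈ U, u ∉ sectors e (QC ∪ QD) := fun u hu =>
    hQ.not_mem_sectors_of_mem_fareySet hu
  have hTU : edges (QC ∪ QD) ⊆ U := hQ.edges_subset_fareySet B γ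
  have hUN : ∀ u ∈ U, u ∈ N := fun u hu => hU.mem_lattice he hu
  refine ⟨hU.fan N he, hU.fan_refines he hΔ ?_, ?_, Submodule.span ℤ (Set.range e),
    Submodule.span_le.2 (Set.range_subset_iff.2 he), relIndex_span_ne_zero hk0 hk,
    hU.fan_isRegular N he⟩
  · intro σ hσ
    refine ⟨s σ, hsσ σ hσ, fun g hg hg0 => ?_⟩
    have hgN := hsN σ hσ hg
    obtain ⟨h1, h2⟩ := hs σ hσ g hg hg0
    have hc0 := hcpos (hc g hgN hg0)
    refine ⟨c g, hc0, p g, ⟨hp g hgN hg0, ?_⟩, hcp g hgN hg0⟩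
    by_cases h : ξ g = 0
    · left
      obtain ⟨t, ht, htg⟩ := h2 h
      rw [hcp g hgN hg0, area_smul_right] at htg
      rcases (hp g hgN hg0).eq_or_eq_neg (hQ.edge_isPrimitive ht)
        ((mul_eq_zero.1 htg).resolve_left hc0.ne') with h3 | h3
      · rw [h3]; exact ht
      · rw [h3]; exact hQ.neg_mem_edges ht
    · right
      constructor
      · rwa [hcp g hgN hg0, smul_mem_sectors hc0] at h1
      · refine hB _ (Or.inr ⟨g, Set.mem_biUnion hσ hg, rfl⟩) fun h3 => h ?_
        rw [hcp g hgN hg0, map_smul, h3, smul_zero]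
  · have hcellQ : ∀ q ∈ QC, ∀ x ∈ sector e q.1 q.2,
        cell e U x = PointedCone.hull ℝ {q.1, q.2} := by
      intro q hq x hx
      have hq' : q ∈ QC ∪ QD := Or.inl hq
      exact hU.cell_pair (hTU ⟨q, hq', Or.inl rfl⟩) (hTU ⟨q, hq', Or.inr rfl⟩)
        (hQ.area_eq_one q hq')
        (fun v hv h1 => not_lt.1 fun h2 => hUno v hv ⟨q, hq', h1, h2⟩) hx.1 hx.2
    have hinj : ∀ x y : Plane, ξ x = ξ y → η x = η y → x = y := fun x y h1 h2 =>
      sub_eq_zero.1 (hQ.eq_zero (by rw [map_sub, h1, sub_self]) (by rw [map_sub, h2, sub_self]))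
    -- The good cells: zero, the attracting sectors and the rays of `U`.
    set X : Set Plane := {x | x = 0 ∨ x ∈ sectors e QC ∨ ∃ c : ℝ, 0 < c ∧ ∃ u ∈ U, x = c • u} with hX
    have himage : ∀ u : N, (u : Plane) ∈ U → (φ u : Plane) ∈ X := by
      intro u hu
      by_cases h0 : (φ u : Plane) = 0
      · exact Or.inl h0
      have hN := (φ u).2
      have hc0 := hcpos (hc _ hN h0)
      have hcp' := hcp _ hN h0
      have hξu := hξ u
      have hηu := hη u
      by_cases hCs : (φ u : Plane) ∈ sectors e QC
      · exact Or.inr (Or.inl hCs)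
      refine Or.inr (Or.inr ⟨_, hc0, _, ⟨hp _ hN h0, ?_⟩, hcp'⟩)
      by_cases hu0 : ξ u = 0
      · have hT : (u : Plane) ∈ edges (QC ∪ QD) := by
          refine hu.2.resolve_right fun h => hu.1.ne_zero (hQ.eq_zero hu0 ?_)
          have := h.2
          rw [hu0, abs_zero, Real.zero_rpow hγ0.ne', mul_zero] at this
          exact abs_nonpos_iff.1 this
        left
        have hφu : (φ u : Plane) = r₂ • (u : Plane) :=
          hinj _ _ (by rw [hξu, map_smul, hu0]; simp) (by rw [hηu, map_smul, smul_eq_mul])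
        have harea : area e (u : Plane) (p (φ u)) = 0 := by
          have : area e (u : Plane) (φ u) = 0 := by rw [hφu, area_smul_right, area_self, mul_zero]
          rw [hcp', area_smul_right] at this
          exact (mul_eq_zero.1 this).resolve_left hc0.ne'
        rcases (hp _ hN h0).eq_or_eq_neg (hQ.edge_isPrimitive hT) harea with h | h
        · rw [h]; exact hT
        · rw [h]; exact hQ.neg_mem_edges hT
      · right
        constructor
        · rw [← smul_mem_sectors hc0, ← hcp']
          rintro ⟨q, hq | hq, h⟩
          · exact hCs ⟨q, hq, h⟩
          · obtain ⟨q', hq', h'⟩ := hD u ⟨q, hq, h⟩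
            exact hUno u hu ⟨q', Or.inr hq', h'⟩
        · have hb : |η u| ≤ B * |ξ u| ^ γ :=
            hu.2.elim (fun h => hB _ (Or.inl h) hu0) fun h => h.2
          rw [hcp', map_smul, smul_eq_mul] at hξu hηu
          have hξa := congrArg abs hξu
          have hηa := congrArg abs hηu
          rw [abs_mul, abs_mul, abs_of_pos hc0] at hξa hηa
          set a := c (φ u : Plane)
          set v := p (φ u : Plane)
          have h3 : (a * |ξ v|) ^ γ = |r₁| ^ γ * |ξ u| ^ γ := by
            rw [hξa, Real.mul_rpow (abs_nonneg _) (abs_nonneg _)]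
          rw [Real.mul_rpow hc0.le (abs_nonneg _)] at h3
          have haγ : 0 < a ^ γ := Real.rpow_pos_of_pos hc0 _
          have h4 := hγ a (hc _ hN h0)
          -- With `φ u = a v`, the bound for `u` becomes that for `v` by `|r₂| a ^ γ ≤ |r₁| ^ γ a`.
          have h5 : (a * a ^ γ) * |η v| ≤ (a * a ^ γ) * (B * |ξ v| ^ γ) := by
            calc (a * a ^ γ) * |η v| = (a * |η v|) * a ^ γ := by ring
              _ = (|r₂| * a ^ γ) * |η u| := by rw [hηa]; ring
              _ ≤ (|r₁| ^ γ * a) * (B * |ξ u| ^ γ) := by gcongr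
              _ = a * B * (|r₁| ^ γ * |ξ u| ^ γ) := by ring
              _ = (a * a ^ γ) * (B * |ξ v| ^ γ) := by rw [← h3]; ring
          exact le_of_mul_le_mul_left h5 (by positivity)
    refine hU.fan_isAlgebraicallyStable he hk0 hk φ X (Or.inl rfl)
      (fun u hu => Or.inr (Or.inr ⟨1, one_pos, u, hu, (one_smul _ _).symm⟩)) ?_
    rintro x (rfl | ⟨q, hq, hx⟩ | ⟨a, ha, u, hu, rfl⟩)
    · refine ⟨0, Or.inl rfl, fun n hn => ?_⟩
      rw [hU.cell_zero, Submodule.mem_bot] at hn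
      have : n = 0 := Subtype.ext hn
      rw [this, map_zero]
      exact (cell e U 0).zero_mem
    · obtain ⟨q', hq', h⟩ := hC q hq
      have hq'1 := hQ.area_eq_one q' (Or.inl hq')
      have hy : q'.1 + q'.2 ∈ sector e q'.1 q'.2 := by
        constructor
        · rw [area_add_right, area_self, hq'1]; norm_num
        · rw [area_add_left, area_self, hq'1]; norm_num
      refine ⟨q'.1 + q'.2, Or.inr (Or.inl ⟨q', hq', hy⟩), fun n hn => ?_⟩
      rw [hcellQ q' hq' _ hy]
      rw [hcellQ q hq x hx] at hn
      exact h n hn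
    · refine ⟨φ ⟨u, hUN u hu⟩, himage ⟨u, hUN u hu⟩ hu, fun n hn => ?_⟩
      obtain ⟨b, hb, hn⟩ := hU.exists_eq_smul_of_mem_cell hu hu.1.ne_zero ha hn
      have : (φ n : Plane) = b • (φ ⟨u, hUN u hu⟩ : Plane) := by
        apply hinj
        · rw [map_smul, hξ, hξ, hn, map_smul, smul_eq_mul, smul_eq_mul]; ring
        · rw [map_smul, hη, hη, hn, map_smul, smul_eq_mul, smul_eq_mul]; ring
      rw [this]
      exact (cell e U _).smul_mem hb (self_mem_cell _)
end

/-! ### Real eigenvalues, eigenforms and lattice vectors -/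

noncomputable section

section Eigenforms

/-- The roots of a real quadratic are real or conjugate, and conjugate roots have equal norm. -/
theorem Complex.im_eq_zero_of_norm_lt {ρ₁ ρ₂ : ℂ} {t d : ℝ} (ht : ρ₁ + ρ₂ = t) (hd : ρ₁ * ρ₂ = d)
    (h : ‖ρ₂‖ < ‖ρ₁‖) : ρ₁.im = 0 ∧ ρ₂.im = 0 := by
  have h1 := congrArg Complex.im ht
  have h2 := congrArg Complex.im hd
  simp only [Complex.add_im, Complex.mul_im, Complex.ofReal_im] at h1 h2
  have h3 : ρ₂.im = -ρ₁.im := by linarith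
  have h4 : ρ₁.im * (ρ₂.re - ρ₁.re) = 0 := by rw [h3] at h2; linarith
  rcases mul_eq_zero.1 h4 with h5 | h5
  · exact ⟨h5, by rw [h3, h5, neg_zero]⟩
  · exfalso
    have : ‖ρ₂‖ ^ 2 = ‖ρ₁‖ ^ 2 := by
      rw [Complex.sq_norm, Complex.sq_norm, Complex.normSq_apply, Complex.normSq_apply, h3,
        sub_eq_zero.1 h5]
      ring
    nlinarith [norm_nonneg ρ₁, norm_nonneg ρ₂]

variable {N : Submodule ℤ Plane} {f : Module.Basis (Fin 2) ℝ Plane}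

theorem Matrix.exists_real_roots_of_charpoly_roots {A : Matrix (Fin 2) (Fin 2) ℤ} {ρ₁ ρ₂ : ℂ}
    (hρ : (A.charpoly.map (Int.castRingHom ℂ)).roots = {ρ₁, ρ₂}) (hlt : ‖ρ₂‖ < ‖ρ₁‖) :
    ∃ r₁ r₂ : ℝ, |r₂| < |r₁| ∧ ((A.map (Int.cast : ℤ → ℝ)) - Matrix.scalar (Fin 2) r₁).det = 0 ∧
      ((A.map (Int.cast : ℤ → ℝ)) - Matrix.scalar (Fin 2) r₂).det = 0 := by
  set P := A.charpoly.map (Int.castRingHom ℂ) with hP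
  have hmonic : P.Monic := A.charpoly_monic.map _
  have hprod : P = (Polynomial.X - Polynomial.C ρ₁) * (Polynomial.X - Polynomial.C ρ₂) := by
    have h := (IsAlgClosed.splits P).eq_prod_roots_of_monic hmonic
    rw [h, hρ]
    simp
  have heval : ∀ z : ℂ, z ^ 2 - (A.trace : ℂ) * z + (A.det : ℂ) = (z - ρ₁) * (z - ρ₂) := by
    intro z
    have h := congrArg (Polynomial.eval z) hprod
    rw [hP, Matrix.charpoly_fin_two] at h
    simpa using h
  have hd : ρ₁ * ρ₂ = ((A.det : ℝ) : ℂ) := by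
    have := heval 0
    rw [Complex.ofReal_intCast]
    linear_combination -this
  have ht : ρ₁ + ρ₂ = ((A.trace : ℝ) : ℂ) := by
    have h0 := heval 0
    have h1 := heval 1
    rw [Complex.ofReal_intCast]
    linear_combination h1 - h0
  obtain ⟨him1, him2⟩ := Complex.im_eq_zero_of_norm_lt ht hd hlt
  have e1 : ρ₁ = (ρ₁.re : ℂ) := Complex.ext rfl (by simp [him1])
  have e2 : ρ₂ = (ρ₂.re : ℂ) := Complex.ext rfl (by simp [him2])
  have hroot : ∀ r : ℝ, ((r : ℂ) = ρ₁ ∨ (r : ℂ) = ρ₂) →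
      ((A.map (Int.cast : ℤ → ℝ)) - Matrix.scalar (Fin 2) r).det = 0 := by
    intro r hr
    have h1 : (r : ℂ) ^ 2 - (A.trace : ℂ) * r + (A.det : ℂ) = 0 := by
      rw [heval]
      rcases hr with h | h <;> simp [h]
    have hcast : ∀ t d : ℤ, (r : ℂ) ^ 2 - (t : ℂ) * r + (d : ℂ) = 0 →
        r ^ 2 - (t : ℝ) * r + (d : ℝ) = 0 := fun t d h => by exact_mod_cast h
    have h2 := hcast _ _ h1
    rw [Matrix.trace_fin_two, Matrix.det_fin_two] at h2
    rw [Matrix.det_fin_two]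
    simp
    push_cast at h2
    linarith
  refine ⟨ρ₁.re, ρ₂.re, ?_, hroot _ (Or.inl e1.symm), hroot _ (Or.inr e2.symm)⟩
  rw [e1, e2] at hlt
  simpa using hlt

/-- A left eigenvector of the matrix of `φ`, extended linearly to the plane. -/
theorem exists_eigenform (b : Module.Basis (Fin 2) ℤ N) (hf : ∀ i, f i = b i) (φ : N →ₗ[ℤ] N)
    {r : ℝ} (hr : (((LinearMap.toMatrix b b φ).map (Int.cast : ℤ → ℝ)) -
      Matrix.scalar (Fin 2) r).det = 0) :
    ∃ ξ : Plane →ₗ[ℝ] ℝ, ξ ≠ 0 ∧ ∀ n : N, ξ (φ n) = r * ξ n := by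
  obtain ⟨l, hl0, hl⟩ := Matrix.exists_vecMul_eq_zero_iff.2 hr
  set ξ : Plane →ₗ[ℝ] ℝ := f.constr ℝ l with hξ
  have hξb : ∀ i, ξ (b i) = l i := fun i => by
    rw [← hf, hξ, f.constr_basis]
  refine ⟨ξ, fun h => hl0 (funext fun i => by rw [← hξb, h]; rfl), ?_⟩
  have key : ((ξ.restrictScalars ℤ).comp N.subtype).comp φ =
      ((r • ξ).restrictScalars ℤ).comp N.subtype := by
    refine b.ext fun j => ?_
    have h1 : φ (b j) = ∑ i, LinearMap.toMatrix b b φ i j • b i := by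
      conv_lhs => rw [← b.sum_repr (φ (b j))]
      simp [LinearMap.toMatrix_apply]
    have h2 := congrFun hl j
    simp only [LinearMap.comp_apply, LinearMap.restrictScalars_apply, Submodule.subtype_apply,
      LinearMap.smul_apply, smul_eq_mul]
    rw [h1, hξb]
    simp only [Fin.sum_univ_two, Submodule.coe_add, Submodule.coe_smul, map_add, map_zsmul, hξb]
    simp [Matrix.vecMul, dotProduct, Fin.sum_univ_two] at h2
    fin_cases j <;> simp at h2 ⊢ <;> linarith
  intro n
  exact LinearMap.congr_fun key n

theorem eigenforms_independent (b : Module.Basis (Fin 2) ℤ N) (hf : ∀ i, f i = b i)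
    {φ : N →ₗ[ℤ] N} {ξ η : Plane →ₗ[ℝ] ℝ} {r₁ r₂ : ℝ} (hr : r₁ ≠ r₂) (hξ0 : ξ ≠ 0) (hη0 : η ≠ 0)
    (hξ : ∀ n : N, ξ (φ n) = r₁ * ξ n) (hη : ∀ n : N, η (φ n) = r₂ * η n) :
    ξ (f 0) * η (f 1) - η (f 0) * ξ (f 1) ≠ 0 := by
  intro hdet
  obtain ⟨s, t, hst, h⟩ : ∃ s t : ℝ, (s ≠ 0 ∨ t ≠ 0) ∧ s • ξ = t • η := by
    have hex : ∃ i, η (f i) ≠ 0 := by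
      by_contra! h
      exact hη0 (f.ext fun i => by rw [h i]; rfl)
    obtain ⟨i, hi⟩ := hex
    refine ⟨η (f i), ξ (f i), Or.inl hi, f.ext fun j => ?_⟩
    simp only [LinearMap.smul_apply, smul_eq_mul]
    fin_cases i <;> fin_cases j <;> simp <;> linarith
  have hn : ∀ n : N, s * ξ n = 0 ∧ t * η n = 0 := by
    intro n
    have h1 := LinearMap.congr_fun h n
    have h2 := LinearMap.congr_fun h (φ n)
    simp only [LinearMap.smul_apply, smul_eq_mul, hξ, hη] at h1 h2
    have h3 : (r₁ - r₂) * (s * ξ n) = 0 := by linear_combination h2 - r₂ * h1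
    have h4 := (mul_eq_zero.1 h3).resolve_left (sub_ne_zero.2 hr)
    exact ⟨h4, by rw [← h1, h4]⟩
  rcases hst with h0 | h0
  · exact hξ0 (f.ext fun i => by
      rw [hf]
      exact (mul_eq_zero.1 (hn (b i)).1).resolve_left h0)
  · exact hη0 (f.ext fun i => by
      rw [hf]
      exact (mul_eq_zero.1 (hn (b i)).2).resolve_left h0)

end Eigenforms

section Lattice

variable {N : Submodule ℤ Plane} {ξ η : Plane →ₗ[ℝ] ℝ}

theorem area_eq_mul (e : Module.Basis (Fin 2) ℝ Plane) (ξ η : Plane →ₗ[ℝ] ℝ) (x y : Plane) :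
    ξ x * η y - η x * ξ y = area e x y * (ξ (e 0) * η (e 1) - η (e 0) * ξ (e 1)) := by
  have hx := eq_of_area_eq_one (area_basis (e := e)) x
  have hy := eq_of_area_eq_one (area_basis (e := e)) y
  have hxy : area e x y = area e x (e 1) * area e (e 0) y - area e (e 0) x * area e y (e 1) := by
    simp [area]
  rw [hxy]
  conv_lhs => rw [hx, hy]
  simp only [map_add, map_smul, smul_eq_mul]
  ring

theorem exists_basis_of_ne_zero {u w : Plane} (h : ξ u * η w - η u * ξ w ≠ 0) :
    ∃ e : Module.Basis (Fin 2) ℝ Plane, e 0 = u ∧ e 1 = w := by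
  have hli : LinearIndependent ℝ ![u, w] := by
    rw [LinearIndependent.pair_iff]
    intro s t hst
    have h1 := congrArg ξ hst
    have h2 := congrArg η hst
    simp only [map_add, map_smul, smul_eq_mul, map_zero] at h1 h2
    constructor
    · refine (mul_eq_zero.1 (?_ : s * (ξ u * η w - η u * ξ w) = 0)).resolve_right h
      linear_combination η w * h1 - ξ w * h2
    · refine (mul_eq_zero.1 (?_ : t * (ξ u * η w - η u * ξ w) = 0)).resolve_right h
      linear_combination ξ u * h2 - η u * h1
  refine ⟨basisOfLinearIndependentOfCardEqFinrank hli (by simp), ?_, ?_⟩ <;> simp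

/-- Cramer's rule: the determinant of `e` in the basis `f` is a common denominator. -/
theorem exists_nat_smul_mem_span {f e : Module.Basis (Fin 2) ℝ Plane}
    (hf : Submodule.span ℤ (Set.range f) = N) (he : ∀ i, e i ∈ N) :
    ∃ k : ℕ, 0 < k ∧ ∀ n ∈ N, (k : ℝ) • n ∈ Submodule.span ℤ (Set.range e) := by
  subst hf
  obtain ⟨d, hd⟩ := area_eq_intCast (he 0) (he 1)
  have hd0 : d ≠ 0 := by
    rintro rfl
    have h := area_eq_mul f (e.coord 0) (e.coord 1) (e 0) (e 1)
    rw [hd] at h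
    simp at h
  have key : ∀ n ∈ Submodule.span ℤ (Set.range f),
      (d : ℝ) • n ∈ Submodule.span ℤ (Set.range e) := by
    intro n hn
    obtain ⟨a, ha⟩ := area_eq_intCast hn (he 1)
    obtain ⟨b, hb⟩ := area_eq_intCast (he 0) hn
    rw [← hd, area_smul_eq, ha, hb, Int.cast_smul_eq_zsmul, Int.cast_smul_eq_zsmul]
    exact add_mem (Submodule.smul_mem _ _ (Submodule.subset_span ⟨0, rfl⟩))
      (Submodule.smul_mem _ _ (Submodule.subset_span ⟨1, rfl⟩))
  refine ⟨d.natAbs, Int.natAbs_pos.2 hd0, fun n hn => ?_⟩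
  have h : (d.natAbs : ℝ) = |(d : ℝ)| := by rw [Nat.cast_natAbs, Int.cast_abs]
  rw [h]
  rcases abs_choice (d : ℝ) with h | h
  · rw [h]
    exact key n hn
  · rw [h, neg_smul]
    exact neg_mem (key n hn)

/-- An open cone contains a ball around `x₀`; scaled by a large `K`, the ball is wider than a
fundamental domain and contains the lattice point `floor (K x₀)`. -/
theorem exists_lattice_mem_cone {f : Module.Basis (Fin 2) ℝ Plane}
    (hf : Submodule.span ℤ (Set.range f) = N) (hdet : ξ (f 0) * η (f 1) - η (f 0) * ξ (f 1) ≠ 0)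
    {α β : ℝ} (hαβ : α < β) : ∃ n ∈ N, 0 < ξ n ∧ α * ξ n < η n ∧ η n < β * ξ n := by
  subst hf
  set D := ξ (f 0) * η (f 1) - η (f 0) * ξ (f 1) with hD
  set m := (α + β) / 2 with hm
  set x₀ : Plane := ((η (f 1) - m * ξ (f 1)) / D) • f 0 +
    ((m * ξ (f 0) - η (f 0)) / D) • f 1 with hx₀
  have hξ0 : ξ x₀ = 1 := by
    rw [hx₀]
    simp only [map_add, map_smul, smul_eq_mul]
    field_simp
    rw [hD]; ring
  have hη0 : η x₀ = m := by
    rw [hx₀]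
    simp only [map_add, map_smul, smul_eq_mul]
    field_simp
    rw [hD]; ring
  have hcξ : Continuous ξ := ξ.continuous_of_finiteDimensional
  have hcη : Continuous η := η.continuous_of_finiteDimensional
  have hopen : IsOpen {x : Plane | 0 < ξ x ∧ α * ξ x < η x ∧ η x < β * ξ x} :=
    (isOpen_lt continuous_const hcξ).inter ((isOpen_lt (hcξ.const_mul α) hcη).inter
      (isOpen_lt hcη (hcξ.const_mul β)))
  have hmem : x₀ ∈ {x : Plane | 0 < ξ x ∧ α * ξ x < η x ∧ η x < β * ξ x} := by
    refine ⟨?_, ?_, ?_⟩ <;> simp only [hξ0, hη0] <;> linarith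
  obtain ⟨ε, hε, hball⟩ := Metric.isOpen_iff.1 hopen x₀ hmem
  obtain ⟨K, hK⟩ := exists_nat_gt ((∑ i, ‖f i‖) / ε)
  have hsum : 0 ≤ ∑ i, ‖f i‖ := Finset.sum_nonneg fun i _ => norm_nonneg _
  have hK0 : (0 : ℝ) < K := (div_nonneg hsum hε.le).trans_lt hK
  set n : Plane := (ZSpan.floor f ((K : ℝ) • x₀)).1 with hn
  have hfract : ‖(K : ℝ) • x₀ - n‖ ≤ ∑ i, ‖f i‖ := ZSpan.norm_fract_le f ((K : ℝ) • x₀)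
  have hnb : (K : ℝ)⁻¹ • n ∈ Metric.ball x₀ ε := by
    have : (K : ℝ)⁻¹ • n - x₀ = -((K : ℝ)⁻¹ • ((K : ℝ) • x₀ - n)) := by
      rw [smul_sub, inv_smul_smul₀ hK0.ne', neg_sub]
    rw [Metric.mem_ball, dist_eq_norm, this, norm_neg, norm_smul, norm_inv, Real.norm_eq_abs,
      abs_of_pos hK0, inv_mul_lt_iff₀ hK0]
    rw [div_lt_iff₀ hε] at hK
    exact hfract.trans_lt hK
  obtain ⟨h1, h2, h3⟩ := hball hnb
  simp only [map_smul, smul_eq_mul] at h1 h2 h3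
  have hKi : (0 : ℝ) < (K : ℝ)⁻¹ := inv_pos.2 hK0
  refine ⟨n, (ZSpan.floor f ((K : ℝ) • x₀)).2, pos_of_mul_pos_right h1 hKi.le, ?_, ?_⟩
  · rw [mul_left_comm] at h2
    exact lt_of_mul_lt_mul_left h2 hKi.le
  · rw [mul_left_comm] at h3
    exact lt_of_mul_lt_mul_left h3 hKi.le

/-- A lattice eigenvector makes `r₂ = c / a` rational, and the integral map `a φ - c` sends the
lattice into the other eigenline `η = 0`. It does not kill a basis vector with `ξ ≠ 0`. -/
theorem exists_eigenvector_of_eigenvector {f : Module.Basis (Fin 2) ℝ Plane}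
    (hf : Submodule.span ℤ (Set.range f) = N) (hdet : ξ (f 0) * η (f 1) - η (f 0) * ξ (f 1) ≠ 0)
    {φ : N →ₗ[ℤ] N} {r₁ r₂ : ℝ} (hr : r₁ ≠ r₂) (hξ : ∀ n : N, ξ (φ n) = r₁ * ξ n)
    (hη : ∀ n : N, η (φ n) = r₂ * η n) {n : N} (hn : n ≠ 0) (hn0 : ξ n = 0) :
    ∃ u : N, u ≠ 0 ∧ η u = 0 := by
  subst hf
  have hinj : ∀ x : Plane, ξ x = 0 → η x = 0 → x = 0 := fun x h1 h2 =>
    eq_zero_of_area_eq_zero (e := f) fun z => by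
      have := area_eq_mul f ξ η z x
      rw [h1, h2] at this
      simpa [hdet] using this.symm
  have hφn : (φ n : Plane) = r₂ • (n : Plane) := by
    refine sub_eq_zero.1 (hinj _ ?_ ?_)
    · rw [map_sub, hξ, map_smul, hn0]; simp
    · rw [map_sub, hη, map_smul, smul_eq_mul, sub_self]
  obtain ⟨i, hi⟩ : ∃ i, area f (f i) n ≠ 0 := by
    by_contra! h
    apply hn
    apply Subtype.ext
    have h0 := h 0
    have h1 := h 1
    rw [area_basis_zero_left] at h0
    rw [area_basis_one_left, neg_eq_zero] at h1
    apply f.repr.injective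
    ext i
    fin_cases i <;> simp [h0, h1]
  obtain ⟨j, hj⟩ : ∃ j, ξ (f j) ≠ 0 := by
    by_contra! h
    rw [h 0, h 1] at hdet
    simp at hdet
  obtain ⟨a, ha⟩ := area_eq_intCast (Submodule.subset_span (Set.mem_range_self i)) n.2
  obtain ⟨c, hc⟩ := area_eq_intCast (Submodule.subset_span (Set.mem_range_self i)) (φ n).2
  have hac : (c : ℝ) = r₂ * a := by rw [← hc, ← ha, hφn, area_smul_right]
  set z : Submodule.span ℤ (Set.range f) := ⟨f j, Submodule.subset_span ⟨j, rfl⟩⟩ with hz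
  have hval : ((a • φ z - c • z : Submodule.span ℤ (Set.range f)) : Plane) =
      (a : ℝ) • (φ z : Plane) - (c : ℝ) • f j := by
    rw [Int.cast_smul_eq_zsmul, Int.cast_smul_eq_zsmul]
    rfl
  have hξz : ξ (φ z) = r₁ * ξ (f j) := hξ z
  have hηz : η (φ z) = r₂ * η (f j) := hη z
  refine ⟨a • φ z - c • z, fun h => ?_, ?_⟩
  · have h1 : ξ ((a • φ z - c • z : Submodule.span ℤ (Set.range f)) : Plane) = 0 := by
      rw [h]; exact map_zero ξ
    rw [hval, map_sub, map_smul, map_smul, hξz, hac, smul_eq_mul, smul_eq_mul] at h1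
    have h2 : (a : ℝ) * (r₁ - r₂) * ξ (f j) = 0 := by linear_combination h1
    refine mul_ne_zero (mul_ne_zero ?_ (sub_ne_zero.2 hr)) hj h2
    rwa [← ha]
  · rw [hval, map_sub, map_smul, map_smul, hηz, hac, smul_eq_mul, smul_eq_mul]
    ring

theorem exists_pos_mul_le {G : Set Plane} (hG : G.Finite) (ξ η : Plane →ₗ[ℝ] ℝ) :
    ∃ δ : ℝ, 0 < δ ∧ ∀ g ∈ G, η g ≠ 0 → δ * |ξ g| ≤ |η g| := by
  obtain ⟨B, hB⟩ := (hG.image fun t => |ξ t| / |η t|).bddAbove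
  refine ⟨(max B 1)⁻¹, by positivity, fun g hg h => ?_⟩
  have h1 : |ξ g| / |η g| ≤ max B 1 := (hB ⟨g, hg, rfl⟩).trans (le_max_left _ _)
  rw [div_le_iff₀ (abs_pos.2 h)] at h1
  rwa [inv_mul_le_iff₀ (by positivity)]

end Lattice
end

/-! ### Balanced thin sectors around both eigenlines -/

noncomputable section

theorem mul_lt_zero_iff_of_pos_left {p x : ℝ} (hp : 0 < p) : p * x < 0 ↔ x < 0 := by
  rw [mul_neg_iff]
  exact ⟨fun h => h.elim And.right fun h' => absurd h'.1 hp.not_gt, fun h => Or.inl ⟨hp, h⟩⟩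

/-- A quadratic form of the slope conditions that treats a sector and its opposite together. -/
theorem slope_between_iff {a a' y z : ℝ} (h : 0 < a + a') :
    (0 < z + a' * y ∧ 0 < a * y - z ∨ z + a' * y < 0 ∧ a * y - z < 0) ↔
      -(a' * y ^ 2) < y * z ∧ y * z < a * y ^ 2 := by
  constructor
  · rintro (⟨h1, h2⟩ | ⟨h1, h2⟩)
    · have hy : 0 < y := pos_of_mul_pos_right (by nlinarith : 0 < (a + a') * y) h.le
      constructor <;> nlinarith
    · have hy : y < 0 := by nlinarith
      constructor <;> nlinarith
  · rintro ⟨h1, h2⟩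
    rcases lt_trichotomy y 0 with hy | rfl | hy
    · right
      constructor <;> nlinarith
    · simp at h1 h2
    · left
      constructor
      · exact pos_of_mul_pos_right (by nlinarith : 0 < y * (z + a' * y)) hy.le
      · exact pos_of_mul_pos_right (by nlinarith : 0 < y * (a * y - z)) hy.le

/-- The sector between `c` and `c'` and its opposite. -/
def doubleSector (c c' : Plane) : Set (Plane × Plane) := {(c, c'), (-c, -c')}

section DoubleSector

variable {e : Module.Basis (Fin 2) ℝ Plane} {ξ η : Plane →ₗ[ℝ] ℝ} {κ : ℝ}

theorem mem_sectors_union {Q Q' : Set (Plane × Plane)} {x : Plane} :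
    x ∈ sectors e (Q ∪ Q') ↔ x ∈ sectors e Q ∨ x ∈ sectors e Q' := by
  simp only [sectors, Set.mem_ofPred_eq, Set.mem_union, or_and_right, exists_or]

theorem mem_edges_union {Q Q' : Set (Plane × Plane)} {x : Plane} :
    x ∈ edges (Q ∪ Q') ↔ x ∈ edges Q ∨ x ∈ edges Q' := by
  simp only [edges, Set.mem_ofPred_eq, Set.mem_union, or_and_right, exists_or]

theorem mem_sectors_doubleSector {c c' x : Plane} : x ∈ sectors e (doubleSector c c') ↔
    (0 < area e c x ∧ 0 < area e x c') ∨ (area e c x < 0 ∧ area e x c' < 0) := by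
  simp [sectors, doubleSector, sector, area_neg_left, area_neg_right]

theorem mem_edges_doubleSector {c c' x : Plane} : x ∈ edges (doubleSector c c') ↔
    x = c ∨ x = c' ∨ x = -c ∨ x = -c' := by
  simp [edges, doubleSector, or_assoc]

theorem neg_mem_doubleSector {c c' : Plane} {q : Plane × Plane} (hq : q ∈ doubleSector c c') :
    (-q.1, -q.2) ∈ doubleSector c c' := by
  rcases hq with rfl | hq
  · exact Or.inr rfl
  · rw [Set.mem_singleton_iff.1 hq]
    left
    simp

theorem forall_mem_doubleSector {c c' : Plane} {p : Plane × Plane → Prop} (h : p (c, c'))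
    (h' : p (-c, -c')) : ∀ q ∈ doubleSector c c', p q := by
  rintro q (rfl | hq)
  · exact h
  · rw [Set.mem_singleton_iff.1 hq]
    exact h'

theorem mem_sectors_doubleSector_iff_right (hκ : 0 < κ)
    (harea : ∀ x y, area e x y = κ * (ξ x * η y - η x * ξ y)) {c c' : Plane} {a a' : ℝ}
    (ha : 0 < a) (ha' : 0 < a') (hc : 0 < ξ c) (hc' : 0 < ξ c') (hcη : η c = -(a' * ξ c))
    (hcη' : η c' = a * ξ c') (x : Plane) :
    x ∈ sectors e (doubleSector c c') ↔
      -(a' * ξ x ^ 2) < ξ x * η x ∧ ξ x * η x < a * ξ x ^ 2 := by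
  have h1 : area e c x = (κ * ξ c) * (η x + a' * ξ x) := by rw [harea, hcη]; ring
  have h2 : area e x c' = (κ * ξ c') * (a * ξ x - η x) := by rw [harea, hcη']; ring
  have p1 : 0 < κ * ξ c := mul_pos hκ hc
  have p2 : 0 < κ * ξ c' := mul_pos hκ hc'
  rw [mem_sectors_doubleSector, h1, h2, ← slope_between_iff (add_pos ha ha'),
    mul_pos_iff_of_pos_left p1, mul_pos_iff_of_pos_left p2, mul_lt_zero_iff_of_pos_left p1,
    mul_lt_zero_iff_of_pos_left p2]

theorem mem_sectors_doubleSector_iff_left (hκ : 0 < κ)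
    (harea : ∀ x y, area e x y = κ * (ξ x * η y - η x * ξ y)) {c c' : Plane} {b b' : ℝ}
    (hb : 0 < b) (hb' : 0 < b') (hc : 0 < η c) (hc' : 0 < η c') (hcξ : ξ c = b * η c)
    (hcξ' : ξ c' = -(b' * η c')) (x : Plane) :
    x ∈ sectors e (doubleSector c c') ↔
      -(b' * η x ^ 2) < η x * ξ x ∧ η x * ξ x < b * η x ^ 2 := by
  have h1 : area e c x = (κ * η c) * (b * η x - ξ x) := by rw [harea, hcξ]; ring
  have h2 : area e x c' = (κ * η c') * (ξ x + b' * η x) := by rw [harea, hcξ']; ring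
  have p1 : 0 < κ * η c := mul_pos hκ hc
  have p2 : 0 < κ * η c' := mul_pos hκ hc'
  rw [mem_sectors_doubleSector, h1, h2, ← slope_between_iff (add_pos hb hb'),
    mul_pos_iff_of_pos_left p1, mul_pos_iff_of_pos_left p2, mul_lt_zero_iff_of_pos_left p1,
    mul_lt_zero_iff_of_pos_left p2, and_comm, and_comm (a := b * η x - ξ x < 0)]

end DoubleSector

theorem not_between_of_mul_abs_le {a a' δ y z : ℝ} (ha : a ≤ δ) (ha' : a' ≤ δ)
    (h : δ * |y| ≤ |z|) : ¬(-(a' * y ^ 2) < y * z ∧ y * z < a * y ^ 2) := by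
  rintro ⟨h1, h2⟩
  have h3 : |y * z| < δ * y ^ 2 := by
    rw [abs_lt]
    constructor <;> nlinarith [sq_nonneg y]
  rw [abs_mul, ← sq_abs y] at h3
  nlinarith [abs_nonneg y, mul_le_mul_of_nonneg_left h (abs_nonneg y)]

theorem between_of_abs_lt {a a' δ y z : ℝ} (ha : δ ≤ a) (ha' : δ ≤ a') (h : |z| < δ * |y|) :
    -(a' * y ^ 2) < y * z ∧ y * z < a * y ^ 2 := by
  have hy : 0 < |y| := by
    rcases (abs_nonneg y).eq_or_lt with h0 | h0
    · rw [← h0, mul_zero] at h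
      exact absurd h (abs_nonneg z).not_gt
    · exact h0
  have h3 : |y * z| < δ * y ^ 2 := by
    rw [abs_mul, ← sq_abs y]
    nlinarith
  rw [abs_lt] at h3
  constructor <;> nlinarith [sq_nonneg y]

/-- The sector from `e 1 - n e 0` to `e 1 - (n + 1) e 0` has slopes `b`, `b'` determined by `m = ξ
(e 1) / ξ (e 0)`. For `m` near `n + 1 / 2` the numerators nearly agree, and for large `n` the
denominators do too. A whole interval of `m` is kept because only a dense set of ratios is available
later. -/
theorem exists_balanced_slopes {θ a a' t : ℝ} (hθ0 : 0 ≤ θ) (hθ : θ < 1) (ha : 0 < a)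
    (ha' : 0 < a') (ht : 0 < t) :
    ∃ (n : ℕ) (l u : ℝ), 0 < l ∧ l < u ∧ ∀ m : ℝ, l < m → m < u → (n : ℝ) < m ∧ m < n + 1 ∧
      ∃ b b' : ℝ, b * (a * m + n * a') = m - n ∧ b' * (a * m + (n + 1) * a') = n + 1 - m ∧
        b ≤ t ∧ b' ≤ t ∧ θ * b ≤ b' ∧ θ * b' ≤ b := by
  -- The first bound makes the difference `a'` of the denominators negligible, the second makes both
  -- slopes at most `t`.
  obtain ⟨n, hn⟩ := exists_nat_gt (max (4 / (1 - θ)) (1 / (a' * t)))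
  have hθ' : 0 < 1 - θ := by linarith
  have hn1 := (le_max_left _ _).trans_lt hn
  have hn2 := (le_max_right _ _).trans_lt hn
  rw [div_lt_iff₀ hθ'] at hn1
  rw [div_lt_iff₀ (by positivity)] at hn2
  have hn0 : (0 : ℝ) ≤ n := Nat.cast_nonneg n
  refine ⟨n, n + 1 / 2 - (1 - θ) / 8, n + 1 / 2 + (1 - θ) / 8, by linarith, by linarith,
    fun m hl hu => ?_⟩
  have hm1 : (n : ℝ) < m := by linarith
  have hm2 : m < n + 1 := by linarith
  have hm0 : 0 < m := by linarith
  set S := a * m + n * a' with hS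
  have hS0 : 0 < S := by positivity
  have hSn : n * a' ≤ S := by rw [hS]; linarith [mul_pos ha hm0]
  have hS' : a * m + (n + 1) * a' = S + a' := by rw [hS]; ring
  have hSt : 1 ≤ t * S := by nlinarith
  refine ⟨hm1, hm2, (m - n) / S, (n + 1 - m) / (S + a'), by field_simp, ?_, ?_, ?_, ?_, ?_⟩
  · rw [hS']; field_simp
  · rw [div_le_iff₀ hS0]; linarith
  · rw [div_le_iff₀ (by positivity)]; nlinarith
  · rw [← mul_div_assoc, div_le_div_iff₀ hS0 (by positivity)]
    have h1 : (1 - θ) / 4 ≤ 1 - (m - n) - θ * (m - n) := by nlinarith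
    have h2 : 1 ≤ n * (1 - (m - n) - θ * (m - n)) := by nlinarith
    have h3 : a' ≤ S * (1 - (m - n) - θ * (m - n)) := by nlinarith
    have h4 : θ * (m - n) ≤ 1 := by nlinarith
    nlinarith
  · rw [← mul_div_assoc, div_le_div_iff₀ (by positivity) hS0]
    have h1 : θ * (n + 1 - m) ≤ m - n := by nlinarith
    nlinarith [mul_le_mul_of_nonneg_right h1 hS0.le, mul_pos (sub_pos.2 hm1) ha']

section

variable {N : Submodule ℤ Plane} {e : Module.Basis (Fin 2) ℝ Plane} {ξ η : Plane →ₗ[ℝ] ℝ}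

/-- The numerical data of two unimodular double sectors around the lines `η = 0` and `ξ = 0`. -/
structure IsBalanced (e : Module.Basis (Fin 2) ℝ Plane) (ξ η : Plane →ₗ[ℝ] ℝ) (n : ℕ)
    (a a' b b' : ℝ) : Prop where
  ha : 0 < a
  ha' : 0 < a'
  hb : 0 < b
  hb' : 0 < b'
  pos_zero : 0 < ξ (e 0)
  pos_one : 0 < ξ (e 1)
  eta_zero : η (e 0) = -(a' * ξ (e 0))
  eta_one : η (e 1) = a * ξ (e 1)
  pos_fst : 0 < η (e 1 - (n : ℝ) • e 0)
  pos_snd : 0 < η (e 1 - ((n : ℝ) + 1) • e 0)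
  xi_fst : ξ (e 1 - (n : ℝ) • e 0) = b * η (e 1 - (n : ℝ) • e 0)
  xi_snd : ξ (e 1 - ((n : ℝ) + 1) • e 0) = -(b' * η (e 1 - ((n : ℝ) + 1) • e 0))
  -- These two inequalities keep the attracting and repelling sectors disjoint.
  mul_le : a * b ≤ 1
  mul_le' : a' * b' ≤ 1

namespace IsBalanced

variable {n : ℕ} {a a' b b' : ℝ}

theorem det_pos (h : IsBalanced e ξ η n a a' b b') :
    0 < ξ (e 0) * η (e 1) - η (e 0) * ξ (e 1) := by
  have := mul_pos h.pos_zero h.pos_one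
  rw [h.eta_zero, h.eta_one]
  nlinarith [mul_pos h.ha this, mul_pos h.ha' this]

theorem area_eq (h : IsBalanced e ξ η n a a' b b') (x y : Plane) :
    area e x y = (ξ (e 0) * η (e 1) - η (e 0) * ξ (e 1))⁻¹ * (ξ x * η y - η x * ξ y) := by
  rw [area_eq_mul e ξ η x y, mul_comm (area e x y), inv_mul_cancel_left₀ h.det_pos.ne']

theorem mem_right (h : IsBalanced e ξ η n a a' b b') (x : Plane) :
    x ∈ sectors e (doubleSector (e 0) (e 1)) ↔
      -(a' * ξ x ^ 2) < ξ x * η x ∧ ξ x * η x < a * ξ x ^ 2 :=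
  mem_sectors_doubleSector_iff_right (inv_pos.2 h.det_pos) h.area_eq h.ha h.ha' h.pos_zero h.pos_one
    h.eta_zero h.eta_one x

theorem mem_left (h : IsBalanced e ξ η n a a' b b') (x : Plane) :
    x ∈ sectors e (doubleSector (e 1 - (n : ℝ) • e 0) (e 1 - ((n : ℝ) + 1) • e 0)) ↔
      -(b' * η x ^ 2) < η x * ξ x ∧ η x * ξ x < b * η x ^ 2 :=
  mem_sectors_doubleSector_iff_left (inv_pos.2 h.det_pos) h.area_eq h.hb h.hb' h.pos_fst h.pos_snd
    h.xi_fst h.xi_snd x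

theorem isSectorSystem (h : IsBalanced e ξ η n a a' b b') :
    IsSectorSystem e ξ η (ξ (e 0) * η (e 1) - η (e 0) * ξ (e 1))⁻¹
      (doubleSector (e 0) (e 1) ∪
        doubleSector (e 1 - (n : ℝ) • e 0) (e 1 - ((n : ℝ) + 1) • e 0)) where
  pos := inv_pos.2 h.det_pos
  area_eq := h.area_eq
  finite := by simp [doubleSector]
  neg_mem := fun q hq => hq.imp neg_mem_doubleSector neg_mem_doubleSector
  fst_mem := by
    have h0 : e 0 ∈ Submodule.span ℤ (Set.range e) := Submodule.subset_span ⟨0, rfl⟩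
    have h1 : e 1 ∈ Submodule.span ℤ (Set.range e) := Submodule.subset_span ⟨1, rfl⟩
    have h2 : e 1 - (n : ℝ) • e 0 ∈ Submodule.span ℤ (Set.range e) := by
      rw [Nat.cast_smul_eq_nsmul]
      exact sub_mem h1 (nsmul_mem h0 n)
    rintro q (hq | hq)
    · exact forall_mem_doubleSector (p := fun q => q.1 ∈ Submodule.span ℤ (Set.range e)) h0
        (neg_mem h0) q hq
    · exact forall_mem_doubleSector (p := fun q => q.1 ∈ Submodule.span ℤ (Set.range e)) h2
        (neg_mem h2) q hq
  snd_mem := by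
    have h0 : e 0 ∈ Submodule.span ℤ (Set.range e) := Submodule.subset_span ⟨0, rfl⟩
    have h1 : e 1 ∈ Submodule.span ℤ (Set.range e) := Submodule.subset_span ⟨1, rfl⟩
    have h2 : e 1 - ((n : ℝ) + 1) • e 0 ∈ Submodule.span ℤ (Set.range e) := by
      rw [← Nat.cast_succ, Nat.cast_smul_eq_nsmul]
      exact sub_mem h1 (nsmul_mem h0 _)
    rintro q (hq | hq)
    · exact forall_mem_doubleSector (p := fun q => q.2 ∈ Submodule.span ℤ (Set.range e)) h1
        (neg_mem h1) q hq
    · exact forall_mem_doubleSector (p := fun q => q.2 ∈ Submodule.span ℤ (Set.range e)) h2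
        (neg_mem h2) q hq
  area_eq_one := by
    rintro q (hq | hq)
    · exact forall_mem_doubleSector (p := fun q => area e q.1 q.2 = 1) (by simp [area])
        (by simp [area]) q hq
    · exact forall_mem_doubleSector (p := fun q => area e q.1 q.2 = 1) (by simp [area])
        (by simp [area]) q hq
  edges_not_mem := by
    have hneg : ∀ x : Plane, x ∉ sectors e (doubleSector (e 0) (e 1) ∪
        doubleSector (e 1 - (n : ℝ) • e 0) (e 1 - ((n : ℝ) + 1) • e 0)) →
        -x ∉ sectors e (doubleSector (e 0) (e 1) ∪
        doubleSector (e 1 - (n : ℝ) • e 0) (e 1 - ((n : ℝ) + 1) • e 0)) := by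
      intro x hx
      rw [mem_sectors_union, h.mem_right, h.mem_left] at hx ⊢
      simpa using hx
    have h0 : e 0 ∉ sectors e (doubleSector (e 0) (e 1) ∪
        doubleSector (e 1 - (n : ℝ) • e 0) (e 1 - ((n : ℝ) + 1) • e 0)) := by
      rw [mem_sectors_union, h.mem_right, h.mem_left, h.eta_zero]
      rintro (⟨h1, -⟩ | ⟨h1, -⟩)
      · nlinarith
      · have : a' * (a' * b') * ξ (e 0) ^ 2 ≤ a' * 1 * ξ (e 0) ^ 2 := by
          gcongr
          · exact h.ha'.le
          · exact h.mul_le'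
        nlinarith
    have h1 : e 1 ∉ sectors e (doubleSector (e 0) (e 1) ∪
        doubleSector (e 1 - (n : ℝ) • e 0) (e 1 - ((n : ℝ) + 1) • e 0)) := by
      rw [mem_sectors_union, h.mem_right, h.mem_left, h.eta_one]
      rintro (⟨-, h1⟩ | ⟨-, h1⟩)
      · nlinarith
      · have : a * (a * b) * ξ (e 1) ^ 2 ≤ a * 1 * ξ (e 1) ^ 2 := by
          gcongr
          · exact h.ha.le
          · exact h.mul_le
        nlinarith
    have h2 : e 1 - (n : ℝ) • e 0 ∉ sectors e (doubleSector (e 0) (e 1) ∪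
        doubleSector (e 1 - (n : ℝ) • e 0) (e 1 - ((n : ℝ) + 1) • e 0)) := by
      rw [mem_sectors_union, h.mem_right, h.mem_left, h.xi_fst]
      set z := η (e 1 - (n : ℝ) • e 0)
      rintro (⟨-, h1⟩ | ⟨-, h1⟩)
      · have : b * (a * b) * z ^ 2 ≤ b * 1 * z ^ 2 := by
          gcongr
          · exact h.hb.le
          · exact h.mul_le
        nlinarith
      · nlinarith
    have h3 : e 1 - ((n : ℝ) + 1) • e 0 ∉ sectors e (doubleSector (e 0) (e 1) ∪
        doubleSector (e 1 - (n : ℝ) • e 0) (e 1 - ((n : ℝ) + 1) • e 0)) := by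
      rw [mem_sectors_union, h.mem_right, h.mem_left, h.xi_snd]
      set z := η (e 1 - ((n : ℝ) + 1) • e 0)
      rintro (⟨h1, -⟩ | ⟨h1, -⟩)
      · have : b' * (a' * b') * z ^ 2 ≤ b' * 1 * z ^ 2 := by
          gcongr
          · exact h.hb'.le
          · exact h.mul_le'
        nlinarith
      · nlinarith
    intro t ht
    rw [mem_edges_union, mem_edges_doubleSector, mem_edges_doubleSector] at ht
    rcases ht with (rfl | rfl | rfl | rfl) | (rfl | rfl | rfl | rfl)
    exacts [h0, h1, hneg _ h0, hneg _ h1, h2, h3, hneg _ h2, hneg _ h3]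
  basis_mem := by
    intro i
    rw [mem_edges_union, mem_edges_doubleSector]
    fin_cases i <;> simp
  near_left := by
    refine ⟨min b b', lt_min h.hb h.hb', fun x hx => Or.inl ?_⟩
    rw [mem_sectors_union, h.mem_left]
    exact Or.inr (between_of_abs_lt (min_le_left _ _) (min_le_right _ _) hx)
  near_right := by
    refine ⟨min a a', lt_min h.ha h.ha', fun x hx => Or.inl ?_⟩
    rw [mem_sectors_union, h.mem_right]
    exact Or.inl (between_of_abs_lt (min_le_left _ _) (min_le_right _ _) hx)

theorem mem_hull_iff (h : IsBalanced e ξ η n a a' b b') (x : Plane) :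
    x ∈ PointedCone.hull ℝ {e 0, e 1} ↔ -(a' * ξ x) ≤ η x ∧ η x ≤ a * ξ x := by
  constructor
  · intro hx
    obtain ⟨s, t, hs, ht, rfl⟩ := PointedCone.mem_hull_pair.1 hx
    simp only [map_add, map_smul, smul_eq_mul, h.eta_zero, h.eta_one]
    have h1 := mul_nonneg hs h.pos_zero.le
    have h2 := mul_nonneg ht h.pos_one.le
    constructor <;> nlinarith [mul_nonneg h1 h.ha.le, mul_nonneg h1 h.ha'.le,
      mul_nonneg h2 h.ha.le, mul_nonneg h2 h.ha'.le]
  · rintro ⟨h1, h2⟩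
    have hd := inv_pos.2 h.det_pos
    refine PointedCone.mem_hull_pair.2 ⟨area e x (e 1), area e (e 0) x, ?_, ?_,
      eq_of_area_eq_one area_basis x⟩
    · rw [h.area_eq]
      refine mul_nonneg hd.le ?_
      rw [h.eta_one]
      nlinarith [mul_nonneg h.pos_one.le (sub_nonneg.2 h2)]
    · rw [h.area_eq]
      refine mul_nonneg hd.le ?_
      rw [h.eta_zero]
      nlinarith [mul_nonneg h.pos_zero.le (by linarith : 0 ≤ η x + a' * ξ x)]

end IsBalanced

theorem PointedCone.mem_hull_neg_pair {u w x : Plane} :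
    x ∈ PointedCone.hull ℝ {-u, -w} ↔ -x ∈ PointedCone.hull ℝ {u, w} := by
  simp only [PointedCone.mem_hull_pair]
  constructor
  · rintro ⟨a, b, ha, hb, rfl⟩
    exact ⟨a, b, ha, hb, by simp only [smul_neg]; abel⟩
  · rintro ⟨a, b, ha, hb, h⟩
    refine ⟨a, b, ha, hb, ?_⟩
    rw [← neg_neg x, h, smul_neg, smul_neg]
    abel

/-- `φ` multiplies the slope `η / ξ` by `r₂ / r₁`. A negative factor exchanges the two sides, so
each of `a`, `a'` must dominate `|r₂ / r₁|` times the other. -/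
theorem mul_le_of_mul_abs_le {r₁ r₂ a a' y z : ℝ} (hr : |r₂| ≤ |r₁|) (h1 : |r₂| * a ≤ |r₁| * a')
    (h2 : |r₂| * a' ≤ |r₁| * a) (ha : 0 < a) (ha' : 0 < a') (hr₁ : 0 ≤ r₁)
    (hz : -(a' * y) ≤ z) (hz' : z ≤ a * y) :
    -(a' * (r₁ * y)) ≤ r₂ * z ∧ r₂ * z ≤ a * (r₁ * y) := by
  have hy : 0 ≤ y := nonneg_of_mul_nonneg_right (by linarith : 0 ≤ (a + a') * y) (by positivity)
  rw [abs_of_nonneg hr₁] at hr h1 h2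
  rcases le_total 0 r₂ with h | h
  · rw [abs_of_nonneg h] at hr h1 h2
    constructor
    · nlinarith [mul_le_mul_of_nonneg_left hz h,
        mul_le_mul_of_nonneg_right hr (mul_nonneg ha'.le hy)]
    · nlinarith [mul_le_mul_of_nonneg_left hz' h,
        mul_le_mul_of_nonneg_right hr (mul_nonneg ha.le hy)]
  · rw [abs_of_nonpos h] at hr h1 h2
    constructor
    · nlinarith [mul_le_mul_of_nonneg_left hz' (neg_nonneg.2 h), mul_le_mul_of_nonneg_right h1 hy]
    · nlinarith [mul_le_mul_of_nonneg_left hz (neg_nonneg.2 h), mul_le_mul_of_nonneg_right h2 hy]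

/-- Around the repelling line the slope `ξ / η` is multiplied by `r₁ / r₂`, so a point whose image
lies in the sectors was already there. -/
theorem between_of_mul_between {r₁ r₂ b b' y z : ℝ} (hr : |r₂| < |r₁|)
    (h1 : |r₂| * b ≤ |r₁| * b') (h2 : |r₂| * b' ≤ |r₁| * b) (hb : 0 < b) (hb' : 0 < b')
    (hz : -(b' * (r₂ * y) ^ 2) < r₂ * y * (r₁ * z)) (hz' : r₂ * y * (r₁ * z) < b * (r₂ * y) ^ 2) :
    -(b' * y ^ 2) < y * z ∧ y * z < b * y ^ 2 := by
  have hr1 : 0 < |r₁| := (abs_nonneg _).trans_lt hr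
  have hr2 : 0 < |r₂| := by
    rw [abs_pos]
    rintro rfl
    simp at hz hz'
  have hy : y ≠ 0 := by
    rintro rfl
    simp at hz hz'
  have hy2 : 0 < y ^ 2 := by positivity
  have e1 : |r₂| ^ 2 = r₂ ^ 2 := sq_abs _
  have e2 : |r₁ * r₂| = |r₁| * |r₂| := abs_mul _ _
  have hsq : ∀ c, c * (r₂ * y) ^ 2 = |r₂| * (|r₂| * c * y ^ 2) := fun c => by
    rw [mul_pow, ← e1]; ring
  have hprod : r₂ * y * (r₁ * z) = (r₁ * r₂) * (y * z) := by ring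
  rw [hprod, hsq] at hz hz'
  have k1 : |r₂| * b * y ^ 2 ≤ |r₁| * b * y ^ 2 := by gcongr
  have k2 : |r₂| * b' * y ^ 2 ≤ |r₁| * b' * y ^ 2 := by gcongr
  have k3 : |r₂| * b * y ^ 2 ≤ |r₁| * b' * y ^ 2 := by gcongr ?_ * _
  have k4 : |r₂| * b' * y ^ 2 ≤ |r₁| * b * y ^ 2 := by gcongr ?_ * _
  have hp : 0 < |r₁| * |r₂| := by positivity
  rcases abs_choice (r₁ * r₂) with h | h
  · rw [e2] at h
    rw [← h] at hz hz'
    constructor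
    · refine lt_of_mul_lt_mul_left (lt_of_le_of_lt ?_ hz) hp.le
      nlinarith [mul_le_mul_of_nonneg_left k2 hr2.le]
    · refine lt_of_mul_lt_mul_left (lt_of_lt_of_le hz' ?_) hp.le
      nlinarith [mul_le_mul_of_nonneg_left k1 hr2.le]
  · rw [e2] at h
    rw [eq_neg_iff_add_eq_zero, add_comm, ← eq_neg_iff_add_eq_zero] at h
    rw [h] at hz hz'
    constructor
    · refine lt_of_mul_lt_mul_left (?_ : |r₁| * |r₂| * -(b' * y ^ 2) < _) hp.le
      nlinarith [mul_le_mul_of_nonneg_left k3 hr2.le]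
    · refine lt_of_mul_lt_mul_left (?_ : |r₁| * |r₂| * (y * z) < _) hp.le
      nlinarith [mul_le_mul_of_nonneg_left k4 hr2.le]

end
end

/-! ### Eigenlines without lattice vectors -/

noncomputable section

theorem Fan.exists_finite_generators {N : Submodule ℤ Plane} (Δ : Fan N) :
    ∃ G : Set Plane, G.Finite ∧ G ⊆ N ∧ ∀ σ ∈ Δ.cones, ∃ s : Finset Plane, (s : Set Plane) ⊆ G ∧
      σ = PointedCone.hull ℝ (s : Set Plane) := by
  choose! s hsN hsσ using Δ.rational
  refine ⟨⋃ σ ∈ Δ.cones, (s σ : Set Plane), Δ.finite.biUnion fun σ _ => (s σ).finite_toSet,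
    Set.iUnion₂_subset hsN, fun σ hσ => ⟨s σ, ?_, hsσ σ hσ⟩⟩
  exact Set.subset_biUnion_of_mem (u := fun σ => (s σ : Set Plane)) hσ

section

variable {N : Submodule ℤ Plane} {ξ η : Plane →ₗ[ℝ] ℝ} {f : Module.Basis (Fin 2) ℝ Plane}

theorem isBalanced_of_eq {e : Module.Basis (Fin 2) ℝ Plane} {n : ℕ} {a a' b b' m : ℝ} (ha : 0 < a)
    (ha' : 0 < a') (h0 : 0 < ξ (e 0)) (h1 : ξ (e 1) = m * ξ (e 0))
    (hη0 : η (e 0) = -(a' * ξ (e 0))) (hη1 : η (e 1) = a * ξ (e 1)) (hnm : (n : ℝ) < m)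
    (hmn : m < n + 1) (hb : b * (a * m + n * a') = m - n)
    (hb' : b' * (a * m + (n + 1) * a') = n + 1 - m) : IsBalanced e ξ η n a a' b b' := by
  have hn : (0 : ℝ) ≤ n := n.cast_nonneg
  have hm0 : 0 < m := hn.trans_lt hnm
  have hS : 0 < a * m + n * a' := by positivity
  have hS' : 0 < a * m + (n + 1) * a' := by positivity
  have hb0 : 0 < b := pos_of_mul_pos_left (by rw [hb]; linarith) hS.le
  have hb'0 : 0 < b' := pos_of_mul_pos_left (by rw [hb']; linarith) hS'.le
  have hd1 : ξ (e 1 - (n : ℝ) • e 0) = (m - n) * ξ (e 0) := by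
    rw [map_sub, map_smul, smul_eq_mul, h1]; ring
  have hd2 : ξ (e 1 - ((n : ℝ) + 1) • e 0) = (m - (n + 1)) * ξ (e 0) := by
    rw [map_sub, map_smul, smul_eq_mul, h1]; ring
  have hd1' : η (e 1 - (n : ℝ) • e 0) = (a * m + n * a') * ξ (e 0) := by
    rw [map_sub, map_smul, smul_eq_mul, hη0, hη1, h1]; ring
  have hd2' : η (e 1 - ((n : ℝ) + 1) • e 0) = (a * m + (n + 1) * a') * ξ (e 0) := by
    rw [map_sub, map_smul, smul_eq_mul, hη0, hη1, h1]; ring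
  refine ⟨ha, ha', hb0, hb'0, h0, ?_, hη0, hη1, ?_, ?_, ?_, ?_, ?_, ?_⟩
  · rw [h1]; positivity
  · rw [hd1']; positivity
  · rw [hd2']; positivity
  · rw [hd1, hd1', ← mul_assoc, hb]
  · rw [hd2, hd2', ← mul_assoc, hb']; ring
  · refine le_of_mul_le_mul_right ?_ hS
    rw [mul_assoc, hb]
    nlinarith [mul_nonneg hn ha.le, mul_nonneg hn ha'.le]
  · refine le_of_mul_le_mul_right ?_ hS'
    rw [mul_assoc, hb']
    nlinarith [mul_pos hm0 ha, mul_pos hm0 ha']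

/-- The edges of the attracting sector may be rescaled independently within `N`; this changes the
ratio `ξ (e 1) / ξ (e 0)` by any positive rational and so controls the slopes of the repelling
sector. -/
theorem exists_isBalanced (hf : Submodule.span ℤ (Set.range f) = N)
    (hdet : ξ (f 0) * η (f 1) - η (f 0) * ξ (f 1) ≠ 0) {θ δ t : ℝ} (hθ0 : 0 ≤ θ) (hθ : θ < 1)
    (hδ : 0 < δ) (ht : 0 < t) :
    ∃ (e : Module.Basis (Fin 2) ℝ Plane) (n : ℕ) (a a' b b' : ℝ), (∀ i, e i ∈ N) ∧
      IsBalanced e ξ η n a a' b b' ∧ a ≤ δ ∧ a' ≤ δ ∧ b ≤ t ∧ b' ≤ t ∧ θ * a ≤ a' ∧ θ * a' ≤ a ∧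
      θ * b ≤ b' ∧ θ * b' ≤ b := by
  have hθδ : θ * δ < δ := by nlinarith
  have hθδ0 : 0 ≤ θ * δ := mul_nonneg hθ0 hδ.le
  -- With both slopes between `θ δ` and `δ`, each dominates `θ` times the other.
  obtain ⟨c₁, hc₁N, h₁0, h₁l, h₁u⟩ := exists_lattice_mem_cone hf hdet (neg_lt_neg hθδ)
  obtain ⟨c₂, hc₂N, h₂0, h₂l, h₂u⟩ := exists_lattice_mem_cone hf hdet hθδ
  obtain ⟨a', ha'⟩ : ∃ a', η c₁ = -(a' * ξ c₁) := ⟨-(η c₁ / ξ c₁), by field_simp⟩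
  obtain ⟨a, ha⟩ : ∃ a, η c₂ = a * ξ c₂ := ⟨η c₂ / ξ c₂, by field_simp⟩
  rw [ha'] at h₁l h₁u
  rw [ha] at h₂l h₂u
  replace h₁l : a' < δ := lt_of_mul_lt_mul_right (by linarith) h₁0.le
  replace h₁u : θ * δ < a' := lt_of_mul_lt_mul_right (by linarith) h₁0.le
  replace h₂l : θ * δ < a := lt_of_mul_lt_mul_right h₂l h₂0.le
  replace h₂u : a < δ := lt_of_mul_lt_mul_right h₂u h₂0.le
  have ha0 : 0 < a := hθδ0.trans_lt h₂l
  have ha'0 : 0 < a' := hθδ0.trans_lt h₁u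
  obtain ⟨n, l, u, hl, hlu, h⟩ := exists_balanced_slopes hθ0 hθ ha0 ha'0 ht
  obtain ⟨r, hlr, hru⟩ := exists_rat_btwn
    (div_lt_div_of_pos_right (mul_lt_mul_of_pos_right hlu h₁0) h₂0)
  rw [div_lt_iff₀ h₂0] at hlr
  rw [lt_div_iff₀ h₂0] at hru
  have hr0 : (0 : ℝ) < r := pos_of_mul_pos_left ((mul_pos hl h₁0).trans hlr) h₂0.le
  set m := r * ξ c₂ / ξ c₁ with hm
  obtain ⟨hnm, hmn, b, b', hb, hb', hbt, hbt', hθb, hθb'⟩ := h m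
    (by rwa [hm, lt_div_iff₀ h₁0]) (by rwa [hm, div_lt_iff₀ h₁0])
  have hn : (0 : ℝ) ≤ n := n.cast_nonneg
  have hm0 : 0 < m := hn.trans_lt hnm
  have hnum : (0 : ℝ) < r.num := by exact_mod_cast Rat.num_pos.2 (by exact_mod_cast hr0)
  have hden : (0 : ℝ) < (r.den : ℤ) := by exact_mod_cast r.den_pos
  have hrq : (r.num : ℝ) = r * (r.den : ℤ) := by exact_mod_cast (Rat.mul_den_eq_num r).symm
  -- The basis is `e 0 = r.den • c₁`, `e 1 = r.num • c₂`, which has ratio `m`.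
  set p : ℝ := ((r.den : ℤ) : ℝ) with hp
  have hξ1 : ξ ((r.num : ℝ) • c₂) = m * (p * ξ c₁) := by
    rw [map_smul, smul_eq_mul, hrq, hm]
    field_simp
  have hξ0 : ξ (p • c₁) = p * ξ c₁ := by rw [map_smul, smul_eq_mul]
  have hη0 : η (p • c₁) = -(a' * ξ (p • c₁)) := by
    rw [hξ0, map_smul, smul_eq_mul, ha']; ring
  have hη1 : η ((r.num : ℝ) • c₂) = a * ξ ((r.num : ℝ) • c₂) := by
    rw [map_smul, map_smul, smul_eq_mul, smul_eq_mul, ha]; ring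
  have hX : 0 < p * ξ c₁ := mul_pos hden h₁0
  have hne : ξ (p • c₁) * η ((r.num : ℝ) • c₂) - η (p • c₁) * ξ ((r.num : ℝ) • c₂) ≠ 0 := by
    rw [hη0, hη1, hξ0, hξ1]
    have h1 : 0 < (a + a') * (m * ((p * ξ c₁) * (p * ξ c₁))) := by positivity
    nlinarith
  obtain ⟨e, he0, he1⟩ := exists_basis_of_ne_zero hne
  rw [← he0] at hξ0 hη0
  rw [← he1] at hξ1 hη1
  rw [← hξ0] at hξ1 hX
  refine ⟨e, n, a, a', b, b', fun i => ?_, isBalanced_of_eq ha0 ha'0 hX hξ1 hη0 hη1 hnm hmn hb hb',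
    h₂u.le, h₁l.le, hbt, hbt', ?_, ?_, hθb, hθb'⟩
  · fin_cases i
    · change e 0 ∈ N
      rw [he0, hp, Int.cast_smul_eq_zsmul]
      exact N.smul_mem _ hc₁N
    · change e 1 ∈ N
      rw [he1, Int.cast_smul_eq_zsmul]
      exact N.smul_mem _ hc₂N
  · exact (mul_le_mul_of_nonneg_left h₂u.le hθ0).trans h₁u.le
  · exact (mul_le_mul_of_nonneg_left h₁l.le hθ0).trans h₂l.le

/-- No generator of `Δ` lies on an eigenline, so sectors thinner than the bounds `δ` and `t` avoid
all of them. Balance is needed with `θ = |r₂| / |r₁|`. -/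
theorem exists_stable_refinement_of_forall_ne_zero (hf : Submodule.span ℤ (Set.range f) = N)
    (hdet : ξ (f 0) * η (f 1) - η (f 0) * ξ (f 1) ≠ 0) {φ : N →ₗ[ℤ] N} {Δ : Fan N}
    (hΔ : Δ.IsComplete) {r₁ r₂ : ℝ} (hr : |r₂| < |r₁|) (hξ : ∀ n : N, ξ (φ n) = r₁ * ξ n)
    (hη : ∀ n : N, η (φ n) = r₂ * η n) (h0 : ∀ n ∈ N, n ≠ 0 → ξ n ≠ 0 ∧ η n ≠ 0) :
    ∃ Δ' : Fan N, Δ'.Refines Δ ∧ Toric.IsAlgebraicallyStable Δ' φ ∧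
      ∃ N' : Submodule ℤ Plane, N' ≤ N ∧
        N'.toAddSubgroup.relIndex N.toAddSubgroup ≠ 0 ∧ Δ'.IsRegular N' := by
  obtain ⟨G, hG, hGN, hGΔ⟩ := Δ.exists_finite_generators
  obtain ⟨δ, hδ, hδG⟩ := exists_pos_mul_le hG ξ η
  obtain ⟨t, ht, htG⟩ := exists_pos_mul_le hG η ξ
  have hr1 : 0 < |r₁| := (abs_nonneg _).trans_lt hr
  obtain ⟨e, n, a, a', b, b', heN, h, haδ, ha'δ, hbt, hb't, haa', ha'a, hbb', hb'b⟩ :=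
    exists_isBalanced hf hdet (div_nonneg (abs_nonneg r₂) hr1.le) ((div_lt_one hr1).2 hr) hδ ht
  have hθ : ∀ c c' : ℝ, |r₂| / |r₁| * c ≤ c' → |r₂| * c ≤ |r₁| * c' := fun c c' h => by
    rwa [div_mul_eq_mul_div, div_le_iff₀ hr1, mul_comm c'] at h
  obtain ⟨k, hk0, hk⟩ := exists_nat_smul_mem_span hf heN
  refine exists_stable_refinement heN hk0 hk hΔ h.isSectorSystem hr hξ hη ?_ ?_ ?_
  · intro σ hσ
    obtain ⟨s, hs, hsσ⟩ := hGΔ σ hσ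
    refine ⟨s, hs.trans hGN, hsσ, fun g hg hg0 => ?_⟩
    obtain ⟨hξg, hηg⟩ := h0 g (hGN (hs hg)) hg0
    refine ⟨?_, fun h => absurd h hξg⟩
    rw [mem_sectors_union, h.mem_right, h.mem_left, not_or]
    exact ⟨not_between_of_mul_abs_le haδ ha'δ (hδG g (hs hg) hηg),
      not_between_of_mul_abs_le hbt hb't (htG g (hs hg) hξg)⟩
  · have hpos : 0 ≤ r₁ → ∀ n : N, (n : Plane) ∈ PointedCone.hull ℝ {e 0, e 1} →
        (φ n : Plane) ∈ PointedCone.hull ℝ {e 0, e 1} := by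
      intro hr₁ n hn
      rw [h.mem_hull_iff] at hn ⊢
      rw [hξ, hη]
      exact mul_le_of_mul_abs_le hr.le (hθ _ _ haa') (hθ _ _ ha'a) h.ha h.ha' hr₁ hn.1 hn.2
    have hneg : r₁ ≤ 0 → ∀ n : N, (n : Plane) ∈ PointedCone.hull ℝ {e 0, e 1} →
        -(φ n : Plane) ∈ PointedCone.hull ℝ {e 0, e 1} := by
      intro hr₁ n hn
      rw [h.mem_hull_iff] at hn ⊢
      rw [map_neg, map_neg, hξ, hη, ← neg_mul r₁, ← neg_mul r₂]
      refine mul_le_of_mul_abs_le ?_ ?_ ?_ h.ha h.ha' (neg_nonneg.2 hr₁) hn.1 hn.2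
      · rw [abs_neg, abs_neg]; exact hr.le
      · rw [abs_neg, abs_neg]; exact hθ _ _ haa'
      · rw [abs_neg, abs_neg]; exact hθ _ _ ha'a
    rcases le_total 0 r₁ with hr₁ | hr₁
    · refine forall_mem_doubleSector ⟨_, Or.inl rfl, hpos hr₁⟩ ⟨_, Or.inr rfl, fun n hn => ?_⟩
      rw [PointedCone.mem_hull_neg_pair] at hn ⊢
      simpa using hpos hr₁ (-n) (by simpa using hn)
    · refine forall_mem_doubleSector ⟨_, Or.inr rfl, fun n hn => ?_⟩ ⟨_, Or.inl rfl, fun n hn => ?_⟩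
      · rw [PointedCone.mem_hull_neg_pair]
        exact hneg hr₁ n hn
      · rw [PointedCone.mem_hull_neg_pair] at hn
        simpa using hneg hr₁ (-n) (by simpa using hn)
  · intro n hn
    rw [h.mem_left] at hn ⊢
    rw [hξ, hη] at hn
    exact between_of_mul_between hr (hθ _ _ hbb') (hθ _ _ hb'b) h.hb h.hb' hn.1 hn.2

end
end

/-! ### Eigenlines spanned by lattice vectors -/

noncomputable section

section

variable {N : Submodule ℤ Plane} {e : Module.Basis (Fin 2) ℝ Plane}

theorem mem_hull_pair_iff_area {c c' : Plane} (h : area e c c' = 1) (x : Plane) :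
    x ∈ PointedCone.hull ℝ {c, c'} ↔ 0 ≤ area e c x ∧ 0 ≤ area e x c' := by
  rw [PointedCone.mem_hull_pair]
  constructor
  · rintro ⟨a, b, ha, hb, rfl⟩
    simp only [area_add_left, area_add_right, area_smul_left, area_smul_right, area_self, h]
    constructor <;> simpa
  · rintro ⟨h1, h2⟩
    exact ⟨_, _, h2, h1, eq_of_area_eq_one h x⟩

/-- The four unimodular sectors which form the region `0 < |x 1| < |x 0|`. -/
def rightSectors (e : Module.Basis (Fin 2) ℝ Plane) : Set (Plane × Plane) :=
  doubleSector (e 0) (e 0 + e 1) ∪ doubleSector (e 0 - e 1) (e 0)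

/-- The four unimodular sectors which form the region `0 < n * |x 0| < |x 1|`. -/
def leftSectors (e : Module.Basis (Fin 2) ℝ Plane) (n : ℕ) : Set (Plane × Plane) :=
  doubleSector (e 0 + (n : ℝ) • e 1) (e 1) ∪ doubleSector (e 1) ((n : ℝ) • e 1 - e 0)

theorem mem_sectors_rightSectors (x : Plane) : x ∈ sectors e (rightSectors e) ↔
    e.coord 1 x ≠ 0 ∧ |e.coord 1 x| < |e.coord 0 x| := by
  rw [rightSectors, mem_sectors_union, mem_sectors_doubleSector, mem_sectors_doubleSector]
  simp only [area, map_add, map_sub, Finsupp.add_apply, Finsupp.sub_apply, Module.Basis.repr_self,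
    Module.Basis.coord_apply, Finsupp.single_apply]
  simp only [Fin.isValue, ↓reduceIte, one_ne_zero, zero_ne_one, one_mul, zero_mul, mul_one,
    mul_zero, sub_zero, zero_sub, add_zero, zero_add]
  generalize e.repr x 0 = p
  generalize e.repr x 1 = q
  rcases abs_cases p with ⟨h1, h2⟩ | ⟨h1, h2⟩ <;> rcases abs_cases q with ⟨h3, h4⟩ | ⟨h3, h4⟩ <;>
    rw [h1, h3] <;> constructor <;> grind

theorem mem_sectors_leftSectors (n : ℕ) (x : Plane) : x ∈ sectors e (leftSectors e n) ↔
    e.coord 0 x ≠ 0 ∧ n * |e.coord 0 x| < |e.coord 1 x| := by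
  rw [leftSectors, mem_sectors_union, mem_sectors_doubleSector, mem_sectors_doubleSector]
  simp only [area, map_add, map_sub, map_smul, Finsupp.add_apply, Finsupp.sub_apply,
    Finsupp.smul_apply, Module.Basis.repr_self, Module.Basis.coord_apply, Finsupp.single_apply,
    smul_eq_mul]
  simp only [Fin.isValue, ↓reduceIte, one_ne_zero, zero_ne_one, one_mul, zero_mul, mul_one,
    mul_zero, sub_zero, zero_sub, add_zero, zero_add]
  generalize e.repr x 0 = p
  generalize e.repr x 1 = q
  have hn : (0 : ℝ) ≤ n := n.cast_nonneg
  rcases abs_cases p with ⟨h1, h2⟩ | ⟨h1, h2⟩ <;> rcases abs_cases q with ⟨h3, h4⟩ | ⟨h3, h4⟩ <;>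
    rw [h1, h3] <;> have h5 := mul_nonneg hn (abs_nonneg p) <;> rw [h1] at h5 <;>
      constructor <;> grind

theorem isSectorSystem_right_union_left {n : ℕ} (hn : 1 ≤ n) :
    IsSectorSystem e (e.coord 0) (e.coord 1) 1 (rightSectors e ∪ leftSectors e n) where
  pos := one_pos
  area_eq := fun x y => by simp [area]
  finite := by simp [rightSectors, leftSectors, doubleSector]
  neg_mem := by
    rintro q ((hq | hq) | (hq | hq))
    exacts [Or.inl (Or.inl (neg_mem_doubleSector hq)), Or.inl (Or.inr (neg_mem_doubleSector hq)),
      Or.inr (Or.inl (neg_mem_doubleSector hq)), Or.inr (Or.inr (neg_mem_doubleSector hq))]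
  fst_mem := by
    have h0 : e 0 ∈ Submodule.span ℤ (Set.range e) := Submodule.subset_span ⟨0, rfl⟩
    have h1 : e 1 ∈ Submodule.span ℤ (Set.range e) := Submodule.subset_span ⟨1, rfl⟩
    have h2 : e 0 + (n : ℝ) • e 1 ∈ Submodule.span ℤ (Set.range e) := by
      rw [Nat.cast_smul_eq_nsmul]
      exact add_mem h0 (nsmul_mem h1 n)
    have key : ∀ c c' : Plane, c ∈ Submodule.span ℤ (Set.range e) → ∀ q ∈ doubleSector c c',
        q.1 ∈ Submodule.span ℤ (Set.range e) := fun c c' h =>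
      forall_mem_doubleSector h (neg_mem h)
    rintro q ((hq | hq) | (hq | hq))
    exacts [key _ _ h0 q hq, key _ _ (sub_mem h0 h1) q hq, key _ _ h2 q hq, key _ _ h1 q hq]
  snd_mem := by
    have h0 : e 0 ∈ Submodule.span ℤ (Set.range e) := Submodule.subset_span ⟨0, rfl⟩
    have h1 : e 1 ∈ Submodule.span ℤ (Set.range e) := Submodule.subset_span ⟨1, rfl⟩
    have h2 : (n : ℝ) • e 1 - e 0 ∈ Submodule.span ℤ (Set.range e) := by
      rw [Nat.cast_smul_eq_nsmul]
      exact sub_mem (nsmul_mem h1 n) h0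
    have key : ∀ c c' : Plane, c' ∈ Submodule.span ℤ (Set.range e) → ∀ q ∈ doubleSector c c',
        q.2 ∈ Submodule.span ℤ (Set.range e) := fun c c' h =>
      forall_mem_doubleSector h (neg_mem h)
    rintro q ((hq | hq) | (hq | hq))
    exacts [key _ _ (add_mem h0 h1) q hq, key _ _ h0 q hq, key _ _ h1 q hq, key _ _ h2 q hq]
  area_eq_one := by
    have key : ∀ c c' : Plane, area e c c' = 1 → ∀ q ∈ doubleSector c c', area e q.1 q.2 = 1 :=
      fun c c' h => forall_mem_doubleSector h (by rw [area_neg_left, area_neg_right, neg_neg, h])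
    rintro q ((hq | hq) | (hq | hq))
    exacts [key _ _ (by simp [area]) q hq, key _ _ (by simp [area]) q hq,
      key _ _ (by simp [area]) q hq, key _ _ (by simp [area]) q hq]
  edges_not_mem := by
    have hn' : (1 : ℝ) ≤ n := by exact_mod_cast hn
    have key : ∀ x, |e.coord 0 x| ≤ |e.coord 1 x| ∨ e.coord 1 x = 0 →
        |e.coord 1 x| ≤ n * |e.coord 0 x| ∨ e.coord 0 x = 0 →
        x ∉ sectors e (rightSectors e ∪ leftSectors e n) := by
      intro x h1 h2
      rw [mem_sectors_union, mem_sectors_rightSectors, mem_sectors_leftSectors]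
      rintro (⟨h3, h4⟩ | ⟨h3, h4⟩)
      · exact h1.elim h4.not_ge h3
      · exact h2.elim h4.not_ge h3
    intro t ht
    simp only [rightSectors, leftSectors, mem_edges_union, mem_edges_doubleSector] at ht
    apply key
    all_goals
      rcases ht with ((rfl | rfl | rfl | rfl) | (rfl | rfl | rfl | rfl)) |
        ((rfl | rfl | rfl | rfl) | (rfl | rfl | rfl | rfl)) <;> simp [hn']
  basis_mem := by
    intro i
    rw [mem_edges_union, rightSectors, leftSectors, mem_edges_union, mem_edges_union]
    simp only [mem_edges_doubleSector]
    fin_cases i <;> simp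
  near_left := by
    have hn' : (0 : ℝ) < n := by exact_mod_cast hn
    refine ⟨(n : ℝ)⁻¹, inv_pos.2 hn', fun x hx => ?_⟩
    by_cases h : e.coord 0 x = 0
    · refine Or.inr ⟨e 1, ?_, ?_⟩
      · simp [mem_edges_union, leftSectors, mem_edges_doubleSector]
      · rw [area_basis_one_left, neg_eq_zero]
        exact h
    · rw [mem_sectors_union, mem_sectors_leftSectors]
      exact Or.inl (Or.inr ⟨h, (lt_inv_mul_iff₀ hn').1 hx⟩)
  near_right := by
    refine ⟨1, one_pos, fun x hx => ?_⟩
    by_cases h : e.coord 1 x = 0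
    · refine Or.inr ⟨e 0, ?_, ?_⟩
      · simp [mem_edges_union, rightSectors, mem_edges_doubleSector]
      · rw [area_basis_zero_left]
        exact h
    · rw [mem_sectors_union, mem_sectors_rightSectors]
      exact Or.inl (Or.inl ⟨h, by rwa [one_mul] at hx⟩)

/-- The four closed attracting sectors are indexed by the signs `s`, `t` of the two coordinates, and
`φ` multiplies these by the signs of `r₁`, `r₂`. -/
theorem mem_hull_of_mem_rightSectors {q : Plane × Plane} (hq : q ∈ rightSectors e) :
    ∃ s t : ℝ, |s| = 1 ∧ |t| = 1 ∧ ∀ x, x ∈ PointedCone.hull ℝ {q.1, q.2} ↔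
      0 ≤ t * e.coord 1 x ∧ t * e.coord 1 x ≤ s * e.coord 0 x := by
  have h1 : area e (e 0) (e 0 + e 1) = 1 := by simp [area]
  have h2 : area e (e 0 - e 1) (e 0) = 1 := by simp [area]
  rcases hq with hq | hq
  · revert q hq
    refine @forall_mem_doubleSector _ _ (fun q => ∃ s t : ℝ, |s| = 1 ∧ |t| = 1 ∧
      ∀ x, x ∈ PointedCone.hull ℝ {q.1, q.2} ↔
        0 ≤ t * e.coord 1 x ∧ t * e.coord 1 x ≤ s * e.coord 0 x) ⟨1, 1, by simp, by simp, fun x => ?_⟩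
      ⟨-1, -1, by simp, by simp, fun x => ?_⟩
    · rw [mem_hull_pair_iff_area h1]
      simp [area]
    · rw [PointedCone.mem_hull_neg_pair, mem_hull_pair_iff_area h1]
      simp [area]
  · revert q hq
    refine @forall_mem_doubleSector _ _ (fun q => ∃ s t : ℝ, |s| = 1 ∧ |t| = 1 ∧
      ∀ x, x ∈ PointedCone.hull ℝ {q.1, q.2} ↔
        0 ≤ t * e.coord 1 x ∧ t * e.coord 1 x ≤ s * e.coord 0 x) ⟨1, -1, by simp, by simp, fun x => ?_⟩
      ⟨-1, 1, by simp, by simp, fun x => ?_⟩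
    · rw [mem_hull_pair_iff_area h2]
      simp [area]
      constructor <;> rintro ⟨h3, h4⟩ <;> constructor <;> linarith
    · rw [PointedCone.mem_hull_neg_pair, mem_hull_pair_iff_area h2]
      simp [area]
      constructor <;> rintro ⟨h3, h4⟩ <;> constructor <;> linarith

theorem exists_mem_rightSectors {s t : ℝ} (hs : |s| = 1) (ht : |t| = 1) :
    ∃ q ∈ rightSectors e, ∀ x, 0 ≤ t * e.coord 1 x → t * e.coord 1 x ≤ s * e.coord 0 x →
      x ∈ PointedCone.hull ℝ {q.1, q.2} := by
  have h1 : area e (e 0) (e 0 + e 1) = 1 := by simp [area]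
  have h2 : area e (e 0 - e 1) (e 0) = 1 := by simp [area]
  rcases eq_or_eq_neg_of_abs_eq hs with rfl | rfl <;> rcases eq_or_eq_neg_of_abs_eq ht with rfl | rfl
  · refine ⟨_, Or.inl (Or.inl rfl), fun x => ?_⟩
    rw [mem_hull_pair_iff_area h1]
    simp [area]
    grind
  · refine ⟨_, Or.inr (Or.inl rfl), fun x => ?_⟩
    rw [mem_hull_pair_iff_area h2]
    simp [area]
    grind
  · refine ⟨_, Or.inr (Or.inr rfl), fun x => ?_⟩
    rw [PointedCone.mem_hull_neg_pair, mem_hull_pair_iff_area h2]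
    simp [area]
    grind
  · refine ⟨_, Or.inl (Or.inr rfl), fun x => ?_⟩
    rw [PointedCone.mem_hull_neg_pair, mem_hull_pair_iff_area h1]
    simp [area]
    grind

/-- A sign that is `±1` even for `r = 0`, as `r₂` may vanish. -/
theorem exists_abs_eq_one_mul_eq_abs (r : ℝ) : ∃ ε : ℝ, |ε| = 1 ∧ ε * r = |r| := by
  rcases abs_choice r with h | h
  · exact ⟨1, by simp, by rw [h, one_mul]⟩
  · exact ⟨-1, by simp, by rw [h, neg_one_mul]⟩

theorem exists_stable_refinement_of_basis (he : ∀ i, e i ∈ N) {k : ℕ} (hk0 : 0 < k)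
    (hk : ∀ n ∈ N, (k : ℝ) • n ∈ Submodule.span ℤ (Set.range e)) {φ : N →ₗ[ℤ] N} {Δ : Fan N}
    (hΔ : Δ.IsComplete) {r₁ r₂ : ℝ} (hr : |r₂| < |r₁|)
    (h₁ : ∀ n : N, e.coord 0 (φ n) = r₁ * e.coord 0 n)
    (h₂ : ∀ n : N, e.coord 1 (φ n) = r₂ * e.coord 1 n) {G : Set Plane} (hG : G.Finite)
    (hGN : G ⊆ N) (hGΔ : ∀ σ ∈ Δ.cones, ∃ s : Finset Plane, (s : Set Plane) ⊆ G ∧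
      σ = PointedCone.hull ℝ (s : Set Plane))
    (hG' : ∀ g ∈ G, e.coord 1 g ≠ 0 → |e.coord 0 g| ≤ |e.coord 1 g|) :
    ∃ Δ' : Fan N, Δ'.Refines Δ ∧ Toric.IsAlgebraicallyStable Δ' φ ∧
      ∃ N' : Submodule ℤ Plane, N' ≤ N ∧
        N'.toAddSubgroup.relIndex N.toAddSubgroup ≠ 0 ∧ Δ'.IsRegular N' := by
  obtain ⟨δ, hδ, hδG⟩ := exists_pos_mul_le hG (e.coord 1) (e.coord 0)
  -- `n > δ⁻¹` narrows the repelling sectors past the generators of `Δ`; `n ≥ 1` keeps them disjoint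
  -- from the attracting ones.
  obtain ⟨n, hn⟩ := exists_nat_gt (max 1 δ⁻¹)
  have hn1 : 1 ≤ n := by exact_mod_cast ((le_max_left _ _).trans_lt hn).le
  have hnδ : δ⁻¹ ≤ n := ((le_max_right _ _).trans_lt hn).le
  refine exists_stable_refinement he hk0 hk hΔ (isSectorSystem_right_union_left hn1) hr h₁ h₂
    ?_ ?_ ?_
  · intro σ hσ
    obtain ⟨s, hs, hsσ⟩ := hGΔ σ hσ
    refine ⟨s, hs.trans hGN, hsσ, fun g hg _ => ⟨?_, fun h => ⟨e 1, ?_, ?_⟩⟩⟩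
    · rw [mem_sectors_union, mem_sectors_rightSectors, mem_sectors_leftSectors]
      rintro (⟨h3, h4⟩ | ⟨h3, h4⟩)
      · exact h4.not_ge (hG' g (hs hg) h3)
      · refine h4.not_ge (le_trans ?_ (mul_le_mul_of_nonneg_right hnδ (abs_nonneg _)))
        rw [le_inv_mul_iff₀ hδ]
        exact hδG g (hs hg) h3
    · simp [mem_edges_union, leftSectors, mem_edges_doubleSector]
    · rw [area_basis_one_left, neg_eq_zero]
      exact h
  · intro q hq
    obtain ⟨s, t, hs, ht, hst⟩ := mem_hull_of_mem_rightSectors hq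
    obtain ⟨ε₁, hε₁, hr₁⟩ := exists_abs_eq_one_mul_eq_abs r₁
    obtain ⟨ε₂, hε₂, hr₂⟩ := exists_abs_eq_one_mul_eq_abs r₂
    obtain ⟨q', hq', hq''⟩ := exists_mem_rightSectors (e := e) (s := s * ε₁) (t := t * ε₂)
      (by rw [abs_mul, hs, hε₁, one_mul]) (by rw [abs_mul, ht, hε₂, one_mul])
    refine ⟨q', hq', fun m hm => ?_⟩
    obtain ⟨hm1, hm2⟩ := (hst m).1 hm
    have e1 : s * ε₁ * e.coord 0 (φ m) = |r₁| * (s * e.coord 0 m) := by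
      rw [h₁, ← hr₁]; ring
    have e2 : t * ε₂ * e.coord 1 (φ m) = |r₂| * (t * e.coord 1 m) := by
      rw [h₂, ← hr₂]; ring
    refine hq'' _ ?_ ?_
    · rw [e2]
      positivity
    · rw [e1, e2]
      gcongr
  · intro m hm
    rw [mem_sectors_leftSectors, h₁, h₂, abs_mul, abs_mul] at hm
    rw [mem_sectors_leftSectors]
    have hr1 : 0 < |r₁| := (abs_nonneg _).trans_lt hr
    refine ⟨right_ne_zero_of_mul hm.1, lt_of_mul_lt_mul_left (a := |r₁|) ?_ hr1.le⟩
    calc |r₁| * (n * |e.coord 0 m|) = n * (|r₁| * |e.coord 0 m|) := by ring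
      _ < |r₂| * |e.coord 1 m| := hm.2
      _ ≤ |r₁| * |e.coord 1 m| := by gcongr

theorem exists_stable_refinement_of_eigenvectors {ξ η : Plane →ₗ[ℝ] ℝ}
    {f : Module.Basis (Fin 2) ℝ Plane} (hf : Submodule.span ℤ (Set.range f) = N)
    (hdet : ξ (f 0) * η (f 1) - η (f 0) * ξ (f 1) ≠ 0) {φ : N →ₗ[ℤ] N} {Δ : Fan N}
    (hΔ : Δ.IsComplete) {r₁ r₂ : ℝ} (hr : |r₂| < |r₁|) (hξ : ∀ n : N, ξ (φ n) = r₁ * ξ n)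
    (hη : ∀ n : N, η (φ n) = r₂ * η n) {u w : Plane} (huN : u ∈ N) (hwN : w ∈ N) (hu0 : u ≠ 0)
    (hw0 : w ≠ 0) (hu : η u = 0) (hw : ξ w = 0) :
    ∃ Δ' : Fan N, Δ'.Refines Δ ∧ Toric.IsAlgebraicallyStable Δ' φ ∧
      ∃ N' : Submodule ℤ Plane, N' ≤ N ∧
        N'.toAddSubgroup.relIndex N.toAddSubgroup ≠ 0 ∧ Δ'.IsRegular N' := by
  have hinj : ∀ x : Plane, ξ x = 0 → η x = 0 → x = 0 := fun x h1 h2 =>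
    eq_zero_of_area_eq_zero (e := f) fun z => by
      have := area_eq_mul f ξ η z x
      rw [h1, h2] at this
      simpa [hdet] using this.symm
  have hξu : ξ u ≠ 0 := fun h => hu0 (hinj u h hu)
  have hηw : η w ≠ 0 := fun h => hw0 (hinj w hw h)
  obtain ⟨G, hG, hGN, hGΔ⟩ := Δ.exists_finite_generators
  obtain ⟨δ, hδ, hδG⟩ := exists_pos_mul_le hG ξ η
  -- Stretching `e 0 = p u` shrinks the first coordinate, so that every generator of `Δ` off `η = 0`
  -- satisfies `|x 0| ≤ |x 1|` and avoids the attracting sectors.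
  obtain ⟨p, hp⟩ := exists_nat_gt (|η w| / (δ * |ξ u|))
  have hp0 : (0 : ℝ) < p := lt_of_le_of_lt (by positivity) hp
  rw [div_lt_iff₀ (mul_pos hδ (abs_pos.2 hξu))] at hp
  obtain ⟨e, he0, he1⟩ := exists_basis_of_ne_zero (ξ := ξ) (η := η) (u := (p : ℝ) • u) (w := w) (by
    rw [map_smul, map_smul, hu, hw, smul_eq_mul, smul_zero, zero_mul, sub_zero]
    exact mul_ne_zero (mul_ne_zero hp0.ne' hξu) hηw)
  have hx : ∀ x, x = e.coord 0 x • e 0 + e.coord 1 x • e 1 := fun x => by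
    conv_lhs => rw [← e.sum_repr x, Fin.sum_univ_two]
    rfl
  have hξe : ∀ x, ξ x = (p * ξ u) * e.coord 0 x := fun x => by
    conv_lhs => rw [hx x, he0, he1]
    rw [map_add, map_smul, map_smul, map_smul, hw]
    simp only [smul_eq_mul]
    ring
  have hηe : ∀ x, η x = η w * e.coord 1 x := fun x => by
    conv_lhs => rw [hx x, he0, he1]
    rw [map_add, map_smul, map_smul, map_smul, hu]
    simp only [smul_eq_mul]
    ring
  have heN : ∀ i, e i ∈ N := by
    intro i
    fin_cases i
    · change e 0 ∈ N
      rw [he0, Nat.cast_smul_eq_nsmul]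
      exact nsmul_mem huN p
    · change e 1 ∈ N
      rwa [he1]
  obtain ⟨k, hk0, hk⟩ := exists_nat_smul_mem_span hf heN
  refine exists_stable_refinement_of_basis heN hk0 hk hΔ hr (fun n => ?_) (fun n => ?_) hG hGN hGΔ
    fun g hg hg1 => ?_
  · have h := hξ n
    rw [hξe (φ n), hξe n, mul_left_comm] at h
    exact mul_left_cancel₀ (mul_ne_zero hp0.ne' hξu) h
  · have h := hη n
    rw [hηe (φ n), hηe n, mul_left_comm] at h
    exact mul_left_cancel₀ hηw h
  · have h := hδG g hg (by rw [hηe]; exact mul_ne_zero hηw hg1)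
    rw [hξe g, hηe g, abs_mul, abs_mul, abs_mul, Nat.abs_cast] at h
    refine le_of_mul_le_mul_left (h.trans' ?_) (abs_pos.2 hηw)
    calc |η w| * |e.coord 0 g| ≤ p * (δ * |ξ u|) * |e.coord 0 g| := by gcongr
      _ = _ := by ring

end
end

/-! ### The two cases together -/

theorem proposition1 (N : Submodule ℤ Plane) [DiscreteTopology N] [IsZLattice ℝ N]
    (φ : N →ₗ[ℤ] N) (Δ : Fan N) (hcomplete : Δ.IsComplete) (hregular : Δ.IsRegular N)
    (ρ₁ ρ₂ : ℂ)
    (hρ : ((LinearMap.charpoly φ).map (Int.castRingHom ℂ)).roots = {ρ₁, ρ₂})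
    (hlt : ‖ρ₂‖ < ‖ρ₁‖) :
    ∃ Δ' : Fan N, Δ'.Refines Δ ∧ Toric.IsAlgebraicallyStable Δ' φ ∧
      ∃ N' : Submodule ℤ Plane, N' ≤ N ∧
        N'.toAddSubgroup.relIndex N.toAddSubgroup ≠ 0 ∧ Δ'.IsRegular N' := by
  have : Module.Finite ℤ N := ZLattice.module_finite ℝ N
  have : Module.Free ℤ N := ZLattice.module_free ℝ N
  have hrank : Module.finrank ℤ N = 2 := by
    rw [ZLattice.rank ℝ N]
    simp
  let b : Module.Basis (Fin 2) ℤ N := Module.finBasisOfFinrankEq ℤ N hrank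
  let f : Module.Basis (Fin 2) ℝ Plane := b.ofZLatticeBasis ℝ N
  have hfb : ∀ i, f i = b i := fun i => b.ofZLatticeBasis_apply ℝ N i
  have hf : Submodule.span ℤ (Set.range f) = N := b.ofZLatticeBasis_span ℝ
  rw [← LinearMap.charpoly_toMatrix φ b] at hρ
  obtain ⟨r₁, r₂, hr, hr₁, hr₂⟩ := Matrix.exists_real_roots_of_charpoly_roots hρ hlt
  obtain ⟨ξ, hξ0, hξ⟩ := exists_eigenform b hfb φ hr₁
  obtain ⟨η, hη0, hη⟩ := exists_eigenform b hfb φ hr₂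
  have hne : r₁ ≠ r₂ := fun h => hr.ne (by rw [h])
  have hdet := eigenforms_independent b hfb hne hξ0 hη0 hξ hη
  have hdet' : η (f 0) * ξ (f 1) - ξ (f 0) * η (f 1) ≠ 0 := fun h =>
    hdet (by linear_combination -h)
  by_cases h0 : ∀ n ∈ N, n ≠ 0 → ξ n ≠ 0 ∧ η n ≠ 0
  · exact exists_stable_refinement_of_forall_ne_zero hf hdet hcomplete hr hξ hη h0
  · push Not at h0
    obtain ⟨n, hn, hn0, h⟩ := h0
    have hn0' : (⟨n, hn⟩ : N) ≠ 0 := fun h => hn0 (congrArg Subtype.val h)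
    by_cases hξn : ξ n = 0
    · obtain ⟨u, hu0, hu⟩ := exists_eigenvector_of_eigenvector hf hdet hne hξ hη hn0' hξn
      exact exists_stable_refinement_of_eigenvectors hf hdet hcomplete hr hξ hη u.2 hn
        (fun h => hu0 (Subtype.ext h)) hn0 hu hξn
    -- Here the lattice vector lies on `η = 0`, so the roles of `ξ` and `η` are exchanged.
    · obtain ⟨u, hu0, hu⟩ := exists_eigenvector_of_eigenvector hf hdet' hne.symm hη hξ hn0' (h hξn)
      exact exists_stable_refinement_of_eigenvectors hf hdet hcomplete hr hξ hη hn u.2 hn0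
        (fun h => hu0 (Subtype.ext h)) (h hξn) hu
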